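/- Conventions. A real entire function is an entire function whose restriction to $\mathbb{R}$ is real-valued. An entire function $G$ has exponential type $\tau$ if $\limsup_{|z|\to\infty}\frac{\log|G(z)|}{|z|}\le\tau$. For $g:\mathbb{C}\to\mathbb{C}$ integrable on $\mathbb{R}$, $\widehat g(\xi)=\int_{-\infty}^{\infty}g(x)e^{-2\pi i x\xi}\,dx$. The notation $\ll_m$ means $\le C_m\,\cdot$ with a constant $C_m>0$ depending only on $m$. Lemma (Extremal functions for $f_{2m+1,\alpha}$). Let $m\ge 0$ be an integer and let $\tfrac12\le\alpha\le1$ and $\Delta\ge1$ be real. Let $$f_{2m+1,\alpha}(x)=\frac12\int_{\alpha}^{3/2}(\sigma-\alpha)^{2m}\log\left(\frac{1+x^2}{(\sigma-\frac12)^2+x^2}\right)d\sigma .$$ Then there is a unique pair of real entire functions $g^{-}=g^{-}_{2m+1,\alpha,\Delta}$ and $g^{+}=g^{+}_{2m+1,\alpha,\Delta}$ such that (i) $g^{\pm}$ have exponential type $2\pi\Delta$; (ii) $g^{-}(x)\le f_{2m+1,\alpha}(x)\le g^{+}(x)$ for all $x\in\mathbb{R}$; (iii) subject to (i) and (ii),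 the value in $[0,\infty]$ of the integral $\int_{-\infty}^{\infty}\{g^{+}(x)-g^{-}(x)\}\,dx$ is minimized. The functions $g^{\pm}$ are even and satisfy: (iv) for all real $x$, $|g^{\pm}(x)|\ll_m\dfrac1{1+x^2}$, and for all complex $z=x+iy$, $|g^{\pm}(z)|\ll_m\dfrac{\Delta^2e^{2\pi\Delta|y|}}{1+\Delta|z|}$; (v) the Fourier transforms $\widehat g^{\,\pm}$ are continuous functions supported on $[-\Delta,\Delta]$ and satisfy $|\widehat g^{\,\pm}(\xi)|\ll_m1$ for all real $\xi$; (vi) the functions $g^{+}-f_{2m+1,\alpha}$ and $f_{2m+1,\alpha}-g^{-}$ are integrable on $\mathbb{R}$, with $$\int_{-\infty}^{\infty}\{g^{+}(x)-f_{2m+1,\alpha}(x)\}\,dx=-\frac1\Delta\int_{\alpha}^{3/2}(\sigma-\alpha)^{2m}\log\left(\frac{1-e^{-2\pi(\sigma-\frac12)\Delta}}{1-e^{-2\pi\Delta}}\right)d\sigma,$$ $$\int_{-\infty}^{\infty}\{f_{2m+1,\alpha}(x)-g^{-}(x)\}\,dx=\frac1\Delta\int_{\alpha}^{3/2}(\sigma-\alpha)^{2m}\log\left(\frac{1+e^{-2\pi(\sigma-\frac12)\Delta}}{1+e^{-2\pi\Delta}}\right)d\sigma;$$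 (vii) $$\widehat g^{\,\pm}(0)=\frac{\pi(\frac32-\alpha)^{2m+2}}{(2m+1)(2m+2)}-\frac1\Delta\int_{\alpha}^{3/2}(\sigma-\alpha)^{2m}\log\left(\frac{1\mp e^{-2\pi(\sigma-\frac12)\Delta}}{1\mp e^{-2\pi\Delta}}\right)d\sigma;$$ (viii) $\widehat g^{\,\pm}$ are even functions and, for $0<\xi<\Delta$, $$\widehat g^{\,\pm}(\xi)=\frac12\sum_{k=-\infty}^{\infty}(\pm1)^k\left[\frac{k+1}{|\xi+k\Delta|}\left(\frac{(2m)!\,e^{-2\pi|\xi+k\Delta|(\alpha-\frac12)}}{(2\pi|\xi+k\Delta|)^{2m+1}}-\sum_{j=0}^{2m+1}\frac{\gamma_j\,e^{-2\pi|\xi+k\Delta|}}{(2\pi|\xi+k\Delta|)^{j}}\left(\tfrac32-\alpha\right)^{2m+1-j}\right)\right],$$ where $\gamma_j=\frac{(2m)!}{(2m+1-j)!}$ for $0\le j\le 2m+1$. The series converge absolutely, except when $m=0$ and $\alpha=\tfrac12$; in that case the series for $\widehat g^{\,-}$ is the limit of $\sum_{k=-M}^{N}$ as $M,N\to\infty$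 independently, and the series for $\widehat g^{\,+}$ is the limit of the symmetric sums $\sum_{k=-N}^{N}$ as $N\to\infty$. -/

import Mathlib

open Filter Topology MeasureTheory
open scoped FourierTransform ENNReal

noncomputable section

/-- An entire function whose restriction to the real line is real-valued. -/
structure IsRealEntire (G : ℂ → ℂ) : Prop where
  entire : Differentiable ℂ G
  real_on_real : ∀ x : ℝ, (G (x : ℂ)).im = 0

/-- `G` has exponential type `τ`: the limsup of `log |G z| / |z|` as `|z| → ∞` is at most `τ`.
The quotient is taken in the extended reals, with `log 0 = -∞`. -/
def HasExpType (G : ℂ → ℂ) (τ : ℝ) : Prop :=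
  limsup (fun z : ℂ => ENNReal.log ‖G z‖ₑ / ((‖z‖ : ℝ) : EReal)) (cocompact ℂ) ≤ (τ : EReal)

/-- The usual growth condition is the limsup condition. -/
theorem hasExpType_iff (G : ℂ → ℂ) (τ : ℝ) :
    HasExpType G τ ↔
      ∀ ε : ℝ, 0 < ε → ∀ᶠ z in cocompact ℂ, ‖G z‖ ≤ Real.exp ((τ + ε) * ‖z‖) := by
  have key : ∀ (c : ℝ) (z : ℂ), 0 < ‖z‖ →
      (ENNReal.log ‖G z‖ₑ / ((‖z‖ : ℝ) : EReal) ≤ (c : EReal) ↔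
        ‖G z‖ ≤ Real.exp (c * ‖z‖)) := by
    intro c z hz
    rw [EReal.div_le_iff_le_mul (by exact_mod_cast hz) (EReal.coe_ne_top _)]
    have h1 : ((‖z‖ : ℝ) : EReal) * (c : EReal)
        = ENNReal.log (ENNReal.ofReal (Real.exp (c * ‖z‖))) := by
      rw [ENNReal.log_ofReal_of_pos (Real.exp_pos _), Real.log_exp, mul_comm c, EReal.coe_mul]
    rw [h1, ENNReal.log_le_log_iff, ← ofReal_norm,
      ENNReal.ofReal_le_ofReal_iff (Real.exp_pos _).le]
  have hpos : ∀ᶠ z in cocompact ℂ, 0 < ‖z‖ := by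
    filter_upwards [(tendsto_norm_cocompact_atTop (E := ℂ)).eventually_gt_atTop 0] with z hz
    exact hz
  unfold HasExpType
  rw [limsup_le_iff]
  constructor
  · intro h ε hε
    filter_upwards [h ((τ + ε : ℝ) : EReal) (by exact_mod_cast (by linarith : τ < τ + ε)), hpos]
      with z hz hz0
    exact (key _ z hz0).1 hz.le
  · intro h b hb
    obtain ⟨c, hc1, hc2⟩ := EReal.lt_iff_exists_real_btwn.1 hb
    have hc : τ < c := by exact_mod_cast hc1
    filter_upwards [h (c - τ) (by linarith), hpos] with z hz hz0
    refine lt_of_le_of_lt ((key c z hz0).2 ?_) hc2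
    simpa using hz

/-- The pair `(gm, gp)` consists of a minorant and a majorant of `f` that are real entire functions
of exponential type `τ`. -/
structure IsAdmissiblePair (f : ℝ → ℝ) (τ : ℝ) (gm gp : ℂ → ℂ) : Prop where
  realEntire_minor : IsRealEntire gm
  realEntire_major : IsRealEntire gp
  expType_minor : HasExpType gm τ
  expType_major : HasExpType gp τ
  minor_le : ∀ x : ℝ, (gm (x : ℂ)).re ≤ f x
  le_major : ∀ x : ℝ, f x ≤ (gp (x : ℂ)).re

/-- The integral over `ℝ` of `gp - gm`, as an element of `[0, ∞]`.
(For an admissible pair the integrand is nonnegative.) -/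
def pairGap (gm gp : ℂ → ℂ) : ℝ≥0∞ :=
  ∫⁻ x : ℝ, ENNReal.ofReal ((gp (x : ℂ)).re - (gm (x : ℂ)).re)

/-- An admissible pair for which the integral of `gp - gm` is minimal. -/
def IsExtremalPair (f : ℝ → ℝ) (τ : ℝ) (gm gp : ℂ → ℂ) : Prop :=
  IsAdmissiblePair f τ gm gp ∧
    ∀ hm hp : ℂ → ℂ, IsAdmissiblePair f τ hm hp → pairGap gm gp ≤ pairGap hm hp

/-- The function `f_{2m+1,α}`. -/
def fOdd (m : ℕ) (α x : ℝ) : ℝ :=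
  (1 / 2) * ∫ σ in α..(3 / 2),
    (σ - α) ^ (2 * m) * Real.log ((1 + x ^ 2) / ((σ - 1 / 2) ^ 2 + x ^ 2))

/-- `∫_α^{3/2} (σ - α)^{2m} log ((1 - s e^{-2π(σ-1/2)Δ}) / (1 - s e^{-2πΔ})) dσ`,
used with `s = 1` for the majorant and `s = -1` for the minorant. -/
def logRatioIntegral (m : ℕ) (α Δ s : ℝ) : ℝ :=
  ∫ σ in α..(3 / 2), (σ - α) ^ (2 * m) *
    Real.log ((1 - s * Real.exp (-2 * Real.pi * (σ - 1 / 2) * Δ)) /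
      (1 - s * Real.exp (-2 * Real.pi * Δ)))

/-- The coefficient `γ_j = (2m)! / (2m + 1 - j)!`, for `0 ≤ j ≤ 2m + 1`. -/
def gammaCoeff (m j : ℕ) : ℝ :=
  (Nat.factorial (2 * m) : ℝ) / (Nat.factorial (2 * m + 1 - j) : ℝ)

/-- The `k`-th term of the series for the Fourier transform at `ξ`, including the factor `1/2`;
`s = 1` for the majorant and `s = -1` for the minorant. -/
def fourierTerm (m : ℕ) (α Δ s ξ : ℝ) (k : ℤ) : ℝ :=
  (1 / 2) * (s ^ k * (((k : ℝ) + 1) / |ξ + k * Δ| *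
    ((Nat.factorial (2 * m) : ℝ) * Real.exp (-2 * Real.pi * |ξ + k * Δ| * (α - 1 / 2)) /
        (2 * Real.pi * |ξ + k * Δ|) ^ (2 * m + 1)
      - ∑ j ∈ Finset.range (2 * m + 2),
          gammaCoeff m j * Real.exp (-2 * Real.pi * |ξ + k * Δ|) /
            (2 * Real.pi * |ξ + k * Δ|) ^ j * (3 / 2 - α) ^ (2 * m + 1 - j))))

/-- The Fourier transform `ξ ↦ ∫ g(x) e^{-2πixξ} dx` of the restriction of `g` to `ℝ`. -/
def realFourier (g : ℂ → ℂ) : ℝ → ℂ :=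
  𝓕 (fun x : ℝ => g (x : ℂ))

theorem realFourier_eq (g : ℂ → ℂ) (ξ : ℝ) :
    realFourier g ξ
      = ∫ x : ℝ, g (x : ℂ) * Complex.exp (-2 * Real.pi * Complex.I * x * ξ) := by
  unfold realFourier
  rw [Real.fourier_eq']
  refine integral_congr_ae (Eventually.of_forall fun x => ?_)
  simp only [smul_eq_mul]
  rw [mul_comm]
  congr 2
  simp
  ring

/-- The doubly infinite series `∑ a k` has sum `S`, with both ends going to infinity
independently. -/
def HasBilateralSum (a : ℤ → ℂ) (S : ℂ) : Prop :=
  Tendsto (fun p : ℕ × ℕ => ∑ k ∈ Finset.Icc (-(p.1 : ℤ)) (p.2 : ℤ), a k) atTop (𝓝 S)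

/-- The symmetric partial sums `∑_{|k| ≤ N} a k` converge to `S`. -/
def HasSymmetricSum (a : ℤ → ℂ) (S : ℂ) : Prop :=
  Tendsto (fun N : ℕ => ∑ k ∈ Finset.Icc (-(N : ℤ)) (N : ℤ), a k) atTop (𝓝 S)

end

/-! Put `a = α - 1/2`. Since `log ((1+x²)/(b²+x²)) = ∫_b^1 2l/(x²+l²) dl`, exchanging integrals
exhibits `fOdd m α` as the positive superposition `∫_a^1 wt m a l / (x²+l²) dl` (`fOdd_eq`). For a
single `l`, the function `(cosh 2πΔl - cos 2πΔx) / ((cosh 2πΔl - s)(x²+l²))` is entire of type `2πΔ`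
and exceeds `1/(x²+l²)` by `(s - cos 2πΔx) / ((cosh 2πΔl - s)(x²+l²))`, which has the sign of `s =
±1` and vanishes at the nodes `cos 2πΔx = s`. Integration in `l` gives `extremal`. Its integral and
Fourier transform are computed for one `l` and then integrated by Fubini; the bound `wt ≤ l²` keeps
the estimates uniform down to `l = 0`.

Optimality and uniqueness (`one_sided_approximation`): for an integrable competitor `h`, the
function `F = s (h - extremal)` has type `2πΔ` and is nonnegative at the nodes. By Poisson summation
`∫ F` is formally a positive multiple of the sum of the node values, hence nonnegative. If it is not
positive, `F` vanishes at every node, and so does `F'`, except possibly at the origin, where `fOdd`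
may have a corner. After rescaling the nodes to the integers, twisted Poisson summation for `F` and
`F'` gives `F̂(θ) + F̂(θ-1) = 0` and `2πi (θ F̂(θ) + (θ-1) F̂(θ-1)) = F'(0)` on `[0,1)`. Thus `F̂`
is constant there, and continuity with `F̂(1) = 0` forces `F = 0` (`eq_zero_of_deriv_eq_zero`). As
`F` is only integrable, Poisson summation is applied to `F(z) (sin εz / εz)²` and `ε → 0`; the
control off the real axis comes from Phragmén–Lindelöf (`HasExpType.exists_bound_im`).

Series: for `0 ≤ ξ ≤ Δ` the transform is the integral of `π sinh (2π(Δ-ξ)l) / (cosh 2πΔl - s)`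
against `(l-a)^{2m+1}/(2m+1)`. The quotient is expanded in powers of `s e^{-2πΔl}` and integrated
term by term. Dominated convergence needs partial sums of size `O(1/l)`: for `s = -1` this holds
with independent cut-offs, for `s = 1` it is obtained for symmetric ones by pairing the two tails.
-/

/-! ### Entire functions of a complex variable -/

/-- The entire function `sin z / z`. -/
noncomputable def csinc (z : ℂ) : ℂ := dslope Complex.sin 0 z

theorem csinc_zero : csinc 0 = 1 := by
  simp [csinc, dslope_same]

theorem csinc_of_ne {z : ℂ} (hz : z ≠ 0) : csinc z = Complex.sin z / z := by
  rw [csinc, dslope_of_ne _ hz, slope_def_field]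
  simp

theorem mul_csinc (z : ℂ) : z * csinc z = Complex.sin z := by
  rcases eq_or_ne z 0 with rfl | hz
  · simp
  · rw [csinc_of_ne hz]
    field_simp

theorem csinc_neg (z : ℂ) : csinc (-z) = csinc z := by
  rcases eq_or_ne z 0 with rfl | hz
  · simp
  · rw [csinc_of_ne hz, csinc_of_ne (neg_ne_zero.2 hz), Complex.sin_neg, neg_div_neg_eq]

theorem differentiable_csinc : Differentiable ℂ csinc := by
  have h : DifferentiableOn ℂ (dslope Complex.sin 0) Set.univ :=
    (Complex.differentiableOn_dslope Filter.univ_mem).2 Complex.differentiable_sin.differentiableOn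
  exact differentiableOn_univ.1 h

theorem norm_exp_I_mul_le (z : ℂ) : ‖Complex.exp (z * Complex.I)‖ ≤ Real.exp |z.im| := by
  rw [Complex.norm_exp]
  apply Real.exp_le_exp.2
  simpa using neg_le_abs z.im

theorem Complex.norm_sin_le_exp (z : ℂ) : ‖Complex.sin z‖ ≤ Real.exp |z.im| := by
  have h1 := norm_exp_I_mul_le z
  have h2 := norm_exp_I_mul_le (-z)
  rw [Complex.neg_im, abs_neg] at h2
  rw [Complex.sin, norm_div, norm_mul, Complex.norm_I, mul_one]
  have := norm_sub_le (Complex.exp (-z * Complex.I)) (Complex.exp (z * Complex.I))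
  simp only [Complex.norm_ofNat]
  linarith

theorem Complex.norm_cos_le_exp (z : ℂ) : ‖Complex.cos z‖ ≤ Real.exp |z.im| := by
  have h1 := norm_exp_I_mul_le z
  have h2 := norm_exp_I_mul_le (-z)
  rw [Complex.neg_im, abs_neg] at h2
  rw [Complex.cos, norm_div]
  have := norm_add_le (Complex.exp (z * Complex.I)) (Complex.exp (-z * Complex.I))
  simp only [Complex.norm_ofNat]
  linarith

/-- Mean value inequality for `sin` between `0` and `z`, inside the convex strip `|Im w| ≤ |Im z|`,
where `cos` is bounded by `e^{|Im z|}`. -/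
theorem norm_csinc_le (z : ℂ) : ‖csinc z‖ ≤ Real.exp |z.im| := by
  rcases eq_or_ne z 0 with rfl | hz
  · simp [csinc_zero]
  have hconv : Convex ℝ {w : ℂ | |w.im| ≤ |z.im|} := by
    have : {w : ℂ | |w.im| ≤ |z.im|} = Complex.imLm ⁻¹' (Set.Icc (-|z.im|) |z.im|) := by
      ext w; simp [abs_le]
    rw [this]
    exact (convex_Icc _ _).linear_preimage _
  have h0 : (0 : ℂ) ∈ {w : ℂ | |w.im| ≤ |z.im|} := by simp
  have h1 : z ∈ {w : ℂ | |w.im| ≤ |z.im|} := by simp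
  have h := hconv.norm_image_sub_le_of_norm_hasDerivWithin_le (𝕜 := ℂ) (f := Complex.sin)
    (f' := Complex.cos) (x := 0) (y := z) (C := Real.exp |z.im|)
    (fun w _ => (Complex.hasDerivAt_sin w).hasDerivWithinAt)
    (fun w hw => (Complex.norm_cos_le_exp w).trans (Real.exp_le_exp.2 hw))
    h0 h1
  rw [csinc_of_ne hz, norm_div, div_le_iff₀ (norm_pos_iff.2 hz)]
  simpa using h

theorem norm_mul_norm_csinc_le (z : ℂ) : ‖z‖ * ‖csinc z‖ ≤ Real.exp |z.im| := by
  rw [← norm_mul, mul_csinc]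
  exact Complex.norm_sin_le_exp z

theorem one_add_norm_mul_norm_csinc_le (z : ℂ) :
    (1 + ‖z‖) * ‖csinc z‖ ≤ 2 * Real.exp |z.im| := by
  have := norm_csinc_le z
  have := norm_mul_norm_csinc_le z
  nlinarith

theorem csinc_ofReal (x : ℝ) : csinc x = (Real.sinc x : ℂ) := by
  rcases eq_or_ne x 0 with rfl | hx
  · simp [csinc_zero]
  · rw [csinc_of_ne (by exact_mod_cast hx), Real.sinc_of_ne_zero hx]
    simp

/-- An integral over a bounded interval of entire functions depending continuously on the
parameter is entire. -/
theorem differentiable_setIntegral_mul {a b : ℝ} {W : ℝ → ℂ} {K : ℝ → ℂ → ℂ}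
    (hW : IntegrableOn W (Set.Ioc a b)) (hK : Continuous (Function.uncurry K))
    (hd : ∀ t, Differentiable ℂ (K t)) :
    Differentiable ℂ (fun z => ∫ t in Set.Ioc a b, W t * K t z) := by
  intro z₀
  have hcpt : IsCompact (Set.Icc a b ×ˢ Metric.closedBall z₀ 2) :=
    isCompact_Icc.prod (isCompact_closedBall z₀ 2)
  obtain ⟨C, hC⟩ := hcpt.exists_bound_of_continuousOn hK.continuousOn
  have hKt : ∀ t ∈ Set.Ioc a b, ∀ z ∈ Metric.closedBall z₀ 2, ‖K t z‖ ≤ C := fun t ht z hz =>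
    hC (t, z) ⟨Set.Ioc_subset_Icc_self ht, hz⟩
  have hmeas : ∀ z, AEStronglyMeasurable (fun t => W t * K t z)
      (volume.restrict (Set.Ioc a b)) := fun z =>
    hW.aestronglyMeasurable.mul
      (hK.comp (by fun_prop : Continuous fun t : ℝ => (t, z))).aestronglyMeasurable
  -- Cauchy's estimate on unit circles: centred in the ball of radius 1, they stay in the ball of
  -- radius 2 where `K` is bounded by `C`.
  have hder : ∀ t ∈ Set.Ioc a b, ∀ z ∈ Metric.ball z₀ 1, ‖deriv (K t) z‖ ≤ C := by
    intro t ht z hz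
    have := Complex.norm_deriv_le_of_forall_mem_sphere_norm_le (c := z) (R := 1) (C := C) (f := K t)
      one_pos (hd t).diffContOnCl fun w hw => hKt t ht w ?_
    · simpa using this
    · have h1 : dist w z = 1 := hw
      have h2 : dist z z₀ < 1 := hz
      have := dist_triangle w z z₀
      simp only [Metric.mem_closedBall]
      linarith
  have hmain := hasDerivAt_integral_of_dominated_loc_of_deriv_le
    (μ := volume.restrict (Set.Ioc a b)) (𝕜 := ℂ) (F := fun z t => W t * K t z)
    (F' := fun z t => W t * deriv (K t) z) (x₀ := z₀) (s := Metric.ball z₀ 1)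
    (bound := fun t => ‖W t‖ * C) (Metric.ball_mem_nhds z₀ one_pos)
    (Eventually.of_forall hmeas) ?_ ?_ ?_ ?_ ?_
  · exact hmain.2.differentiableAt
  · refine (hW.norm.mul_const C).mono' (hmeas z₀) ?_
    filter_upwards [ae_restrict_mem measurableSet_Ioc] with t ht
    rw [norm_mul]
    exact mul_le_mul_of_nonneg_left (hKt t ht z₀ (by simp)) (norm_nonneg _)
  · refine hW.aestronglyMeasurable.mul (Measurable.aestronglyMeasurable ?_)
    exact (measurable_deriv_with_param hK).comp (by fun_prop : Measurable fun t : ℝ => (t, z₀))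
  · filter_upwards [ae_restrict_mem measurableSet_Ioc] with t ht z hz
    rw [norm_mul]
    exact mul_le_mul_of_nonneg_left (hder t ht z hz) (norm_nonneg _)
  · exact hW.norm.mul_const C
  · exact Eventually.of_forall fun t z _ => ((hd t z).hasDerivAt).const_mul _

/-! ### Identity theorem and growth of functions of exponential type -/

theorem eq_of_eq_ofReal {F G : ℂ → ℂ} (hF : Differentiable ℂ F) (hG : Differentiable ℂ G)
    (h : ∀ x : ℝ, F x = G x) : F = G := by
  refine AnalyticOnNhd.eq_of_frequently_eq (z₀ := 0) (fun z _ => hF.analyticAt z)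
    (fun z _ => hG.analyticAt z) ?_
  have h1 : Tendsto (fun x : ℝ => (x : ℂ)) (𝓝[≠] 0) (𝓝[≠] 0) := by
    refine tendsto_nhdsWithin_of_tendsto_nhds_of_eventually_within _ ?_ ?_
    · have : Tendsto (fun x : ℝ => (x : ℂ)) (𝓝 0) (𝓝 ((0 : ℝ) : ℂ)) :=
        Complex.continuous_ofReal.tendsto 0
      rw [Complex.ofReal_zero] at this
      exact this.mono_left nhdsWithin_le_nhds
    · filter_upwards [self_mem_nhdsWithin] with x hx
      simpa using hx
  exact h1.frequently (Eventually.frequently (Eventually.of_forall h))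

/-- **Phragmén–Lindelöf** for a function of exponential type that is bounded on the real line. -/
theorem norm_le_mul_exp_abs_im {P : ℂ → ℂ} {A B M : ℝ} (hP : Differentiable ℂ P)
    (hB : 0 ≤ B) (hexp : ∀ z, ‖P z‖ ≤ A * Real.exp (B * ‖z‖)) (hreal : ∀ x : ℝ, ‖P x‖ ≤ M) (z : ℂ) :
    ‖P z‖ ≤ M * Real.exp (B * |z.im|) := by
  have key : ∀ Q : ℂ → ℂ, Differentiable ℂ Q → (∀ z, ‖Q z‖ ≤ A * Real.exp (B * ‖z‖)) →
      (∀ x : ℝ, ‖Q x‖ ≤ M) → ∀ z : ℂ, 0 ≤ z.im → ‖Q z‖ ≤ M * Real.exp (B * z.im) := by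
    intro Q hQ hQe hQr z hz
    have hA : 0 ≤ A := by simpa using (norm_nonneg _).trans (hQe 0)
    -- The upper half-plane is rotated to the right half-plane, so the real line becomes the
    -- imaginary axis; the factor `e^{-Bw}` makes `f` bounded on the positive real axis.
    set f : ℂ → ℂ := fun w => Q (w * Complex.I) * Complex.exp (-(B * w)) with hf
    have hfn : ∀ w, ‖f w‖ = ‖Q (w * Complex.I)‖ * Real.exp (-(B * w.re)) := by
      intro w
      simp [hf, Complex.norm_exp]
    have hfe : ∀ w, ‖f w‖ ≤ A * Real.exp (B * ‖w‖ + -(B * w.re)) := by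
      intro w
      rw [hfn, Real.exp_add, ← mul_assoc]
      gcongr
      simpa using hQe (w * Complex.I)
    have hfd : Differentiable ℂ f := by
      simp only [hf]
      exact (hQ.comp (by fun_prop)).mul (by fun_prop)
    have hbd := PhragmenLindelof.right_half_plane_of_bounded_on_real (C := M) (f := f)
      (z := z * -Complex.I) hfd.diffContOnCl ⟨1, by norm_num, B, ?_⟩ ?_ ?_ (by simpa using hz)
    · rw [hfn] at hbd
      have h1 : z * -Complex.I * Complex.I = z := by
        rw [mul_assoc, neg_mul, Complex.I_mul_I]; simp
      have h2 : (z * -Complex.I).re = z.im := by simp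
      rw [h1, h2, Real.exp_neg, ← div_eq_mul_inv, div_le_iff₀ (Real.exp_pos _)] at hbd
      exact hbd
    · refine Asymptotics.IsBigO.of_bound A ?_
      filter_upwards [mem_inf_of_right (mem_principal_self _)] with w hw
      rw [Real.rpow_one, Real.norm_of_nonneg (Real.exp_pos _).le]
      refine (hfe w).trans ?_
      gcongr
      have : 0 ≤ B * w.re := mul_nonneg hB (le_of_lt hw)
      linarith
    · refine isBoundedUnder_of_eventually_le (a := A) ?_
      filter_upwards [eventually_ge_atTop 0] with x hx
      refine (hfe x).trans ?_
      simp [abs_of_nonneg hx]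
    · intro x
      rw [hfn]
      have := hQr (-x)
      have h1 : (x : ℂ) * Complex.I * Complex.I = ((-x : ℝ) : ℂ) := by
        rw [mul_assoc, Complex.I_mul_I]; simp
      rw [h1]
      simpa using this
  rcases le_total 0 z.im with h | h
  · rw [abs_of_nonneg h]
    exact key P hP hexp hreal z h
  · have := key (fun w => P (-w)) (hP.comp differentiable_neg) (fun w => by simpa using hexp (-w))
      (fun x => by simpa using hreal (-x)) (-z) (by simpa using h)
    rw [abs_of_nonpos h]
    simpa using this

theorem HasExpType.exists_bound {F : ℂ → ℂ} {τ : ℝ} (hF : Differentiable ℂ F)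
    (h : HasExpType F τ) {ε : ℝ} (hε : 0 < ε) :
    ∃ A, ∀ z, ‖F z‖ ≤ A * Real.exp ((τ + ε) * ‖z‖) := by
  have h1 := (hasExpType_iff F τ).1 h ε hε
  obtain ⟨K, hK, hsub⟩ := mem_cocompact.1 h1
  obtain ⟨C, hC⟩ := hK.exists_bound_of_continuousOn (f := fun z => ‖F z‖ / Real.exp ((τ + ε) * ‖z‖))
    (Continuous.continuousOn (by
      have := hF.continuous
      exact (by fun_prop : Continuous fun z => ‖F z‖).div (by fun_prop) fun z => (Real.exp_pos _).ne'))
  refine ⟨max C 1, fun z => ?_⟩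
  by_cases hz : z ∈ K
  · have := hC z hz
    rw [Real.norm_of_nonneg (by positivity), div_le_iff₀ (Real.exp_pos _)] at this
    exact this.trans (by gcongr; exact le_max_left _ _)
  · have : ‖F z‖ ≤ Real.exp ((τ + ε) * ‖z‖) := hsub hz
    calc _ ≤ 1 * Real.exp ((τ + ε) * ‖z‖) := by simpa using this
      _ ≤ _ := by gcongr; exact le_max_right _ _

theorem hasExpType_of_bound {F : ℂ → ℂ} {τ : ℝ}
    (h : ∀ ε, 0 < ε → ∃ A, ∀ z, ‖F z‖ ≤ A * Real.exp ((τ + ε) * ‖z‖)) : HasExpType F τ := by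
  rw [hasExpType_iff]
  intro ε hε
  obtain ⟨A, hA⟩ := h (ε / 2) (by linarith)
  have h1 : Tendsto (fun z : ℂ => ε / 2 * ‖z‖) (cocompact ℂ) atTop :=
    (tendsto_norm_cocompact_atTop).const_mul_atTop (by linarith)
  filter_upwards [h1.eventually_ge_atTop A] with z hz
  calc ‖F z‖ ≤ A * Real.exp ((τ + ε / 2) * ‖z‖) := hA z
    _ ≤ Real.exp (ε / 2 * ‖z‖) * Real.exp ((τ + ε / 2) * ‖z‖) := by
        gcongr
        have := Real.add_one_le_exp (ε / 2 * ‖z‖)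
        linarith
    _ = _ := by rw [← Real.exp_add]; ring_nf

theorem HasExpType.sub {F G : ℂ → ℂ} {τ : ℝ} (hF : Differentiable ℂ F) (hG : Differentiable ℂ G)
    (h : HasExpType F τ) (h' : HasExpType G τ) : HasExpType (fun z => F z - G z) τ := by
  refine hasExpType_of_bound fun ε hε => ?_
  obtain ⟨A, hA⟩ := h.exists_bound hF hε
  obtain ⟨B, hB⟩ := h'.exists_bound hG hε
  exact ⟨A + B, fun z => (norm_sub_le _ _).trans (by rw [add_mul]; linarith [hA z, hB z])⟩

theorem HasExpType.comp_affine {F : ℂ → ℂ} {τ c : ℝ} (hF : Differentiable ℂ F)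
    (h : HasExpType F τ) (hτ : 0 ≤ τ) (hc : 0 < c) (d : ℂ) :
    HasExpType (fun z => F (c * z + d)) (c * τ) := by
  refine hasExpType_of_bound fun ε hε => ?_
  obtain ⟨A, hA⟩ := h.exists_bound hF (ε := ε / c) (by positivity)
  have hA0 : 0 ≤ A := by
    have := (norm_nonneg _).trans (hA 0)
    simpa using this
  refine ⟨A * Real.exp ((τ + ε / c) * ‖d‖), fun z => (hA _).trans ?_⟩
  rw [mul_assoc, ← Real.exp_add]
  gcongr
  have h1 : ‖(c : ℂ) * z + d‖ ≤ c * ‖z‖ + ‖d‖ := by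
    refine (norm_add_le _ _).trans ?_
    rw [norm_mul, Complex.norm_real, Real.norm_of_nonneg hc.le]
  have h2 : (c * τ + ε) * ‖z‖ = (τ + ε / c) * (c * ‖z‖) := by field_simp
  rw [h2, ← mul_add, add_comm ‖d‖]
  gcongr

/-- A function of exponential type that is integrable on the real line grows like `e^{τ|Im z|}`. -/
theorem HasExpType.exists_bound_im {F : ℂ → ℂ} {τ : ℝ} (hF : Differentiable ℂ F) (hτ : 0 ≤ τ)
    (h : HasExpType F τ) (hint : Integrable fun x : ℝ => F x) {ε : ℝ} (hε : 0 < ε) :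
    ∃ C, ∀ z : ℂ, ‖F z‖ ≤ C * Real.exp ((τ + ε) * |z.im|) := by
  obtain ⟨A, hA⟩ := h.exists_bound hF (half_pos hε)
  have hA0 : 0 ≤ A := by simpa using (norm_nonneg _).trans (hA 0)
  -- `P` is the primitive of `F` vanishing at `0`. Unlike `F`, it is visibly bounded on the real
  -- line, by the `L¹` norm of `F`. Phragmén–Lindelöf applies to `P`, and Cauchy's estimate brings
  -- the bound back to `F = P'`.
  set P : ℂ → ℂ := fun z => z * ∫ t in Set.Ioc (0 : ℝ) 1, (1 : ℂ) * F (t * z) with hPdef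
  have hcF := hF.continuous
  have hPd : Differentiable ℂ P := by
    refine differentiable_id.mul (differentiable_setIntegral_mul (W := fun _ => 1)
      (K := fun t z => F (t * z)) ?_ ?_ ?_)
    · exact (integrableOn_const_iff).2 (Or.inr (by simp))
    · exact hcF.comp (by fun_prop)
    · exact fun t => hF.comp (by fun_prop)
  have hPx : ∀ x : ℝ, P x = ∫ t in (0 : ℝ)..x, F t := by
    intro x
    have h1 := intervalIntegral.smul_integral_comp_mul_right (a := 0) (b := 1)
      (fun t : ℝ => F t) x
    simp only [zero_mul, one_mul] at h1
    rw [← h1, intervalIntegral.integral_of_le zero_le_one]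
    simp [hPdef]
  have hPder : deriv P = F := by
    refine eq_of_eq_ofReal hPd.deriv hF fun x => ?_
    have h1 : HasDerivAt (fun x : ℝ => P x) (deriv P x) x := (hPd x).hasDerivAt.comp_ofReal
    have h2 : HasDerivAt (fun x : ℝ => P x) (F x) x := by
      simp_rw [hPx]
      exact intervalIntegral.integral_hasDerivAt_right
        (Continuous.intervalIntegrable (by fun_prop) _ _)
        (Continuous.stronglyMeasurableAtFilter (by fun_prop) _ _)
        (Continuous.continuousAt (by fun_prop))
    exact h1.unique h2
  have hPr : ∀ x : ℝ, ‖P x‖ ≤ ∫ t : ℝ, ‖F t‖ := by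
    intro x
    rw [hPx]
    refine intervalIntegral.norm_integral_le_integral_norm_uIoc.trans ?_
    exact setIntegral_le_integral hint.norm (Eventually.of_forall fun t => norm_nonneg _)
  -- `F` was bounded with exponent `τ + ε/2`; the other `ε/2` absorbs the factor `‖z‖` in `P`.
  have hPe : ∀ z, ‖P z‖ ≤ (A * (2 / ε)) * Real.exp ((τ + ε) * ‖z‖) := by
    intro z
    have h1 : ‖∫ t in Set.Ioc (0 : ℝ) 1, (1 : ℂ) * F (t * z)‖
        ≤ A * Real.exp ((τ + ε / 2) * ‖z‖) * volume.real (Set.Ioc (0 : ℝ) 1) := by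
      refine norm_setIntegral_le_of_norm_le_const (by simp) fun t ht => ?_
      rw [one_mul]
      refine (hA _).trans ?_
      gcongr
      rw [norm_mul, Complex.norm_real, Real.norm_of_nonneg ht.1.le]
      exact mul_le_of_le_one_left (norm_nonneg _) ht.2
    have h2 : ‖z‖ ≤ 2 / ε * Real.exp (ε / 2 * ‖z‖) := by
      have := Real.add_one_le_exp (ε / 2 * ‖z‖)
      rw [div_mul_eq_mul_div, le_div_iff₀ hε]
      linarith
    simp only [hPdef, norm_mul]
    calc _ ≤ (2 / ε * Real.exp (ε / 2 * ‖z‖)) * (A * Real.exp ((τ + ε / 2) * ‖z‖)) := by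
          gcongr
          simpa using h1
      _ = (A * (2 / ε)) * (Real.exp (ε / 2 * ‖z‖) * Real.exp ((τ + ε / 2) * ‖z‖)) := by ring
      _ = _ := by rw [← Real.exp_add]; ring_nf
  have hPL := norm_le_mul_exp_abs_im hPd (by linarith) hPe hPr
  refine ⟨(∫ t : ℝ, ‖F t‖) * Real.exp (τ + ε), fun z => ?_⟩
  have hM : 0 ≤ ∫ t : ℝ, ‖F t‖ := integral_nonneg fun t => norm_nonneg _
  have := Complex.norm_deriv_le_of_forall_mem_sphere_norm_le (c := z) (R := 1)
    (C := (∫ t : ℝ, ‖F t‖) * Real.exp (τ + ε) * Real.exp ((τ + ε) * |z.im|)) (f := P)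
    one_pos hPd.diffContOnCl fun w hw => (hPL w).trans ?_
  · rw [hPder] at this
    simpa using this
  · rw [mul_assoc, ← Real.exp_add]
    gcongr
    have h1 : |(w - z).im| ≤ 1 := (Complex.abs_im_le_norm _).trans (by
      have : dist w z = 1 := hw
      rw [dist_eq_norm] at this
      exact this.le)
    have h2 : |w.im| ≤ 1 + |z.im| := by
      have : w.im = (w - z).im + z.im := by simp
      rw [this]
      exact (abs_add_le _ _).trans (by linarith)
    calc (τ + ε) * |w.im| ≤ (τ + ε) * (1 + |z.im|) := by gcongr
      _ = _ := by ring

/-! ### Paley–Wiener and Poisson summation -/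

theorem continuous_realFourier {g : ℂ → ℂ} (hg : Integrable fun x : ℝ => g x) :
    Continuous (realFourier g) := by
  unfold realFourier
  exact VectorFourier.fourierIntegral_continuous Real.continuous_fourierChar
    (by exact continuous_inner) hg

/-- Entire functions with `G z = O(e^{σ|Im z|} / (1 + (Re z)²))`. -/
def StripDecay (σ : ℝ) (G : ℂ → ℂ) : Prop :=
  Differentiable ℂ G ∧ ∃ C, ∀ z : ℂ, ‖G z‖ ≤ C * (Real.exp (σ * |z.im|) * (1 + z.re ^ 2)⁻¹)

namespace StripDecay

variable {σ : ℝ} {G : ℂ → ℂ}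

theorem exists_nonneg (h : StripDecay σ G) :
    ∃ C, 0 ≤ C ∧ ∀ z : ℂ, ‖G z‖ ≤ C * (Real.exp (σ * |z.im|) * (1 + z.re ^ 2)⁻¹) := by
  obtain ⟨C, hC⟩ := h.2
  refine ⟨C, ?_, hC⟩
  simpa using (norm_nonneg _).trans (hC 0)

theorem norm_ofReal_le (h : StripDecay σ G) : ∃ C, 0 ≤ C ∧ ∀ x : ℝ, ‖G x‖ ≤ C * (1 + x ^ 2)⁻¹ := by
  obtain ⟨C, hC, hb⟩ := h.exists_nonneg
  exact ⟨C, hC, fun x => by simpa using hb x⟩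

theorem integrable_line (h : StripDecay σ G) (y : ℝ) :
    Integrable fun x : ℝ => G (x + y * Complex.I) := by
  obtain ⟨C, hC⟩ := h.2
  have hc := h.1.continuous
  refine (integrable_inv_one_add_sq.const_mul (C * Real.exp (σ * |y|))).mono'
    (by fun_prop : Continuous fun x : ℝ => G (x + y * Complex.I)).aestronglyMeasurable
    (Eventually.of_forall fun x => ?_)
  have := hC (x + y * Complex.I)
  rw [mul_assoc]
  simpa using this

theorem integrable (h : StripDecay σ G) : Integrable fun x : ℝ => G x := by
  simpa using h.integrable_line 0

/-- Cauchy's theorem on the rectangles with real parts in `[-R, R]`: the vertical sides contribute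
`O(R⁻²)`. -/
theorem integral_line (h : StripDecay σ G) (y : ℝ) :
    ∫ x : ℝ, G (x + y * Complex.I) = ∫ x : ℝ, G x := by
  obtain ⟨C, hC0, hC⟩ := h.exists_nonneg
  have hside : ∀ c : ℝ, c = 1 ∨ c = -1 → Tendsto
      (fun R : ℝ => ∫ t in (0 : ℝ)..y, G ((c * R : ℝ) + t * Complex.I)) atTop (𝓝 0) := by
    intro c hc
    have hlim : Tendsto (fun R : ℝ => C * Real.exp (|σ| * |y|) * (1 + R ^ 2)⁻¹ * |y|)
        atTop (𝓝 0) := by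
      have h1 : Tendsto (fun R : ℝ => (1 + R ^ 2)⁻¹) atTop (𝓝 0) :=
        tendsto_inv_atTop_zero.comp
          (tendsto_atTop_add_const_left _ _ (tendsto_pow_atTop two_ne_zero))
      simpa using (h1.const_mul (C * Real.exp (|σ| * |y|))).mul_const |y|
    refine squeeze_zero_norm (fun R => ?_) hlim
    have := intervalIntegral.norm_integral_le_of_norm_le_const (a := 0) (b := y)
      (f := fun t : ℝ => G ((c * R : ℝ) + t * Complex.I))
      (C := C * Real.exp (|σ| * |y|) * (1 + R ^ 2)⁻¹) ?_
    · simpa using this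
    · intro t ht
      have ht' : |t| ≤ |y| := by
        rcases Set.mem_uIoc.1 ht with h1 | h1
        · rw [abs_of_pos h1.1, abs_of_pos (h1.1.trans_le h1.2)]; exact h1.2
        · rw [abs_of_nonpos h1.2, abs_of_neg (h1.1.trans_le h1.2)]; linarith [h1.1]
      refine (hC _).trans ?_
      have hre : (((c * R : ℝ) : ℂ) + t * Complex.I).re = c * R := by simp
      have him : (((c * R : ℝ) : ℂ) + t * Complex.I).im = t := by simp
      rw [hre, him, mul_assoc]
      have : (c * R) ^ 2 = R ^ 2 := by rcases hc with rfl | rfl <;> ring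
      rw [this]
      gcongr
      exact le_abs_self σ
  have hrect : ∀ R : ℝ, (∫ x in (-R)..R, G (x + y * Complex.I)) =
      (∫ x in (-R)..R, G x) + Complex.I * (∫ t in (0 : ℝ)..y, G ((1 * R : ℝ) + t * Complex.I))
      - Complex.I * (∫ t in (0 : ℝ)..y, G ((-1 * R : ℝ) + t * Complex.I)) := by
    intro R
    have := Complex.integral_boundary_rect_eq_zero_of_differentiableOn G (-R : ℂ) (R + y * Complex.I)
      h.1.differentiableOn
    simp only [Complex.neg_re, Complex.ofReal_re, Complex.add_re, Complex.mul_re, Complex.I_re,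
      mul_zero, Complex.ofReal_im, Complex.I_im, mul_one, sub_self, add_zero, Complex.neg_im,
      neg_zero, Complex.add_im, Complex.mul_im, zero_add, smul_eq_mul, Complex.ofReal_zero,
      zero_mul] at this
    simp only [one_mul, neg_mul]
    linear_combination -this
  have hl := intervalIntegral_tendsto_integral (h.integrable_line y) tendsto_neg_atTop_atBot
    tendsto_id
  have hr := intervalIntegral_tendsto_integral h.integrable tendsto_neg_atTop_atBot tendsto_id
  have hr' := (hr.add ((hside 1 (Or.inl rfl)).const_mul Complex.I)).sub
    ((hside (-1) (Or.inr rfl)).const_mul Complex.I)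
  rw [mul_zero, add_zero, sub_zero] at hr'
  refine tendsto_nhds_unique hl (hr'.congr fun R => ?_)
  exact (hrect R).symm

theorem norm_mul_exp (G : ℂ → ℂ) (θ : ℝ) (z : ℂ) :
    ‖G z * Complex.exp (-2 * Real.pi * Complex.I * z * θ)‖
      = ‖G z‖ * Real.exp (2 * Real.pi * (z.im * θ)) := by
  rw [norm_mul, Complex.norm_exp]
  congr 2
  simp
  ring

theorem mul_exp (h : StripDecay σ G) (θ : ℝ) : StripDecay (σ + 2 * Real.pi * |θ|)
    (fun z => G z * Complex.exp (-2 * Real.pi * Complex.I * z * θ)) := by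
  obtain ⟨C, hC0, hC⟩ := h.exists_nonneg
  refine ⟨h.1.mul (by fun_prop), C, fun z => ?_⟩
  rw [norm_mul_exp, add_mul, Real.exp_add]
  have hexp : Real.exp (2 * Real.pi * (z.im * θ)) ≤ Real.exp (2 * Real.pi * |θ| * |z.im|) := by
    rw [mul_assoc (2 * Real.pi) |θ|]
    have : z.im * θ ≤ |θ| * |z.im| := by
      rw [mul_comm, ← abs_mul]; exact le_abs_self _
    gcongr
  calc _ ≤ C * (Real.exp (σ * |z.im|) * (1 + z.re ^ 2)⁻¹) * Real.exp (2 * Real.pi * |θ| * |z.im|) :=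
        mul_le_mul (hC z) hexp (Real.exp_pos _).le (by positivity)
    _ = _ := by ring

/-- The easy half of Paley–Wiener: moving the line of integration to height `cT`, with `c = ±1` of
sign opposite to `ξ`, bounds the integral by a constant times `e^{(σ - 2π|ξ|)T}`, and `T → ∞`. -/
theorem realFourier_eq_zero (h : StripDecay σ G) {ξ : ℝ} (hξ : σ < 2 * Real.pi * |ξ|) :
    realFourier G ξ = 0 := by
  obtain ⟨C, hC0, hC⟩ := h.exists_nonneg
  obtain ⟨c, hc, hcξ⟩ : ∃ c : ℝ, |c| = 1 ∧ c * ξ = -|ξ| := by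
    rcases le_total 0 ξ with h | h
    · exact ⟨-1, by simp, by rw [abs_of_nonneg h]; ring⟩
    · exact ⟨1, by simp, by rw [abs_of_nonpos h]; ring⟩
  rw [realFourier_eq]
  have hH := h.mul_exp ξ
  have hb : ∀ T : ℝ, 0 ≤ T → ‖∫ x : ℝ, G x * Complex.exp (-2 * Real.pi * Complex.I * x * ξ)‖
      ≤ Real.exp ((σ - 2 * Real.pi * |ξ|) * T) * (C * ∫ x : ℝ, (1 + x ^ 2)⁻¹) := by
    intro T hT
    have hline := hH.integral_line (c * T)
    rw [← hline, ← integral_const_mul, ← integral_const_mul]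
    refine norm_integral_le_of_norm_le
      ((integrable_inv_one_add_sq.const_mul C).const_mul _) (Eventually.of_forall fun x => ?_)
    rw [norm_mul_exp]
    have hre : ((x : ℂ) + ((c * T : ℝ) : ℂ) * Complex.I).re = x := by simp
    have him : ((x : ℂ) + ((c * T : ℝ) : ℂ) * Complex.I).im = c * T := by simp
    have := hC ((x : ℂ) + ((c * T : ℝ) : ℂ) * Complex.I)
    rw [hre, him, abs_mul, hc, one_mul, abs_of_nonneg hT] at this
    rw [him]
    calc _ ≤ C * (Real.exp (σ * T) * (1 + x ^ 2)⁻¹) * Real.exp (2 * Real.pi * (c * T * ξ)) := by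
          gcongr
      _ = (Real.exp (σ * T) * Real.exp (2 * Real.pi * (c * T * ξ))) * (C * (1 + x ^ 2)⁻¹) := by ring
      _ = _ := by
        rw [← Real.exp_add, show c * T * ξ = T * (c * ξ) by ring, hcξ]
        congr 2
        ring
  have hlim : Tendsto (fun T : ℝ => Real.exp ((σ - 2 * Real.pi * |ξ|) * T) *
      (C * ∫ x : ℝ, (1 + x ^ 2)⁻¹)) atTop (𝓝 0) := by
    have : Tendsto (fun T : ℝ => (σ - 2 * Real.pi * |ξ|) * T) atTop atBot :=
      tendsto_id.const_mul_atTop_of_neg (by linarith)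
    have h2 := (Real.tendsto_exp_atBot.comp this).mul_const (C * ∫ x : ℝ, (1 + x ^ 2)⁻¹)
    rwa [zero_mul] at h2
  have := ge_of_tendsto hlim ((eventually_ge_atTop 0).mono hb)
  simpa using this

/-- Cauchy's estimate on the unit circle about `z`. There `|Re w - Re z| ≤ 1` gives `1 + (Re z)² ≤ 3
(1 + (Re w)²)`, and `|Im w| ≤ 1 + |Im z|` costs the factor `e^σ`. -/
theorem deriv (hσ : 0 ≤ σ) (h : StripDecay σ G) : StripDecay σ (deriv G) := by
  obtain ⟨C, hC0, hC⟩ := h.exists_nonneg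
  refine ⟨h.1.deriv, C * Real.exp σ * 3, fun z => ?_⟩
  have := Complex.norm_deriv_le_of_forall_mem_sphere_norm_le (c := z) (R := 1)
    (C := C * Real.exp σ * 3 * (Real.exp (σ * |z.im|) * (1 + z.re ^ 2)⁻¹)) (f := G)
    one_pos h.1.diffContOnCl fun w hw => (hC w).trans ?_
  · simpa using this
  · have hd : ‖w - z‖ ≤ 1 := by
      have : dist w z = 1 := hw
      rw [dist_eq_norm] at this
      exact this.le
    have h1 : |(w - z).im| ≤ 1 := (Complex.abs_im_le_norm _).trans hd
    have h2 : |w.im| ≤ 1 + |z.im| := by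
      have : w.im = (w - z).im + z.im := by simp
      rw [this]
      exact (abs_add_le _ _).trans (by linarith)
    have h3 : |w.re - z.re| ≤ 1 := by
      simpa using (Complex.abs_re_le_norm (w - z)).trans hd
    have h4 : (w.re - z.re) ^ 2 ≤ 1 := by
      rw [← sq_abs]; nlinarith [abs_nonneg (w.re - z.re)]
    have h5 : (1 + w.re ^ 2)⁻¹ ≤ 3 * (1 + z.re ^ 2)⁻¹ := by
      rw [← div_eq_mul_inv, inv_eq_one_div, div_le_div_iff₀ (by positivity) (by positivity)]
      nlinarith [sq_nonneg (w.re + (w.re - z.re))]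
    have h6 : Real.exp (σ * |w.im|) ≤ Real.exp σ * Real.exp (σ * |z.im|) := by
      rw [← Real.exp_add]
      gcongr
      nlinarith
    calc _ ≤ C * ((Real.exp σ * Real.exp (σ * |z.im|)) * (3 * (1 + z.re ^ 2)⁻¹)) := by gcongr
      _ = _ := by ring

theorem summable_int (h : StripDecay σ G) : Summable fun n : ℤ => G (n : ℂ) := by
  obtain ⟨C, hC0, hC⟩ := h.norm_ofReal_le
  have h2 : Summable fun n : ℤ => C * |((n : ℝ))| ^ (-2 : ℝ) :=
    (Real.summable_abs_int_rpow one_lt_two).mul_left C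
  refine Summable.of_norm_bounded_eventually h2 ?_
  filter_upwards [(Set.finite_singleton (0 : ℤ)).compl_mem_cofinite] with n hn
  have hn0 : (n : ℝ) ≠ 0 := by exact_mod_cast hn
  have := hC n
  rw [Real.rpow_neg (abs_nonneg _), Real.rpow_two, sq_abs]
  refine (by simpa using this : ‖G (n : ℂ)‖ ≤ C * (1 + (n : ℝ) ^ 2)⁻¹).trans ?_
  gcongr
  linarith

/-- Summability on the frequency side is automatic: the transform is nonzero at only finitely many
integers. -/
theorem tsum_int_eq (h : StripDecay σ G) :
    ∑' n : ℤ, G (n : ℂ) = ∑' n : ℤ, realFourier G n := by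
  obtain ⟨C, hC0, hC⟩ := h.norm_ofReal_le
  have hc := h.1.continuous
  have hsum : Summable fun n : ℤ => 𝓕 (fun x : ℝ => G x) n := by
    refine summable_of_hasFiniteSupport ?_
    refine (Set.finite_Icc (-⌈|σ|⌉) ⌈|σ|⌉).subset fun n hn => ?_
    by_contra hout
    refine hn (h.realFourier_eq_zero ?_)
    have h1 : |σ| < |(n : ℝ)| := by
      refine (Int.le_ceil _).trans_lt ?_
      rw [← Int.cast_abs]
      norm_cast
      by_contra hle
      exact hout (abs_le.1 (not_lt.1 hle))
    have hpi : 1 < 2 * Real.pi := by linarith [Real.pi_gt_three]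
    calc σ ≤ |σ| := le_abs_self _
      _ < |(n : ℝ)| := h1
      _ ≤ _ := le_mul_of_one_le_left (abs_nonneg _) hpi.le
  have := Real.tsum_eq_tsum_fourier_of_rpow_decay_of_summable (f := fun x : ℝ => G x)
    (by fun_prop) one_lt_two ?_ hsum 0
  · simpa [realFourier] using this
  · refine Asymptotics.IsBigO.of_bound C ?_
    have h0 : ∀ᶠ x : ℝ in cocompact ℝ, x ≠ 0 :=
      (isCompact_singleton (x := (0 : ℝ))).compl_mem_cocompact
    filter_upwards [h0] with x hx
    rw [Real.rpow_neg (abs_nonneg _), Real.rpow_two, sq_abs, Real.norm_of_nonneg (by positivity)]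
    refine (hC x).trans ?_
    gcongr
    linarith

/-- Poisson summation with a twist, for functions whose Fourier transform is supported in
`[-2, 2]`. -/
theorem tsum_int_mul_exp (hσ : σ < 4 * Real.pi) (h : StripDecay σ G) {θ : ℝ} (h0 : 0 ≤ θ)
    (h1 : θ < 1) :
    ∑' n : ℤ, G (n : ℂ) * Complex.exp (-2 * Real.pi * Complex.I * n * θ) =
      realFourier G (θ - 2) + realFourier G (θ - 1) + realFourier G θ + realFourier G (θ + 1) := by
  rw [(h.mul_exp θ).tsum_int_eq]
  have hshift : ∀ n : ℤ, realFourier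
      (fun z => G z * Complex.exp (-2 * Real.pi * Complex.I * z * θ)) n = realFourier G (θ + n) := by
    intro n
    rw [realFourier_eq, realFourier_eq]
    congr 1 with x
    rw [mul_assoc, ← Complex.exp_add]
    congr 2
    push_cast
    ring
  simp_rw [hshift]
  -- The transform vanishes for `|ξ| ≥ 2` because `σ < 4π`; with `0 ≤ θ < 1` only these shifts `θ +
  -- n` can lie in `(-2, 2)`.
  rw [tsum_eq_sum (s := {-2, -1, 0, 1})]
  · rw [Finset.sum_insert (by decide), Finset.sum_insert (by decide), Finset.sum_insert (by decide),
      Finset.sum_singleton]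
    push_cast
    simp only [add_zero, sub_eq_add_neg]
    ring
  · intro n hn
    refine h.realFourier_eq_zero ?_
    have hn' : n ≤ -3 ∨ 2 ≤ n := by
      simp only [Finset.mem_insert, Finset.mem_singleton, not_or] at hn
      omega
    have h2 : 2 ≤ |θ + n| := by
      rcases hn' with hn' | hn'
      · have : (n : ℝ) ≤ -3 := by exact_mod_cast hn'
        rw [le_abs]; right; linarith
      · have : (2 : ℝ) ≤ n := by exact_mod_cast hn'
        rw [le_abs]; left; linarith
    nlinarith [Real.pi_pos]

end StripDecay

/-! ### Integrable functions of exponential type `2π` -/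

/-- `F` multiplied by `(sin (εz) / (εz))²`. -/
noncomputable def damp (F : ℂ → ℂ) (ε : ℝ) (z : ℂ) : ℂ := F z * csinc (ε * z) ^ 2

theorem differentiable_damp {F : ℂ → ℂ} (hF : Differentiable ℂ F) (ε : ℝ) :
    Differentiable ℂ (damp F ε) := by
  have : Differentiable ℂ fun z : ℂ => csinc (ε * z) := differentiable_csinc.comp (by fun_prop)
  exact hF.mul (this.pow 2)

/-- Exponent budget: `τ + ε` from the growth of `F` off the real line and `2ε` from the squared
sinc, which also supplies the quadratic decay. -/
theorem stripDecay_damp {F : ℂ → ℂ} {τ ε : ℝ} (hF : Differentiable ℂ F) (hτ : 0 ≤ τ)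
    (h : HasExpType F τ) (hint : Integrable fun x : ℝ => F x) (hε : 0 < ε) (hε1 : ε ≤ 1) :
    StripDecay (τ + 3 * ε) (damp F ε) := by
  obtain ⟨C, hC⟩ := h.exists_bound_im hF hτ hint hε
  have hC0 : 0 ≤ C := by simpa using (norm_nonneg _).trans (hC 0)
  refine ⟨differentiable_damp hF ε, C * (4 / ε ^ 2), fun z => ?_⟩
  have h1 := one_add_norm_mul_norm_csinc_le (ε * z)
  have him : |((ε : ℂ) * z).im| = ε * |z.im| := by
    simp [abs_mul, abs_of_pos hε]
  have hnorm : ‖(ε : ℂ) * z‖ = ε * ‖z‖ := by simp [abs_of_pos hε]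
  rw [him, hnorm] at h1
  have h2 : (1 + ε * ‖z‖) ^ 2 * ‖csinc (ε * z)‖ ^ 2 ≤ 4 * Real.exp (2 * ε * |z.im|) := by
    rw [← mul_pow]
    calc _ ≤ (2 * Real.exp (ε * |z.im|)) ^ 2 := by gcongr
      _ = 4 * (Real.exp (ε * |z.im|)) ^ 2 := by ring
      _ = _ := by rw [← Real.exp_nat_mul]; push_cast; ring_nf
  have h3 : ε ^ 2 * (1 + z.re ^ 2) ≤ (1 + ε * ‖z‖) ^ 2 := by
    have h4 : z.re ^ 2 ≤ ‖z‖ ^ 2 := by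
      rw [← sq_abs]
      gcongr
      exact Complex.abs_re_le_norm z
    have h5 : ε ^ 2 * z.re ^ 2 ≤ ε ^ 2 * ‖z‖ ^ 2 := by gcongr
    have h6 : 0 ≤ ε * ‖z‖ := by positivity
    nlinarith
  have h4 : ‖csinc (ε * z)‖ ^ 2 ≤ 4 / ε ^ 2 * Real.exp (2 * ε * |z.im|) * (1 + z.re ^ 2)⁻¹ := by
    rw [← div_eq_mul_inv, le_div_iff₀ (by positivity), div_mul_eq_mul_div,
      le_div_iff₀ (by positivity)]
    calc _ = ε ^ 2 * (1 + z.re ^ 2) * ‖csinc (ε * z)‖ ^ 2 := by ring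
      _ ≤ (1 + ε * ‖z‖) ^ 2 * ‖csinc (ε * z)‖ ^ 2 := by gcongr
      _ ≤ _ := h2
  rw [damp, norm_mul, norm_pow]
  calc _ ≤ C * Real.exp ((τ + ε) * |z.im|) *
        (4 / ε ^ 2 * Real.exp (2 * ε * |z.im|) * (1 + z.re ^ 2)⁻¹) := by
        gcongr
        exact hC z
    _ = C * (4 / ε ^ 2) * ((Real.exp ((τ + ε) * |z.im|) * Real.exp (2 * ε * |z.im|))
        * (1 + z.re ^ 2)⁻¹) := by ring
    _ = _ := by rw [← Real.exp_add]; ring_nf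

theorem norm_csinc_ofReal_le (x : ℝ) : ‖csinc x‖ ≤ 1 := by
  simpa using norm_csinc_le x

theorem tendsto_csinc_mul (x : ℂ) :
    Tendsto (fun ε : ℝ => csinc (ε * x) ^ 2) (𝓝[>] 0) (𝓝 1) := by
  have hc : Continuous fun ε : ℝ => csinc (ε * x) ^ 2 :=
    (differentiable_csinc.continuous.comp (by fun_prop)).pow 2
  have := (hc.tendsto 0).mono_left (nhdsWithin_le_nhds (s := Set.Ioi (0 : ℝ)))
  simpa [csinc_zero] using this

theorem tendsto_realFourier_damp {F : ℂ → ℂ} (hF : Differentiable ℂ F)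
    (hint : Integrable fun x : ℝ => F x) (ξ : ℝ) :
    Tendsto (fun ε => realFourier (damp F ε) ξ) (𝓝[>] 0) (𝓝 (realFourier F ξ)) := by
  simp_rw [realFourier_eq]
  have hexp : ∀ x : ℝ, ‖Complex.exp (-2 * Real.pi * Complex.I * x * ξ)‖ = 1 := by
    intro x
    rw [Complex.norm_exp]
    simp
  refine tendsto_integral_filter_of_dominated_convergence (fun x : ℝ => ‖F x‖) ?_ ?_ hint.norm ?_
  · refine Eventually.of_forall fun ε => Continuous.aestronglyMeasurable ?_
    have := (differentiable_damp hF ε).continuous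
    fun_prop
  · refine Eventually.of_forall fun ε => Eventually.of_forall fun x => ?_
    rw [norm_mul, hexp, mul_one, damp, norm_mul, norm_pow]
    refine mul_le_of_le_one_right (norm_nonneg _) (pow_le_one₀ (norm_nonneg _) ?_)
    exact_mod_cast norm_csinc_ofReal_le (ε * x)
  · refine Eventually.of_forall fun x => ?_
    simpa [damp] using ((tendsto_csinc_mul x).const_mul (F x)).mul_const
      (Complex.exp (-2 * Real.pi * Complex.I * x * ξ))

section

variable {F : ℂ → ℂ} (hF : Differentiable ℂ F) (h : HasExpType F (2 * Real.pi))
  (hint : Integrable fun x : ℝ => F x)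

include hF h hint

theorem stripDecay_damp_two_pi {ε : ℝ} (hε : 0 < ε) (hε1 : ε ≤ 1) :
    StripDecay (2 * Real.pi + 3 * ε) (damp F ε) :=
  stripDecay_damp hF (by positivity) h hint hε hε1

theorem eventually_damp : ∀ᶠ ε : ℝ in 𝓝[>] 0, 0 < ε ∧ ε ≤ 1 ∧
    2 * Real.pi + 3 * ε < 4 * Real.pi ∧ StripDecay (2 * Real.pi + 3 * ε) (damp F ε) := by
  filter_upwards [Ioo_mem_nhdsGT (zero_lt_one' ℝ)] with ε hε
  exact ⟨hε.1, hε.2.le, by linarith [Real.pi_gt_three, hε.2],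
    stripDecay_damp_two_pi hF h hint hε.1 hε.2.le⟩

theorem realFourier_eq_zero_of_one_lt {ξ : ℝ} (hξ : 1 < |ξ|) : realFourier F ξ = 0 := by
  refine tendsto_nhds_unique (tendsto_realFourier_damp hF hint ξ) ?_
  refine tendsto_const_nhds.congr' ?_
  have hpos : (0 : ℝ) < min 1 (|ξ| - 1) := lt_min one_pos (by linarith)
  filter_upwards [Ioo_mem_nhdsGT hpos] with ε hε
  have h1 : ε < 1 := hε.2.trans_le (min_le_left _ _)
  have h2 : ε < |ξ| - 1 := hε.2.trans_le (min_le_right _ _)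
  refine ((stripDecay_damp_two_pi hF h hint hε.1 h1.le).realFourier_eq_zero ?_).symm
  have h3 : 0 < ε := hε.1
  nlinarith [Real.pi_gt_three]

/-- The endpoints `|ξ| = 1` follow by continuity. They matter: at `θ = 0` the shifts `θ ± 1` are
exactly these endpoints. -/
theorem realFourier_eq_zero_of_one_le {ξ : ℝ} (hξ : 1 ≤ |ξ|) : realFourier F ξ = 0 := by
  have hc : Tendsto (fun t : ℝ => realFourier F (t * ξ)) (𝓝[>] 1) (𝓝 (realFourier F (1 * ξ))) :=
    (((continuous_realFourier hint).comp (by fun_prop : Continuous fun t : ℝ => t * ξ)).tendsto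
      1).mono_left nhdsWithin_le_nhds
  rw [one_mul] at hc
  refine tendsto_nhds_unique hc (tendsto_const_nhds.congr' ?_)
  filter_upwards [self_mem_nhdsWithin] with t ht
  have ht : (1 : ℝ) < t := ht
  refine (realFourier_eq_zero_of_one_lt hF h hint ?_).symm
  rw [abs_mul, abs_of_pos (by linarith)]
  nlinarith

/-- A substitute for Poisson summation that asserts no summability of `F` over the integers. Of the
four shifts, `θ - 2` and `θ + 1` drop out in the limit. -/
theorem tendsto_tsum_damp {θ : ℝ} (h0 : 0 ≤ θ) (h1 : θ < 1) :
    Tendsto (fun ε : ℝ => ∑' n : ℤ, damp F ε n * Complex.exp (-2 * Real.pi * Complex.I * n * θ))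
      (𝓝[>] 0) (𝓝 (realFourier F θ + realFourier F (θ - 1))) := by
  have hl : ∀ ξ, Tendsto (fun ε => realFourier (damp F ε) ξ) (𝓝[>] 0) (𝓝 (realFourier F ξ)) :=
    tendsto_realFourier_damp hF hint
  have := (((hl (θ - 2)).add (hl (θ - 1))).add (hl θ)).add (hl (θ + 1))
  rw [realFourier_eq_zero_of_one_le hF h hint (ξ := θ - 2) (by rw [le_abs]; right; linarith),
    realFourier_eq_zero_of_one_le hF h hint (ξ := θ + 1) (by rw [le_abs]; left; linarith),
    zero_add, add_zero,
    add_comm (realFourier F (θ - 1))] at this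
  refine this.congr' ?_
  filter_upwards [eventually_damp hF h hint] with ε hε
  exact (hε.2.2.2.tsum_int_mul_exp hε.2.2.1 h0 h1).symm

/-- At `θ = 0` the damped sums tend to the integral, and each sum of nonnegative terms dominates its
`n`-th term. This yields both nonnegativity of the integral and vanishing at every integer when the
integral is not positive. -/
theorem re_le_re_integral (hpos : ∀ n : ℤ, 0 ≤ (F n).re) (n : ℤ) :
    (F n).re ≤ (∫ x : ℝ, F x).re := by
  have hlim := tendsto_tsum_damp hF h hint le_rfl one_pos
  rw [realFourier_eq_zero_of_one_le hF h hint (ξ := 0 - 1) (by norm_num), add_zero,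
    realFourier_eq] at hlim
  simp only [Complex.ofReal_zero, mul_zero, Complex.exp_zero, mul_one] at hlim
  have hlim' := (Complex.continuous_re.tendsto _).comp hlim
  have hl : Tendsto (fun ε : ℝ => (damp F ε n).re) (𝓝[>] 0) (𝓝 (F n).re) := by
    have := (tendsto_csinc_mul (n : ℂ)).const_mul (F n)
    rw [mul_one] at this
    exact (Complex.continuous_re.tendsto _).comp this
  refine le_of_tendsto_of_tendsto hl hlim' ?_
  filter_upwards [eventually_damp hF h hint] with ε hε
  have hs := hε.2.2.2.summable_int
  simp only [Function.comp_apply]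
  rw [Complex.re_tsum hs]
  have hs' : Summable fun n : ℤ => (damp F ε n).re := (Complex.hasSum_re hs.hasSum).summable
  refine hs'.le_tsum n fun k _ => ?_
  have hreal : csinc ((ε : ℂ) * k) ^ 2 = ((Real.sinc (ε * k) ^ 2 : ℝ) : ℂ) := by
    rw [← Complex.ofReal_intCast, ← Complex.ofReal_mul, csinc_ofReal]
    push_cast
    rfl
  rw [damp, hreal, Complex.re_mul_ofReal]
  exact mul_nonneg (hpos k) (sq_nonneg _)

theorem realFourier_add_eq_zero (hz : ∀ n : ℤ, F n = 0) {θ : ℝ} (h0 : 0 ≤ θ) (h1 : θ < 1) :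
    realFourier F θ + realFourier F (θ - 1) = 0 := by
  refine tendsto_nhds_unique (tendsto_tsum_damp hF h hint h0 h1) ?_
  simp [damp, hz]

theorem realFourier_deriv_damp {ε : ℝ} (hε : 0 < ε) (hε1 : ε ≤ 1) (ξ : ℝ) :
    realFourier (deriv (damp F ε)) ξ = 2 * Real.pi * Complex.I * ξ * realFourier (damp F ε) ξ := by
  have hs := stripDecay_damp_two_pi hF h hint hε hε1
  have hd : deriv (fun x : ℝ => damp F ε x) = fun x : ℝ => deriv (damp F ε) x :=
    funext fun x => ((hs.1 x).hasDerivAt.comp_ofReal).deriv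
  have := Real.fourier_deriv hs.integrable
    (fun x => ((hs.1 x).hasDerivAt.comp_ofReal).differentiableAt)
    (by rw [hd]; exact (hs.deriv (by positivity)).integrable)
  rw [hd] at this
  exact congrFun this ξ

/-- Twisted Poisson summation for the derivative of the damped function: only `n = 0` survives on
one side, and on the other `θ F̂(θ) + (θ-1) F̂(θ-1)` collapses to `F̂(θ)` because `F̂(θ-1) =
-F̂(θ)`. -/
theorem deriv_zero_eq (hz : ∀ n : ℤ, F n = 0) (hz' : ∀ n : ℤ, n ≠ 0 → deriv F n = 0) {θ : ℝ}
    (h0 : 0 ≤ θ) (h1 : θ < 1) : deriv F 0 = 2 * Real.pi * Complex.I * realFourier F θ := by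
  have hl : ∀ ξ : ℝ, Tendsto (fun ε => 2 * Real.pi * Complex.I * ξ * realFourier (damp F ε) ξ)
      (𝓝[>] 0) (𝓝 (2 * Real.pi * Complex.I * ξ * realFourier F ξ)) := fun ξ =>
    (tendsto_realFourier_damp hF hint ξ).const_mul _
  have hlim := (((hl (θ - 2)).add (hl (θ - 1))).add (hl θ)).add (hl (θ + 1))
  rw [realFourier_eq_zero_of_one_le hF h hint (ξ := θ - 2) (by rw [le_abs]; right; linarith),
    realFourier_eq_zero_of_one_le hF h hint (ξ := θ + 1) (by rw [le_abs]; left; linarith)] at hlim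
  have hsum := realFourier_add_eq_zero hF h hint hz h0 h1
  have hrw : realFourier F (θ - 1) = - realFourier F θ := by linear_combination hsum
  rw [hrw] at hlim
  have heq : deriv F 0 = 2 * Real.pi * Complex.I * ((θ - 2 : ℝ) : ℂ) * 0 +
      2 * Real.pi * Complex.I * ((θ - 1 : ℝ) : ℂ) * -realFourier F θ +
      2 * Real.pi * Complex.I * (θ : ℂ) * realFourier F θ +
      2 * Real.pi * Complex.I * ((θ + 1 : ℝ) : ℂ) * 0 := by
    refine tendsto_nhds_unique (tendsto_const_nhds.congr' ?_) hlim
    filter_upwards [eventually_damp hF h hint] with ε hε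
    obtain ⟨hε0, hε1, hε4, hs⟩ := hε
    have hp := (hs.deriv (by positivity)).tsum_int_mul_exp hε4 h0 h1
    simp_rw [realFourier_deriv_damp hF h hint hε0 hε1] at hp
    rw [← hp]
    have hderiv : ∀ n : ℤ, deriv (damp F ε) n = deriv F n * csinc (ε * n) ^ 2 := by
      intro n
      have hcd : DifferentiableAt ℂ (fun z : ℂ => csinc (ε * z) ^ 2) n := by
        have : Differentiable ℂ fun z : ℂ => csinc (ε * z) := differentiable_csinc.comp (by fun_prop)
        exact (this.pow 2) n
      have := ((hF n).hasDerivAt.mul hcd.hasDerivAt).deriv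
      rw [hz, zero_mul, add_zero] at this
      exact this
    rw [tsum_eq_single (0 : ℤ)]
    · rw [hderiv]
      simp [csinc_zero]
    · intro n hn
      rw [hderiv, hz' n hn]
      simp
  rw [heq]
  push_cast
  ring

/-- `F̂` is constant on `[0,1)`, and its continuity and vanishing at `1` make the constant zero.
Thus no information on `F'(0)` is needed; Fourier inversion finishes. -/
theorem eq_zero_of_deriv_eq_zero (hz : ∀ n : ℤ, F n = 0)
    (hz' : ∀ n : ℤ, n ≠ 0 → deriv F n = 0) : ∀ z, F z = 0 := by
  have hcont := continuous_realFourier hint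
  have hd0 : deriv F 0 = 0 := by
    have hl : Tendsto (fun θ : ℝ => 2 * Real.pi * Complex.I * realFourier F θ) (𝓝[<] 1)
        (𝓝 (2 * Real.pi * Complex.I * realFourier F 1)) :=
      ((hcont.tendsto 1).mono_left nhdsWithin_le_nhds).const_mul _
    rw [realFourier_eq_zero_of_one_le hF h hint (ξ := 1) (by simp), mul_zero] at hl
    refine tendsto_nhds_unique (tendsto_const_nhds.congr' ?_) hl
    filter_upwards [Ioo_mem_nhdsLT (zero_lt_one' ℝ)] with θ hθ
    exact deriv_zero_eq hF h hint hz hz' hθ.1.le hθ.2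
  have hpos : ∀ θ : ℝ, 0 ≤ θ → θ < 1 → realFourier F θ = 0 := by
    intro θ h0 h1
    have := deriv_zero_eq hF h hint hz hz' h0 h1
    rw [hd0] at this
    have hpi : (2 * Real.pi * Complex.I : ℂ) ≠ 0 := Complex.two_pi_I_ne_zero
    exact (mul_eq_zero.1 this.symm).resolve_left hpi
  have hall : ∀ ξ : ℝ, realFourier F ξ = 0 := by
    intro ξ
    by_cases h1 : 1 ≤ |ξ|
    · exact realFourier_eq_zero_of_one_le hF h hint h1
    · rw [not_le, abs_lt] at h1
      rcases le_or_gt 0 ξ with h0 | h0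
      · exact hpos ξ h0 h1.2
      · have := realFourier_add_eq_zero hF h hint hz (θ := ξ + 1) (by linarith) (by linarith)
        rw [hpos (ξ + 1) (by linarith) (by linarith)] at this
        simpa using this
  have hFzero : 𝓕 (fun x : ℝ => F x) = fun _ => 0 := funext hall
  have hc : Continuous fun x : ℝ => F x := hF.continuous.comp Complex.continuous_ofReal
  have hinv := hc.fourierInv_fourier_eq hint (by rw [hFzero]; exact integrable_zero _ _ _)
  have hx : ∀ x : ℝ, F x = 0 := by
    intro x
    have := congrFun hinv x
    rw [hFzero] at this
    rw [← this, Real.fourierInv_eq']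
    simp
  exact congrFun (eq_of_eq_ofReal hF (differentiable_const 0) hx)

end

/-- A real entire function of exponential type `2π` that is integrable on the real line and
nonnegative at the integers has nonnegative integral; the integral vanishes only for the zero
function if the function is bounded below quadratically near each nonzero integer. -/
theorem IsRealEntire.eq_zero_of_integral_nonpos {F : ℂ → ℂ} (hF : IsRealEntire F)
    (h : HasExpType F (2 * Real.pi)) (hint : Integrable fun x : ℝ => F x)
    (hpos : ∀ n : ℤ, 0 ≤ (F n).re)
    (hlow : ∀ n : ℤ, n ≠ 0 → ∃ c : ℝ, ∀ᶠ x : ℝ in 𝓝 (n : ℝ), -(c * (x - n) ^ 2) ≤ (F x).re)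
    (h0 : (∫ x : ℝ, F x).re ≤ 0) : ∀ z, F z = 0 := by
  have hz : ∀ n : ℤ, F n = 0 := by
    intro n
    apply Complex.ext
    · exact le_antisymm ((re_le_re_integral hF.entire h hint hpos n).trans h0) (hpos n)
    · simpa using hF.real_on_real n
  refine eq_zero_of_deriv_eq_zero hF.entire h hint hz fun n hn => ?_
  obtain ⟨c, hc⟩ := hlow n hn
  have hd : HasDerivAt (fun x : ℝ => F x) (deriv F n) n := by
    have := (hF.entire ((n : ℝ) : ℂ)).hasDerivAt.comp_ofReal
    simpa using this
  have hre : HasDerivAt (fun x : ℝ => (F x).re) (deriv F n).re n :=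
    Complex.reCLM.hasFDerivAt.comp_hasDerivAt (n : ℝ) hd
  have him : HasDerivAt (fun x : ℝ => (F x).im) (deriv F n).im n :=
    Complex.imCLM.hasFDerivAt.comp_hasDerivAt (n : ℝ) hd
  apply Complex.ext
  -- Adding the parabola makes `n` a local minimum without changing the derivative there.
  · have hq : HasDerivAt (fun x : ℝ => (F x).re + c * (x - n) ^ 2) (deriv F n).re n := by
      have h2 : HasDerivAt (fun x : ℝ => c * (x - n) ^ 2) (c * (2 * ((n : ℝ) - n))) n := by
        simpa using (((hasDerivAt_id (n : ℝ)).sub_const (n : ℝ)).pow 2).const_mul c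
      have h3 := hre.add h2
      rw [sub_self, mul_zero, mul_zero, add_zero] at h3
      exact h3
    refine IsLocalMin.hasDerivAt_eq_zero (f := fun x : ℝ => (F x).re + c * (x - n) ^ 2) ?_ hq
    filter_upwards [hc] with x hx
    have : F ((n : ℝ) : ℂ) = 0 := by simpa using hz n
    simp only [this, Complex.zero_re, sub_self]
    linarith
  · simp_rw [hF.real_on_real] at him
    exact him.unique (hasDerivAt_const _ _)

theorem IsRealEntire.sub {F G : ℂ → ℂ} (hF : IsRealEntire F) (hG : IsRealEntire G) :
    IsRealEntire fun z => F z - G z :=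
  ⟨hF.entire.sub hG.entire, fun x => by simp [hF.real_on_real x, hG.real_on_real x]⟩

/-! ### Transfer to type `2πΔ` and nodes `n/Δ + t` -/

section Rescale

variable {F : ℂ → ℂ} {Δ : ℝ} (t : ℝ) (hΔ : 0 < Δ) (hF : IsRealEntire F)
  (h : HasExpType F (2 * Real.pi * Δ)) (hint : Integrable fun x : ℝ => F x)

include hF in
theorem IsRealEntire.comp_affine :
    IsRealEntire fun z => F (((Δ⁻¹ : ℝ) : ℂ) * z + t) :=
  ⟨hF.entire.comp (by fun_prop), fun x => by
    have := hF.real_on_real (Δ⁻¹ * x + t)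
    push_cast at this ⊢
    exact this⟩

include hΔ hF h in
theorem hasExpType_rescale :
    HasExpType (fun z => F (((Δ⁻¹ : ℝ) : ℂ) * z + t)) (2 * Real.pi) := by
  have := h.comp_affine hF.entire (by positivity) (inv_pos.2 hΔ) (t : ℂ)
  rwa [show Δ⁻¹ * (2 * Real.pi * Δ) = 2 * Real.pi by field_simp] at this

include hΔ hint in
theorem integrable_rescale :
    Integrable fun x : ℝ => F (((Δ⁻¹ : ℝ) : ℂ) * (x : ℂ) + t) := by
  have h1 := (hint.comp_add_right t).comp_mul_left' (inv_pos.2 hΔ).ne'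
  refine h1.congr (Eventually.of_forall fun x => ?_)
  push_cast
  rfl

include hΔ in
theorem integral_rescale (F : ℂ → ℂ) :
    ∫ x : ℝ, F (((Δ⁻¹ : ℝ) : ℂ) * (x : ℂ) + t) = Δ * ∫ x : ℝ, F x := by
  have h1 := Measure.integral_comp_mul_left (fun x : ℝ => F ((x + t : ℝ) : ℂ)) Δ⁻¹
  rw [integral_add_right_eq_self (fun x : ℝ => F (x : ℂ)), inv_inv, abs_of_pos hΔ] at h1
  rw [← Complex.real_smul, ← h1]
  congr 1 with x
  push_cast
  rfl

include hΔ hF h hint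

theorem integral_re_nonneg_of_nodes (hpos : ∀ n : ℤ, 0 ≤ (F ((Δ⁻¹ * n + t : ℝ) : ℂ)).re) :
    0 ≤ (∫ x : ℝ, F x).re := by
  have h1 := re_le_re_integral (hF.comp_affine t).entire (hasExpType_rescale t hΔ hF h)
    (integrable_rescale t hΔ hint)
    (fun n => by have := hpos n; push_cast at this ⊢; exact this) 0
  rw [integral_rescale t hΔ F, Complex.re_ofReal_mul] at h1
  have h0 : 0 ≤ (F (((Δ⁻¹ : ℝ) : ℂ) * ((0 : ℤ) : ℂ) + t)).re := by
    have := hpos 0; push_cast at this ⊢; exact this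
  exact nonneg_of_mul_nonneg_right (h0.trans h1) hΔ

theorem eq_zero_of_nodes (hpos : ∀ n : ℤ, 0 ≤ (F ((Δ⁻¹ * n + t : ℝ) : ℂ)).re)
    (hlow : ∀ n : ℤ, n ≠ 0 → ∃ c : ℝ, ∀ᶠ x : ℝ in 𝓝 (Δ⁻¹ * n + t),
      -(c * (x - (Δ⁻¹ * n + t)) ^ 2) ≤ (F x).re)
    (h0 : (∫ x : ℝ, F x).re ≤ 0) : ∀ z, F z = 0 := by
  have h1 := (hF.comp_affine t).eq_zero_of_integral_nonpos (hasExpType_rescale t hΔ hF h)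
    (integrable_rescale t hΔ hint)
    (fun n => by have := hpos n; push_cast at this ⊢; exact this) ?_ ?_
  · intro z
    have := h1 (Δ * (z - t))
    have hΔ' : (Δ : ℂ) ≠ 0 := by exact_mod_cast hΔ.ne'
    have h2 : ((Δ⁻¹ : ℝ) : ℂ) * (Δ * (z - t)) + t = z := by
      push_cast
      field_simp
      ring
    rwa [h2] at this
  · intro n hn
    obtain ⟨c, hc⟩ := hlow n hn
    refine ⟨c * Δ⁻¹ ^ 2, ?_⟩
    have hl : Tendsto (fun x : ℝ => Δ⁻¹ * x + t) (𝓝 (n : ℝ)) (𝓝 (Δ⁻¹ * n + t)) :=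
      (by fun_prop : Continuous fun x : ℝ => Δ⁻¹ * x + t).tendsto _
    filter_upwards [hl.eventually hc] with x hx
    push_cast at hx ⊢
    refine le_trans (le_of_eq ?_) hx
    ring
  · rw [integral_rescale t hΔ F, Complex.re_ofReal_mul]
    exact mul_nonpos_of_nonneg_of_nonpos hΔ.le h0

end Rescale

/-! ### The Fourier transform of `1 / (x² + l²)` -/

theorem integrable_inv_sq_add_sq {l : ℝ} (hl : 0 < l) :
    Integrable fun x : ℝ => (x ^ 2 + l ^ 2)⁻¹ := by
  have h1 := (integrable_inv_one_add_sq.comp_mul_left' (inv_pos.2 hl).ne').const_mul (l ^ 2)⁻¹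
  refine h1.congr (Eventually.of_forall fun x => ?_)
  simp only
  rw [← mul_inv]
  congr 1
  field_simp
  ring

theorem integral_exp_mul_exp_neg_abs {l : ℝ} (hl : 0 < l) (x : ℝ) :
    Integrable (fun t : ℝ => (Real.exp (-(2 * Real.pi * l * |t|)) : ℂ)) ∧
    ∫ t : ℝ, Complex.exp (2 * Real.pi * Complex.I * t * x) * (Real.exp (-(2 * Real.pi * l * |t|)) : ℂ)
      = ((l / Real.pi * (x ^ 2 + l ^ 2)⁻¹ : ℝ) : ℂ) := by
  have hpi := Real.pi_pos
  have hcont : ∀ y : ℝ, AEStronglyMeasurable (fun t : ℝ => Complex.exp (2 * Real.pi * Complex.I * t * y) *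
      (Real.exp (-(2 * Real.pi * l * |t|)) : ℂ)) volume := fun y =>
    (by fun_prop : Continuous _).aestronglyMeasurable
  have key : ∀ y : ℝ, IntegrableOn (fun t : ℝ => Complex.exp (2 * Real.pi * Complex.I * t * y) *
      (Real.exp (-(2 * Real.pi * l * |t|)) : ℂ)) (Set.Ioi 0) ∧
      IntegrableOn (fun t : ℝ => Complex.exp (2 * Real.pi * Complex.I * t * y) *
      (Real.exp (-(2 * Real.pi * l * |t|)) : ℂ)) (Set.Iic 0) ∧
      ((∫ t in Set.Ioi (0 : ℝ), Complex.exp (2 * Real.pi * Complex.I * t * y) *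
      (Real.exp (-(2 * Real.pi * l * |t|)) : ℂ)) = (2 * Real.pi * (l - Complex.I * y))⁻¹) ∧
      ((∫ t in Set.Iic (0 : ℝ), Complex.exp (2 * Real.pi * Complex.I * t * y) *
      (Real.exp (-(2 * Real.pi * l * |t|)) : ℂ)) = (2 * Real.pi * (l + Complex.I * y))⁻¹) := by
    intro y
    have e1 : Set.EqOn (fun t : ℝ => Complex.exp (2 * Real.pi * Complex.I * t * y) *
        (Real.exp (-(2 * Real.pi * l * |t|)) : ℂ))
        (fun t : ℝ => Complex.exp (-(2 * Real.pi * (l - Complex.I * y)) * t)) (Set.Ioi 0) := by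
      intro t ht
      simp only [abs_of_pos (Set.mem_Ioi.1 ht), Complex.ofReal_exp]
      rw [← Complex.exp_add]
      congr 1
      push_cast
      ring
    have e2 : Set.EqOn (fun t : ℝ => Complex.exp (2 * Real.pi * Complex.I * t * y) *
        (Real.exp (-(2 * Real.pi * l * |t|)) : ℂ))
        (fun t : ℝ => Complex.exp ((2 * Real.pi * (l + Complex.I * y)) * t)) (Set.Iic 0) := by
      intro t ht
      simp only [abs_of_nonpos (Set.mem_Iic.1 ht), Complex.ofReal_exp]
      rw [← Complex.exp_add]
      congr 1
      push_cast
      ring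
    have r1 : (-(2 * Real.pi * (l - Complex.I * y))).re < 0 := by
      simp; positivity
    have r2 : 0 < (2 * Real.pi * (l + Complex.I * y)).re := by
      simp; positivity
    refine ⟨(integrableOn_exp_mul_complex_Ioi r1 0).congr_fun e1.symm measurableSet_Ioi,
      (integrableOn_exp_mul_complex_Iic r2 0).congr_fun e2.symm measurableSet_Iic, ?_, ?_⟩
    · rw [setIntegral_congr_fun measurableSet_Ioi e1, integral_exp_mul_complex_Ioi r1]
      simp [neg_div_neg_eq]
    · rw [setIntegral_congr_fun measurableSet_Iic e2, integral_exp_mul_complex_Iic r2]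
      simp
  refine ⟨?_, ?_⟩
  · have h0 := (key 0).2.1.union (key 0).1
    rw [Set.Iic_union_Ioi, integrableOn_univ] at h0
    simpa using h0
  · obtain ⟨i1, i2, v1, v2⟩ := key x
    rw [← intervalIntegral.integral_Iic_add_Ioi i2 i1, v1, v2]
    have n1 : (l : ℂ) - Complex.I * x ≠ 0 := by
      intro h; have := congrArg Complex.re h; simp at this; exact hl.ne' this
    have n2 : (l : ℂ) + Complex.I * x ≠ 0 := by
      intro h; have := congrArg Complex.re h; simp at this; exact hl.ne' this
    have n3 : (x : ℂ) ^ 2 + (l : ℂ) ^ 2 ≠ 0 := by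
      have : x ^ 2 + l ^ 2 ≠ 0 := by positivity
      exact_mod_cast this
    have n4 : (Real.pi : ℂ) ≠ 0 := by exact_mod_cast hpi.ne'
    have n5 : (x : ℂ) ^ 2 + (l : ℂ) ^ 2 = (l - Complex.I * x) * (l + Complex.I * x) := by
      linear_combination (x : ℂ) ^ 2 * Complex.I_sq
    push_cast
    rw [n5]
    field_simp
    ring

/-- The Fourier transform of `1 / (x² + l²)`. -/
theorem integral_inv_sq_add_sq_mul_exp {l : ℝ} (hl : 0 < l) (ξ : ℝ) :
    ∫ x : ℝ, (((x ^ 2 + l ^ 2)⁻¹ : ℝ) : ℂ) * Complex.exp (-2 * Real.pi * Complex.I * x * ξ)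
      = ((Real.pi / l * Real.exp (-(2 * Real.pi * l * |ξ|)) : ℝ) : ℂ) := by
  have hpi := Real.pi_pos
  have hl' : (l : ℂ) ≠ 0 := by exact_mod_cast hl.ne'
  have hpi' : (Real.pi : ℂ) ≠ 0 := by exact_mod_cast hpi.ne'
  set φ : ℝ → ℂ := fun t => (Real.exp (-(2 * Real.pi * l * |t|)) : ℂ) with hφ
  have hinv : 𝓕⁻ φ = fun x : ℝ => ((l / Real.pi * (x ^ 2 + l ^ 2)⁻¹ : ℝ) : ℂ) := by
    ext x
    rw [Real.fourierInv_eq', ← (integral_exp_mul_exp_neg_abs hl x).2]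
    refine integral_congr_ae (Eventually.of_forall fun t => ?_)
    simp only [smul_eq_mul, hφ]
    congr 2
    simp
    ring
  have hint : Integrable (fun x : ℝ => ((l / Real.pi * (x ^ 2 + l ^ 2)⁻¹ : ℝ) : ℂ)) :=
    ((integrable_inv_sq_add_sq hl).const_mul _).ofReal
  have hneg : 𝓕 φ = fun x : ℝ => ((l / Real.pi * (x ^ 2 + l ^ 2)⁻¹ : ℝ) : ℂ) := by
    ext x
    have := congrFun hinv (-x)
    rw [Real.fourierInv_eq_fourier_neg, neg_neg] at this
    rw [this]
    simp
  have hcont : Continuous φ := by simp only [hφ]; fun_prop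
  -- Fourier inversion for `e^{-2πl|t|}`, whose inverse transform is elementary, takes the place of
  -- a residue computation.
  have := congrFun (hcont.fourier_fourierInv_eq (integral_exp_mul_exp_neg_abs hl 0).1
    (by rw [hneg]; exact hint)) ξ
  rw [hinv, Real.fourier_eq'] at this
  have h2 : ∫ x : ℝ, (((x ^ 2 + l ^ 2)⁻¹ : ℝ) : ℂ) * Complex.exp (-2 * Real.pi * Complex.I * x * ξ)
      = (Real.pi / l : ℂ) * φ ξ := by
    rw [← this, ← integral_const_mul]
    refine integral_congr_ae (Eventually.of_forall fun t => ?_)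
    simp only [smul_eq_mul]
    push_cast
    have : Complex.exp (-2 * Real.pi * (inner ℝ t ξ : ℝ) * Complex.I) =
        Complex.exp (-2 * Real.pi * Complex.I * t * ξ) := by
      congr 1
      simp
      ring
    rw [this]
    field_simp
  rw [h2, hφ]
  push_cast
  rfl

/-! ### The kernels -/

/-- The density of `f_{2m+1,α}` with respect to the functions `1 / (x² + l²)`, for
`a = α - 1/2`. -/
noncomputable def wt (m : ℕ) (a l : ℝ) : ℝ := (l - a) ^ (2 * m + 1) / (2 * m + 1) * l

/-- The normalizing factor `cosh (2πΔl) - s`. -/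
noncomputable def dens (s Δ l : ℝ) : ℝ := Real.cosh (2 * Real.pi * Δ * l) - s

/-- The entire function `(cosh (2πΔl) - cos (2πΔz)) / (z² + l²)`. -/
noncomputable def bandKernel (Δ l : ℝ) (z : ℂ) : ℂ :=
  2 * (Real.pi * Δ) ^ 2 *
    (csinc (Real.pi * Δ * (z - l * Complex.I)) * csinc (Real.pi * Δ * (z + l * Complex.I)))

/-- The extremal majorant (`s = 1`) and minorant (`s = -1`). -/
noncomputable def extremal (m : ℕ) (a Δ s : ℝ) (z : ℂ) : ℂ :=
  ∫ l in Set.Ioc a 1, ((wt m a l / dens s Δ l : ℝ) : ℂ) * bandKernel Δ l z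

/-- The integrand of the difference between the extremal function and `f_{2m+1,α}`. -/
noncomputable def remKernel (m : ℕ) (a Δ s l x : ℝ) : ℝ :=
  wt m a l * (s - Real.cos (2 * Real.pi * Δ * x)) / (dens s Δ l * (x ^ 2 + l ^ 2))

theorem wt_nonneg {m : ℕ} {a l : ℝ} (ha : 0 ≤ a) (hl : a < l) : 0 ≤ wt m a l := by
  have h1 : 0 ≤ l - a := by linarith
  have h2 : 0 ≤ l := by linarith
  unfold wt
  positivity

/-- The factor `l ^ 2` cancels the double zero of `dens 1 Δ l` at `l = 0` (see
`two_mul_sq_le_dens`); hence the estimates are uniform in `a`, including `a = 0`. -/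
theorem wt_le_sq {m : ℕ} {a l : ℝ} (ha : 0 ≤ a) (hl : l ∈ Set.Ioc a 1) : wt m a l ≤ l ^ 2 := by
  have h1 : 0 ≤ l - a := by linarith [hl.1]
  have h2 : 0 ≤ l := by linarith [hl.1]
  have h3 : (l - a) ^ (2 * m + 1) ≤ l - a := by
    have : (l - a) ^ (2 * m + 1) ≤ (l - a) ^ 1 :=
      pow_le_pow_of_le_one h1 (by linarith [hl.2]) (by omega)
    simpa using this
  have h4 : (l - a) ^ (2 * m + 1) / (2 * m + 1) ≤ (l - a) ^ (2 * m + 1) := by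
    apply div_le_self (by positivity)
    have : (0 : ℝ) ≤ m := Nat.cast_nonneg m
    linarith
  unfold wt
  calc _ ≤ l * l := by
        gcongr
        linarith
    _ = l ^ 2 := by ring

theorem two_mul_sinh_sq_le_dens {s : ℝ} (hs : s ≤ 1) (Δ l : ℝ) :
    2 * Real.sinh (Real.pi * Δ * l) ^ 2 ≤ dens s Δ l := by
  unfold dens
  rw [show 2 * Real.pi * Δ * l = 2 * (Real.pi * Δ * l) by ring, Real.cosh_two_mul, Real.cosh_sq]
  linarith

theorem two_mul_sq_le_dens {s Δ l : ℝ} (hs : s ≤ 1) (hΔ : 0 < Δ) (hl : 0 ≤ l) :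
    2 * (Real.pi * Δ * l) ^ 2 ≤ dens s Δ l := by
  refine le_trans ?_ (two_mul_sinh_sq_le_dens hs Δ l)
  have h0 : 0 ≤ Real.pi * Δ * l := by positivity
  gcongr
  exact Real.self_le_sinh_iff.2 h0

theorem dens_pos {s Δ l : ℝ} (hs : s ≤ 1) (hΔ : 0 < Δ) (hl : 0 < l) : 0 < dens s Δ l :=
  lt_of_lt_of_le (by positivity) (two_mul_sq_le_dens hs hΔ hl.le)

theorem bandKernel_neg (Δ l : ℝ) (z : ℂ) : bandKernel Δ l (-z) = bandKernel Δ l z := by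
  unfold bandKernel
  rw [show (Real.pi * Δ * (-z - l * Complex.I) : ℂ) = -(Real.pi * Δ * (z + l * Complex.I)) by ring,
    show (Real.pi * Δ * (-z + l * Complex.I) : ℂ) = -(Real.pi * Δ * (z - l * Complex.I)) by ring,
    csinc_neg, csinc_neg]
  ring

theorem extremal_neg (m : ℕ) (a Δ s : ℝ) (z : ℂ) :
    extremal m a Δ s (-z) = extremal m a Δ s z := by
  simp only [extremal, bandKernel_neg]

/-- `2 sin A sin B = cos (B - A) - cos (B + A)` with `B - A = 2πΔl i` and `B + A = 2πΔx`. -/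
theorem bandKernel_ofReal {Δ l : ℝ} (hΔ : 0 < Δ) (hl : 0 < l) (x : ℝ) :
    bandKernel Δ l x = (((Real.cosh (2 * Real.pi * Δ * l) - Real.cos (2 * Real.pi * Δ * x)) /
      (x ^ 2 + l ^ 2) : ℝ) : ℂ) := by
  have hpi := Real.pi_pos
  set A : ℂ := Real.pi * Δ * (x - l * Complex.I) with hA
  set B : ℂ := Real.pi * Δ * (x + l * Complex.I) with hB
  have hA0 : A ≠ 0 := by
    intro h; have := congrArg Complex.im h; simp [hA, hpi.ne', hΔ.ne', hl.ne'] at this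
  have hB0 : B ≠ 0 := by
    intro h; have := congrArg Complex.im h; simp [hB, hpi.ne', hΔ.ne', hl.ne'] at this
  have hAB : A * B = (Real.pi * Δ) ^ 2 * ((x : ℂ) ^ 2 + (l : ℂ) ^ 2) := by
    simp only [hA, hB]
    linear_combination (-(Real.pi * Δ : ℂ) ^ 2 * (l : ℂ) ^ 2) * Complex.I_sq
  have hsin : 2 * (Complex.sin A * Complex.sin B) =
      Complex.cosh (2 * Real.pi * Δ * l) - Complex.cos (2 * Real.pi * Δ * x) := by
    have h1 : Complex.cos (B - A) = Complex.cosh (2 * Real.pi * Δ * l) := by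
      rw [← Complex.cos_mul_I]
      congr 1
      simp only [hA, hB]
      ring
    have h2 : Complex.cos (B + A) = Complex.cos (2 * Real.pi * Δ * x) := by
      congr 1
      simp only [hA, hB]
      ring
    rw [← h1, ← h2, Complex.cos_sub, Complex.cos_add]
    ring
  have n3 : (x : ℂ) ^ 2 + (l : ℂ) ^ 2 ≠ 0 := by
    have : x ^ 2 + l ^ 2 ≠ 0 := by positivity
    exact_mod_cast this
  have n4 : (Real.pi : ℂ) * Δ ≠ 0 := by
    exact_mod_cast (by positivity : Real.pi * Δ ≠ 0)
  rw [bandKernel, ← hA, ← hB, csinc_of_ne hA0, csinc_of_ne hB0, div_mul_div_comm, hAB]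
  push_cast
  rw [← hsin]
  have n5 : (Δ : ℂ) ≠ 0 := by exact_mod_cast hΔ.ne'
  field_simp

/-- The numerator splits as `cosh - cos = dens + (s - cos)`: the first part reproduces `1/(x²+l²)`,
the second is the error. -/
theorem bandKernel_mul_weight {m : ℕ} {a Δ s l : ℝ} (hs : s ≤ 1) (hΔ : 0 < Δ) (hl : 0 < l) (x : ℝ) :
    ((wt m a l / dens s Δ l : ℝ) : ℂ) * bandKernel Δ l x =
      ((wt m a l / (x ^ 2 + l ^ 2) + remKernel m a Δ s l x : ℝ) : ℂ) := by
  rw [bandKernel_ofReal hΔ hl, ← Complex.ofReal_mul]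
  congr 1
  have hd := (dens_pos hs hΔ hl).ne'
  have hx : x ^ 2 + l ^ 2 ≠ 0 := by positivity
  unfold remKernel
  have : Real.cosh (2 * Real.pi * Δ * l) = dens s Δ l + s := by unfold dens; ring
  rw [this]
  field_simp
  ring

theorem continuous_bandKernel (Δ : ℝ) : Continuous (Function.uncurry (bandKernel Δ)) := by
  have := differentiable_csinc.continuous
  unfold bandKernel Function.uncurry
  fun_prop

theorem differentiable_bandKernel (Δ l : ℝ) : Differentiable ℂ (bandKernel Δ l) := by
  have := differentiable_csinc
  unfold bandKernel
  fun_prop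

/-! ### Bounds for the kernels -/

theorem div_sq_add_sq_nonneg {m : ℕ} {a l : ℝ} (ha : 0 ≤ a) (hl : l ∈ Set.Ioc a 1) (x : ℝ) :
    0 ≤ wt m a l / (x ^ 2 + l ^ 2) := by
  have := wt_nonneg (m := m) ha hl.1
  positivity

theorem wt_div_le {m : ℕ} {a l : ℝ} (ha : 0 ≤ a) (hl : l ∈ Set.Ioc a 1) (x : ℝ) :
    wt m a l / (x ^ 2 + l ^ 2) ≤ (1 + x ^ 2)⁻¹ := by
  have hl0 : 0 < l := by linarith [hl.1]
  have := wt_le_sq (m := m) ha hl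
  rw [inv_eq_one_div, div_le_div_iff₀ (by positivity) (by positivity)]
  have h2 : l ^ 2 ≤ 1 := pow_le_one₀ hl0.le hl.2
  nlinarith [mul_nonneg (sq_nonneg x) (by linarith : 0 ≤ 1 - l ^ 2),
    mul_le_mul_of_nonneg_right this (by positivity : 0 ≤ 1 + x ^ 2)]

theorem abs_remKernel_le_of_ne {m : ℕ} {a Δ s l x : ℝ} (ha : 0 ≤ a) (hl : l ∈ Set.Ioc a 1)
    (hs : s ≤ 1) (hΔ : 0 < Δ) (hx : x ≠ 0) :
    |remKernel m a Δ s l x| ≤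
      |s - Real.cos (2 * Real.pi * Δ * x)| / (2 * (Real.pi * Δ) ^ 2 * x ^ 2) := by
  have hl0 : 0 < l := by linarith [hl.1]
  have hd := two_mul_sq_le_dens hs hΔ hl0.le
  have hdp := dens_pos hs hΔ hl0
  have hw := wt_le_sq (m := m) ha hl
  have hw0 := wt_nonneg (m := m) ha hl.1
  have hpi := Real.pi_pos
  unfold remKernel
  rw [abs_div, abs_mul, abs_of_nonneg hw0, abs_of_pos (by positivity : 0 < dens s Δ l * (x ^ 2 + l ^ 2)),
    div_le_div_iff₀ (by positivity) (by positivity)]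
  calc _ = |s - Real.cos (2 * Real.pi * Δ * x)| * (wt m a l * (2 * (Real.pi * Δ) ^ 2) * x ^ 2) := by ring
    _ ≤ |s - Real.cos (2 * Real.pi * Δ * x)| * (l ^ 2 * (2 * (Real.pi * Δ) ^ 2) * (x ^ 2 + l ^ 2)) := by
        gcongr
        nlinarith
    _ = |s - Real.cos (2 * Real.pi * Δ * x)| * (2 * (Real.pi * Δ * l) ^ 2 * (x ^ 2 + l ^ 2)) := by ring
    _ ≤ _ := by gcongr

theorem one_sub_cos_le (y : ℝ) : 1 - Real.cos y ≤ y ^ 2 / 2 := by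
  linarith [Real.one_sub_sq_div_two_le_cos (x := y)]

/-- For `x² ≥ 1` the denominator suffices. For `x² ≤ 1` the cases differ: if `s = 1`, the small
numerator `1 - cos 2πΔx` compensates the small `dens`; if `s = -1`, then `dens ≥ 2`. -/
theorem abs_remKernel_le {m : ℕ} {a Δ s l : ℝ} (ha : 0 ≤ a) (hl : l ∈ Set.Ioc a 1)
    (hs : s = 1 ∨ s = -1) (hΔ : 1 ≤ Δ) (x : ℝ) :
    |remKernel m a Δ s l x| ≤ 2 * (1 + x ^ 2)⁻¹ := by
  have hl0 : 0 < l := by linarith [hl.1]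
  have hs1 : s ≤ 1 := by rcases hs with rfl | rfl <;> norm_num
  have hΔ0 : 0 < Δ := by linarith
  have hpi : 3 < Real.pi := Real.pi_gt_three
  have hpΔ : 1 ≤ (Real.pi * Δ) ^ 2 := by
    have : 1 ≤ Real.pi * Δ := by nlinarith
    nlinarith
  have hd := two_mul_sq_le_dens hs1 hΔ0 hl0.le
  have hdp := dens_pos hs1 hΔ0 hl0
  have hw := wt_le_sq (m := m) ha hl
  have hw0 := wt_nonneg (m := m) ha hl.1
  have hc1 := Real.cos_le_one (2 * Real.pi * Δ * x)
  have hc2 := Real.neg_one_le_cos (2 * Real.pi * Δ * x)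
  rcases le_total 1 (x ^ 2) with hx | hx
  · have hx0 : x ≠ 0 := by rintro rfl; norm_num at hx
    refine (abs_remKernel_le_of_ne ha hl hs1 hΔ0 hx0).trans ?_
    have h2 : |s - Real.cos (2 * Real.pi * Δ * x)| ≤ 2 := by
      rw [abs_le]
      rcases hs with rfl | rfl <;> constructor <;> linarith
    rw [← div_eq_mul_inv, div_le_div_iff₀ (by positivity) (by positivity)]
    calc _ ≤ 2 * (1 + x ^ 2) := by gcongr
      _ ≤ 2 * (2 * 1 * x ^ 2) := by linarith
      _ ≤ _ := by gcongr
  · have h1 : |remKernel m a Δ s l x| ≤ 1 := by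
      unfold remKernel
      rw [abs_div, abs_mul, abs_of_nonneg hw0,
        abs_of_pos (by positivity : 0 < dens s Δ l * (x ^ 2 + l ^ 2)), div_le_one (by positivity)]
      rcases hs with rfl | rfl
      · rw [abs_of_nonneg (by linarith)]
        have h3 := one_sub_cos_le (2 * Real.pi * Δ * x)
        calc _ ≤ l ^ 2 * ((2 * Real.pi * Δ * x) ^ 2 / 2) :=
              mul_le_mul hw h3 (by linarith) (by positivity)
          _ = 2 * (Real.pi * Δ * l) ^ 2 * x ^ 2 := by ring
          _ ≤ _ := by gcongr; nlinarith
      · rw [abs_of_nonpos (by linarith)]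
        have h4 : 2 ≤ dens (-1) Δ l := by
          unfold dens
          linarith [Real.one_le_cosh (2 * Real.pi * Δ * l)]
        calc _ ≤ l ^ 2 * 2 := mul_le_mul hw (by linarith) (by linarith) (by positivity)
          _ ≤ 2 * (x ^ 2 + l ^ 2) := by nlinarith
          _ ≤ _ := by gcongr
    refine h1.trans ?_
    rw [← div_eq_mul_inv, le_div_iff₀ (by positivity)]
    linarith

/-- At a node `s - cos` has a double zero: `|s - cos 2πΔx| = 1 - cos 2πΔ(x - x₀)`. The resulting
quadratic bound, uniform in `l`, feeds the uniqueness argument; it degenerates only at `x = 0`. -/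
theorem abs_remKernel_le_near {m : ℕ} {a Δ s l x x₀ : ℝ} (ha : 0 ≤ a) (hl : l ∈ Set.Ioc a 1)
    (hs : s = 1 ∨ s = -1) (hΔ : 0 < Δ) (hx : x ≠ 0) (hcos : Real.cos (2 * Real.pi * Δ * x₀) = s) :
    |remKernel m a Δ s l x| ≤ (x - x₀) ^ 2 / x ^ 2 := by
  have hs1 : s ≤ 1 := by rcases hs with rfl | rfl <;> norm_num
  have hpi := Real.pi_pos
  refine (abs_remKernel_le_of_ne ha hl hs1 hΔ hx).trans ?_
  have hsin : Real.sin (2 * Real.pi * Δ * x₀) = 0 := by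
    have := Real.sin_sq_add_cos_sq (2 * Real.pi * Δ * x₀)
    rw [hcos] at this
    have h2 : s ^ 2 = 1 := by rcases hs with rfl | rfl <;> norm_num
    rw [h2] at this
    exact pow_eq_zero_iff two_ne_zero |>.1 (by linarith)
  have hy : Real.cos (2 * Real.pi * Δ * x) = s * Real.cos (2 * Real.pi * Δ * (x - x₀)) := by
    rw [show 2 * Real.pi * Δ * x = 2 * Real.pi * Δ * (x - x₀) + 2 * Real.pi * Δ * x₀ by ring,
      Real.cos_add, hsin, hcos]
    ring
  have habs : |s| = 1 := by rcases hs with rfl | rfl <;> norm_num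
  rw [hy, ← mul_one_sub, abs_mul, habs, one_mul,
    abs_of_nonneg (by linarith [Real.cos_le_one (2 * Real.pi * Δ * (x - x₀))]),
    div_le_div_iff₀ (by positivity) (by positivity)]
  calc _ ≤ ((2 * Real.pi * Δ * (x - x₀)) ^ 2 / 2) * x ^ 2 := by
        gcongr
        exact one_sub_cos_le _
    _ = _ := by ring

/-- Equivalent to `1 + 2v ≤ e^{2v}`. It lets `2 sinh² v ≤ dens` absorb both `e^{2v}` and the
vanishing factor `v²`, for small and large `v` alike. -/
theorem mul_exp_le_sinh (v : ℝ) : v * Real.exp v ≤ (1 + 2 * v) * Real.sinh v := by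
  have h1 := Real.add_one_le_exp (2 * v)
  have h2 : Real.exp (2 * v) = Real.exp v * Real.exp v := by rw [← Real.exp_add]; ring_nf
  have h3 : Real.exp v * Real.exp (-v) = 1 := by rw [← Real.exp_add]; simp
  have h4 := Real.exp_pos v
  have h5 : (1 + 2 * v) * Real.exp (-v) ≤ Real.exp v := by
    have h6 := Real.exp_pos (-v)
    calc _ ≤ Real.exp (2 * v) * Real.exp (-v) := by gcongr; linarith
      _ = Real.exp v := by rw [h2, mul_assoc, h3, mul_one]
  rw [Real.sinh_eq]
  nlinarith

theorem norm_kernel_le {m : ℕ} {a Δ s l : ℝ} (ha : 0 ≤ a) (hl : l ∈ Set.Ioc a 1)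
    (hs : s ≤ 1) (hΔ : 1 ≤ Δ) (z : ℂ) :
    ‖((wt m a l / dens s Δ l : ℝ) : ℂ) * bandKernel Δ l z‖ ≤
      128 * (Δ ^ 2 * Real.exp (2 * Real.pi * Δ * |z.im|) / (1 + Δ * ‖z‖)) := by
  have hl0 : 0 < l := by linarith [hl.1]
  have hΔ0 : 0 < Δ := by linarith
  have hpi : 3 < Real.pi := Real.pi_gt_three
  have hdp := dens_pos hs hΔ0 hl0
  have hw := wt_le_sq (m := m) ha hl
  have hw0 := wt_nonneg (m := m) ha hl.1
  set v := Real.pi * Δ * l with hv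
  have hv0 : 0 < v := by positivity
  set y := Real.pi * Δ * |z.im| with hy
  have hcs : ∀ w : ℂ, |w.im| ≤ |z.im| + l →
      |((Real.pi : ℂ) * Δ * w).im| ≤ y + v := by
    intro w hw
    rw [← Complex.ofReal_mul, Complex.im_ofReal_mul, abs_mul, abs_of_pos (by positivity)]
    calc _ ≤ Real.pi * Δ * (|z.im| + l) := by gcongr
      _ = _ := by rw [hy, hv]; ring
  have hbig : ∀ w : ℂ, |w.im| ≤ |z.im| + l → ‖z‖ ≤ ‖w‖ →
      (1 + Δ * ‖z‖) * ‖csinc (Real.pi * Δ * w)‖ ≤ 2 * Real.exp (y + v) := by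
    intro w hw hzw
    refine le_trans ?_ ((one_add_norm_mul_norm_csinc_le (Real.pi * Δ * w)).trans
      (b := 2 * Real.exp |((Real.pi : ℂ) * Δ * w).im|) (c := 2 * Real.exp (y + v)) ?_)
    · gcongr
      rw [norm_mul, norm_mul, Complex.norm_real, Complex.norm_real, Real.norm_of_nonneg hΔ0.le,
        Real.norm_of_nonneg (by linarith)]
      calc Δ * ‖z‖ ≤ Real.pi * Δ * ‖z‖ := by
            gcongr
            nlinarith
        _ ≤ _ := by gcongr
    · gcongr
      exact hcs w hw
  have hsmall : ∀ w : ℂ, |w.im| ≤ |z.im| + l →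
      ‖csinc (Real.pi * Δ * w)‖ ≤ Real.exp (y + v) := fun w hw =>
    (norm_csinc_le _).trans (Real.exp_le_exp.2 (hcs w hw))
  have him1 : |(z - l * Complex.I).im| ≤ |z.im| + l := by
    simpa [abs_of_pos hl0] using abs_sub (z.im) l
  have him2 : |(z + l * Complex.I).im| ≤ |z.im| + l := by
    simpa [abs_of_pos hl0] using abs_add_le (z.im) l
  have hprod : (1 + Δ * ‖z‖) * (‖csinc (Real.pi * Δ * (z - l * Complex.I))‖ *
      ‖csinc (Real.pi * Δ * (z + l * Complex.I))‖) ≤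
      2 * (Real.exp (2 * v) * Real.exp (2 * Real.pi * Δ * |z.im|)) := by
    have he : Real.exp (y + v) * Real.exp (y + v) =
        Real.exp (2 * v) * Real.exp (2 * Real.pi * Δ * |z.im|) := by
      rw [← Real.exp_add, ← Real.exp_add, hy]
      ring_nf
    rw [← he]
    -- Of `z ± il`, the point farther from the real axis has norm at least `‖z‖`; its sinc supplies
    -- the decay, the other is only bounded.
    rcases le_total 0 z.im with h | h
    · have hn : ‖z‖ ≤ ‖z + l * Complex.I‖ := by
        rw [Complex.norm_def, Complex.norm_def]
        apply Real.sqrt_le_sqrt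
        rw [Complex.normSq_apply, Complex.normSq_apply]
        simp
        nlinarith
      calc _ = ‖csinc (Real.pi * Δ * (z - l * Complex.I))‖ *
            ((1 + Δ * ‖z‖) * ‖csinc (Real.pi * Δ * (z + l * Complex.I))‖) := by ring
        _ ≤ Real.exp (y + v) * (2 * Real.exp (y + v)) :=
            mul_le_mul (hsmall _ him1) (hbig _ him2 hn) (by positivity) (by positivity)
        _ = _ := by ring
    · have hn : ‖z‖ ≤ ‖z - l * Complex.I‖ := by
        rw [Complex.norm_def, Complex.norm_def]
        apply Real.sqrt_le_sqrt
        rw [Complex.normSq_apply, Complex.normSq_apply]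
        simp
        nlinarith
      calc _ = ‖csinc (Real.pi * Δ * (z + l * Complex.I))‖ *
            ((1 + Δ * ‖z‖) * ‖csinc (Real.pi * Δ * (z - l * Complex.I))‖) := by ring
        _ ≤ Real.exp (y + v) * (2 * Real.exp (y + v)) :=
            mul_le_mul (hsmall _ him2) (hbig _ him1 hn) (by positivity) (by positivity)
        _ = _ := by ring
  -- With `v = πΔl ≤ 3.15 Δ` and `Δ ≥ 1` one has `1 + 2v ≤ 8Δ`, whence `64 Δ²`; the factor 2 in
  -- `hprod` then gives 128.
  have hweight : wt m a l / dens s Δ l * (2 * (Real.pi * Δ) ^ 2) * Real.exp (2 * v) ≤ 64 * Δ ^ 2 := by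
    rw [div_mul_eq_mul_div, div_mul_eq_mul_div, div_le_iff₀ hdp]
    have h1 := mul_exp_le_sinh v
    have h2 := two_mul_sinh_sq_le_dens hs Δ l
    have h3 : 1 + 2 * v ≤ 8 * Δ := by
      have : v ≤ 3.15 * Δ := by
        rw [hv]
        have := Real.pi_lt_d2
        calc Real.pi * Δ * l ≤ Real.pi * Δ * 1 := by gcongr; exact hl.2
          _ ≤ _ := by rw [mul_one]; gcongr
      linarith
    calc _ ≤ l ^ 2 * (2 * (Real.pi * Δ) ^ 2) * Real.exp (2 * v) := by gcongr
      _ = 2 * (v * Real.exp v) ^ 2 := by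
          rw [show Real.exp (2 * v) = Real.exp v ^ 2 by rw [← Real.exp_nat_mul]; push_cast; ring_nf, hv]
          ring
      _ ≤ 2 * ((1 + 2 * v) * Real.sinh v) ^ 2 := by gcongr
      _ = (1 + 2 * v) ^ 2 * (2 * Real.sinh v ^ 2) := by ring
      _ ≤ (8 * Δ) ^ 2 * dens s Δ l := by gcongr
      _ = _ := by ring
  have hnorm : ‖((wt m a l / dens s Δ l : ℝ) : ℂ) * bandKernel Δ l z‖ =
      wt m a l / dens s Δ l * (2 * (Real.pi * Δ) ^ 2) *
        (‖csinc (Real.pi * Δ * (z - l * Complex.I))‖ *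
          ‖csinc (Real.pi * Δ * (z + l * Complex.I))‖) := by
    rw [norm_mul, Complex.norm_real, Real.norm_of_nonneg (by positivity), bandKernel, norm_mul,
      norm_mul, norm_mul, norm_pow, norm_mul, Complex.norm_real, Complex.norm_real,
      Real.norm_of_nonneg hΔ0.le, Real.norm_of_nonneg (by linarith : 0 ≤ Real.pi), Complex.norm_ofNat]
    ring
  rw [hnorm, ← mul_div_assoc, le_div_iff₀ (by positivity)]
  calc _ = wt m a l / dens s Δ l * (2 * (Real.pi * Δ) ^ 2) * ((1 + Δ * ‖z‖) *
        (‖csinc (Real.pi * Δ * (z - l * Complex.I))‖ *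
          ‖csinc (Real.pi * Δ * (z + l * Complex.I))‖)) := by ring
    _ ≤ wt m a l / dens s Δ l * (2 * (Real.pi * Δ) ^ 2) *
        (2 * (Real.exp (2 * v) * Real.exp (2 * Real.pi * Δ * |z.im|))) := by gcongr
    _ = (wt m a l / dens s Δ l * (2 * (Real.pi * Δ) ^ 2) * Real.exp (2 * v)) *
        (2 * Real.exp (2 * Real.pi * Δ * |z.im|)) := by ring
    _ ≤ (64 * Δ ^ 2) * (2 * Real.exp (2 * Real.pi * Δ * |z.im|)) := by gcongr
    _ = _ := by ring

/-! ### Integration with respect to the parameter -/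

section Param

variable {E : Type*} [NormedAddCommGroup E] {a C : ℝ} {k : ℝ → ℝ → E}
  (hk : StronglyMeasurable (Function.uncurry k))
  (hb : ∀ l ∈ Set.Ioc a 1, ∀ x, ‖k l x‖ ≤ C * (1 + x ^ 2)⁻¹)

include hk hb

theorem integrableOn_section (x : ℝ) : IntegrableOn (fun l => k l x) (Set.Ioc a 1) := by
  refine Integrable.mono' (g := fun _ => C * (1 + x ^ 2)⁻¹) ?_ ?_ ?_
  · exact (integrableOn_const_iff).2 (Or.inr (by simp))
  · exact (hk.comp_measurable (by fun_prop : Measurable fun l : ℝ => (l, x))).aestronglyMeasurable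
  · filter_upwards [ae_restrict_mem measurableSet_Ioc] with l hl
    exact hb l hl x

theorem integrable_uncurry_prod :
    Integrable (Function.uncurry k) ((volume.restrict (Set.Ioc a 1)).prod volume) := by
  have h1 : Integrable (fun p : ℝ × ℝ => (1 : ℝ) * (C * (1 + p.2 ^ 2)⁻¹))
      ((volume.restrict (Set.Ioc a 1)).prod volume) :=
    Integrable.mul_prod (f := fun _ : ℝ => (1 : ℝ)) (g := fun x : ℝ => C * (1 + x ^ 2)⁻¹)
      ((integrableOn_const_iff).2 (Or.inr (by simp))) (integrable_inv_one_add_sq.const_mul C)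
  refine h1.mono' hk.aestronglyMeasurable ?_
  have h2 : ∀ᵐ p : ℝ × ℝ ∂((volume.restrict (Set.Ioc a 1)).prod volume), p.1 ∈ Set.Ioc a 1 :=
    Measure.quasiMeasurePreserving_fst.ae (ae_restrict_mem measurableSet_Ioc)
  filter_upwards [h2] with p hp
  rw [one_mul]
  exact hb p.1 hp p.2

theorem integrable_setIntegral_section [NormedSpace ℝ E] :
    Integrable fun x => ∫ l in Set.Ioc a 1, k l x :=
  (integrable_uncurry_prod hk hb).integral_prod_right

theorem integral_setIntegral_swap [NormedSpace ℝ E] :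
    ∫ x, ∫ l in Set.Ioc a 1, k l x = ∫ l in Set.Ioc a 1, ∫ x, k l x :=
  (integral_integral_swap (integrable_uncurry_prod hk hb)).symm

end Param

/-- Fubini on the triangle `a < σ < l ≤ 1`, the inner integral being `∫_a^l (σ-a)^k dσ =
(l-a)^{k+1}/(k+1)`. It serves both `fOdd` and the logarithmic integrals. -/
theorem setIntegral_triangle {a : ℝ} (k : ℕ) {h : ℝ → ℝ} (hm : Measurable h)
    (hi : IntegrableOn (fun l => (l - a) ^ (k + 1) / (k + 1) * h l) (Set.Ioc a 1)) :
    ∫ σ in Set.Ioc a 1, (σ - a) ^ k * ∫ l in Set.Ioc σ 1, h l =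
      ∫ l in Set.Ioc a 1, (l - a) ^ (k + 1) / (k + 1) * h l := by
  set F : ℝ → ℝ → ℝ := fun σ l => {p : ℝ × ℝ | p.1 < p.2}.indicator
    (fun p => (p.1 - a) ^ k * h p.2) (σ, l) with hF
  have hmeas : Measurable (Function.uncurry F) :=
    Measurable.indicator (by fun_prop) (measurableSet_lt measurable_fst measurable_snd)
  have hsec : ∀ l ∈ Set.Ioc a 1, ∀ c : ℝ, ∫ σ in Set.Ioc a 1, (Set.Iio l).indicator
      (fun σ => (σ - a) ^ k * c) σ = (l - a) ^ (k + 1) / (k + 1) * c := by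
    intro l hl c
    rw [setIntegral_indicator measurableSet_Iio,
      show Set.Ioc a 1 ∩ Set.Iio l = Set.Ioo a l by
        ext x; simp only [Set.mem_inter_iff, Set.mem_Ioc, Set.mem_Iio, Set.mem_Ioo]
        constructor
        · rintro ⟨⟨h1, _⟩, h3⟩; exact ⟨h1, h3⟩
        · rintro ⟨h1, h3⟩; exact ⟨⟨h1, by linarith [hl.2]⟩, h3⟩,
      integral_mul_const, ← integral_Ioc_eq_integral_Ioo, ← intervalIntegral.integral_of_le hl.1.le,
      intervalIntegral.integral_comp_sub_right (fun x : ℝ => x ^ k), integral_pow]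
    simp
  have hFl : ∀ l, (fun σ => F σ l) = (Set.Iio l).indicator (fun σ => (σ - a) ^ k * h l) := by
    intro l
    ext σ
    simp only [hF, Set.indicator_apply, Set.mem_ofPred_eq, Set.mem_Iio]
  have hFσ : ∀ σ, (fun l => F σ l) = (Set.Ioi σ).indicator (fun l => (σ - a) ^ k * h l) := by
    intro σ
    ext l
    simp only [hF, Set.indicator_apply, Set.mem_ofPred_eq, Set.mem_Ioi]
  -- Integrability is tested with `σ` integrated first, because `h` itself may be singular at `l =
  -- a`; only the weighted `h` is assumed integrable.
  have hint : Integrable (Function.uncurry F)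
      ((volume.restrict (Set.Ioc a 1)).prod (volume.restrict (Set.Ioc a 1))) := by
    rw [integrable_prod_iff' hmeas.aestronglyMeasurable]
    constructor
    · refine Eventually.of_forall fun l => ?_
      change Integrable (fun σ => F σ l) _
      rw [hFl]
      refine Integrable.indicator ?_ measurableSet_Iio
      exact ((by fun_prop : Continuous fun σ : ℝ => (σ - a) ^ k * h l).integrableOn_Ioc)
    · refine hi.norm.congr ?_
      filter_upwards [ae_restrict_mem measurableSet_Ioc] with l hl
      have h1 : ∀ σ ∈ Set.Ioc a 1, ‖Function.uncurry F (σ, l)‖ =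
          (Set.Iio l).indicator (fun σ => (σ - a) ^ k * ‖h l‖) σ := by
        intro σ hσ
        change ‖F σ l‖ = _
        rw [congrFun (hFl l) σ]
        simp only [Set.indicator_apply]
        split_ifs
        · rw [norm_mul, Real.norm_of_nonneg (pow_nonneg (by linarith [hσ.1]) k)]
        · simp
      rw [setIntegral_congr_fun measurableSet_Ioc h1, hsec l hl, norm_mul,
        Real.norm_of_nonneg (div_nonneg (pow_nonneg (by linarith [hl.1]) _) (by positivity))]
  have hswap := integral_integral_swap hint
  have hL : ∀ σ ∈ Set.Ioc a 1, ∫ l in Set.Ioc a 1, F σ l = (σ - a) ^ k * ∫ l in Set.Ioc σ 1, h l := by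
    intro σ hσ
    rw [hFσ, setIntegral_indicator measurableSet_Ioi,
      show Set.Ioc a 1 ∩ Set.Ioi σ = Set.Ioc σ 1 by
        ext x; simp only [Set.mem_inter_iff, Set.mem_Ioc, Set.mem_Ioi]
        constructor
        · rintro ⟨⟨_, h2⟩, h3⟩; exact ⟨h3, h2⟩
        · rintro ⟨h1, h3⟩; exact ⟨⟨by linarith [hσ.1], h3⟩, h1⟩,
      integral_const_mul]
  have hR : ∀ l ∈ Set.Ioc a 1, ∫ σ in Set.Ioc a 1, F σ l = (l - a) ^ (k + 1) / (k + 1) * h l := by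
    intro l hl
    rw [hFl, hsec l hl]
  rw [← setIntegral_congr_fun measurableSet_Ioc hL, hswap,
    setIntegral_congr_fun measurableSet_Ioc hR]

/-! ### Representations of `f_{2m+1,α}` and of the logarithmic integrals -/

theorem log_div_eq_setIntegral {b : ℝ} (hb : 0 < b) (hb1 : b ≤ 1) (x : ℝ) :
    Real.log ((1 + x ^ 2) / (b ^ 2 + x ^ 2)) = ∫ l in Set.Ioc b 1, 2 * l / (x ^ 2 + l ^ 2) := by
  have hpos : ∀ l ∈ Set.uIcc b 1, 0 < x ^ 2 + l ^ 2 := by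
    intro l hl
    rw [Set.uIcc_of_le hb1] at hl
    have : 0 < l := hb.trans_le hl.1
    positivity
  rw [← intervalIntegral.integral_of_le hb1, intervalIntegral.integral_eq_sub_of_hasDerivAt
    (f := fun l => Real.log (x ^ 2 + l ^ 2))]
  · rw [Real.log_div (by positivity) (by positivity)]
    ring_nf
  · intro l hl
    have h1 : HasDerivAt (fun l : ℝ => x ^ 2 + l ^ 2) (2 * l) l := by
      simpa using (hasDerivAt_pow 2 l).const_add (x ^ 2)
    exact h1.log (hpos l hl).ne'
  · refine ContinuousOn.intervalIntegrable ?_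
    exact ContinuousOn.div (by fun_prop) (by fun_prop) fun l hl => (hpos l hl).ne'

theorem stronglyMeasurable_wt_div (m : ℕ) (a : ℝ) :
    StronglyMeasurable (Function.uncurry fun l x => wt m a l / (x ^ 2 + l ^ 2)) := by
  apply Measurable.stronglyMeasurable
  unfold wt Function.uncurry
  fun_prop

theorem norm_wt_div_le {m : ℕ} {a : ℝ} (ha : 0 ≤ a) :
    ∀ l ∈ Set.Ioc a 1, ∀ x : ℝ, ‖wt m a l / (x ^ 2 + l ^ 2)‖ ≤ 1 * (1 + x ^ 2)⁻¹ := by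
  intro l hl x
  rw [Real.norm_of_nonneg (div_sq_add_sq_nonneg ha hl x), one_mul]
  exact wt_div_le ha hl x

theorem fOdd_eq {m : ℕ} {α : ℝ} (h0 : 1 / 2 ≤ α) (h1 : α ≤ 1) (x : ℝ) :
    fOdd m α x = ∫ l in Set.Ioc (α - 1 / 2) 1, wt m (α - 1 / 2) l / (x ^ 2 + l ^ 2) := by
  set a := α - 1 / 2 with ha
  have ha0 : 0 ≤ a := by linarith
  have hi := integrableOn_section (stronglyMeasurable_wt_div m a) (norm_wt_div_le ha0) x
  have hk : ∀ l : ℝ, (l - a) ^ (2 * m + 1) / ((2 * m : ℕ) + 1) * (2 * l / (x ^ 2 + l ^ 2)) =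
      2 * (wt m a l / (x ^ 2 + l ^ 2)) := by
    intro l
    unfold wt
    push_cast
    ring
  have htri := setIntegral_triangle (a := a) (2 * m) (h := fun l => 2 * l / (x ^ 2 + l ^ 2))
    (by fun_prop) (by simp_rw [hk]; exact hi.const_mul 2)
  simp_rw [hk] at htri
  rw [integral_const_mul] at htri
  have hshift := intervalIntegral.integral_comp_add_right (a := a) (b := 1) (fun σ : ℝ =>
    (σ - α) ^ (2 * m) * Real.log ((1 + x ^ 2) / ((σ - 1 / 2) ^ 2 + x ^ 2))) (1 / 2)
  rw [show a + 1 / 2 = α by rw [ha]; ring, show (1 : ℝ) + 1 / 2 = 3 / 2 by norm_num] at hshift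
  rw [fOdd, ← hshift, intervalIntegral.integral_of_le (by linarith)]
  have hc : ∀ σ ∈ Set.Ioc a 1, (σ + 1 / 2 - α) ^ (2 * m) *
      Real.log ((1 + x ^ 2) / ((σ + 1 / 2 - 1 / 2) ^ 2 + x ^ 2)) =
      (σ - a) ^ (2 * m) * ∫ l in Set.Ioc σ 1, 2 * l / (x ^ 2 + l ^ 2) := by
    intro σ hσ
    rw [← log_div_eq_setIntegral (by linarith [hσ.1]) hσ.2, ha]
    ring_nf
  rw [setIntegral_congr_fun measurableSet_Ioc hc, htri]
  ring

/-- The derivative of `log (1 - s e^{-2πΔl})` with respect to `l`. -/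
noncomputable def logDens (s Δ l : ℝ) : ℝ :=
  2 * Real.pi * Δ * (s * Real.exp (-2 * Real.pi * Δ * l)) /
    (1 - s * Real.exp (-2 * Real.pi * Δ * l))

theorem one_sub_mul_exp_pos {s Δ l : ℝ} (hs : s ≤ 1) (hΔ : 0 < Δ) (hl : 0 < l) :
    0 < 1 - s * Real.exp (-2 * Real.pi * Δ * l) := by
  have h1 : Real.exp (-2 * Real.pi * Δ * l) < 1 := by
    rw [Real.exp_lt_one_iff]
    have := Real.pi_pos
    have : 0 < Real.pi * Δ * l := by positivity
    linarith
  nlinarith [Real.exp_pos (-2 * Real.pi * Δ * l)]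

theorem log_ratio_eq_setIntegral {s Δ b : ℝ} (hs : s ≤ 1) (hΔ : 0 < Δ) (hb : 0 < b)
    (hb1 : b ≤ 1) :
    Real.log ((1 - s * Real.exp (-2 * Real.pi * b * Δ)) / (1 - s * Real.exp (-2 * Real.pi * Δ))) =
      - ∫ l in Set.Ioc b 1, logDens s Δ l := by
  have hpos : ∀ l ∈ Set.uIcc b 1, 0 < 1 - s * Real.exp (-2 * Real.pi * Δ * l) := by
    intro l hl
    rw [Set.uIcc_of_le hb1] at hl
    exact one_sub_mul_exp_pos hs hΔ (hb.trans_le hl.1)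
  have p1 := one_sub_mul_exp_pos hs hΔ hb
  have p2 := one_sub_mul_exp_pos hs hΔ one_pos
  rw [mul_one] at p2
  rw [← intervalIntegral.integral_of_le hb1, intervalIntegral.integral_eq_sub_of_hasDerivAt
    (f := fun l => Real.log (1 - s * Real.exp (-2 * Real.pi * Δ * l)))]
  · rw [show -2 * Real.pi * b * Δ = -2 * Real.pi * Δ * b by ring, Real.log_div p1.ne' p2.ne']
    simp
  · intro l hl
    have h0 : HasDerivAt (fun l : ℝ => -2 * Real.pi * Δ * l) (-2 * Real.pi * Δ) l := by
      simpa using (hasDerivAt_id l).const_mul (-2 * Real.pi * Δ)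
    have h1 := ((h0.exp.const_mul s).const_sub 1).log (hpos l hl).ne'
    convert! h1 using 1
    unfold logDens
    ring
  · refine ContinuousOn.intervalIntegrable ?_
    unfold logDens
    exact ContinuousOn.div (by fun_prop) (by fun_prop) fun l hl => (hpos l hl).ne'

/-- With `q = e^{-2πΔl}` and `s² = 1`: `sinh/(cosh - s) = (1-q²)/(1-sq)² = (1+sq)/(1-sq) = 1 +
2sq/(1-sq)`. This links the transform at `0` to the logarithmic integrals. -/
theorem pi_mul_sinh_div_dens {s Δ l : ℝ} (hs : s = 1 ∨ s = -1) (hΔ : 0 < Δ) (hl : 0 < l) :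
    Real.pi * Real.sinh (2 * Real.pi * Δ * l) / dens s Δ l = Real.pi + Δ⁻¹ * logDens s Δ l := by
  have hs1 : s ≤ 1 := by rcases hs with rfl | rfl <;> norm_num
  have p1 := one_sub_mul_exp_pos hs1 hΔ hl
  have hd := dens_pos hs1 hΔ hl
  unfold logDens
  unfold dens at hd ⊢
  have hE : Real.exp (2 * Real.pi * Δ * l) = (Real.exp (-2 * Real.pi * Δ * l))⁻¹ := by
    rw [← Real.exp_neg]; ring_nf
  have hE' : Real.exp (-(2 * Real.pi * Δ * l)) = Real.exp (-2 * Real.pi * Δ * l) := by ring_nf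
  rw [Real.cosh_eq, hE, hE'] at hd
  rw [Real.sinh_eq, Real.cosh_eq, hE, hE']
  have hq := Real.exp_pos (-2 * Real.pi * Δ * l)
  set q := Real.exp (-2 * Real.pi * Δ * l)
  have h2 : (q⁻¹ + q) / 2 - s = (1 - s * q) ^ 2 / (2 * q) := by
    field_simp
    rcases hs with rfl | rfl <;> ring
  have hne : 1 - s * q ≠ 0 := p1.ne'
  have h3 : Real.pi * ((q⁻¹ - q) / 2) / ((1 - s * q) ^ 2 / (2 * q)) =
      Real.pi * (1 - q ^ 2) / (1 - s * q) ^ 2 := by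
    field_simp
  have h4 : 1 - q ^ 2 = (1 - s * q) * (1 + s * q) := by
    rcases hs with rfl | rfl <;> ring
  have h5 : Δ⁻¹ * (2 * Real.pi * Δ * (s * q) / (1 - s * q)) =
      2 * Real.pi * (s * q) / (1 - s * q) := by
    field_simp
  rw [h2, h3, h4, h5, eq_comm, ← sub_eq_zero, sq, ← mul_assoc, mul_comm Real.pi, mul_assoc (1 - s * q),
    mul_div_mul_left _ _ hne, ← sub_eq_zero.2 (div_self hne)]
  field_simp
  ring

theorem pow_div_eq_wt_div {m : ℕ} {a l : ℝ} (hl : l ≠ 0) :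
    (l - a) ^ (2 * m + 1) / (2 * m + 1) = wt m a l / l := by
  unfold wt
  field_simp

/-- From `(1 + y) e^{-y} ≤ 1` with `y = 2πΔl`. The singularity `1/l` is then cancelled by the
weight. -/
theorem abs_logDens_le {s Δ l : ℝ} (hs : s = 1 ∨ s = -1) (hΔ : 0 < Δ) (hl : 0 < l) :
    |logDens s Δ l| ≤ l⁻¹ := by
  have hs1 : s ≤ 1 := by rcases hs with rfl | rfl <;> norm_num
  have habs : |s| = 1 := by rcases hs with rfl | rfl <;> norm_num
  have hp := one_sub_mul_exp_pos hs1 hΔ hl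
  have hpi := Real.pi_pos
  have hq := Real.exp_pos (-2 * Real.pi * Δ * l)
  unfold logDens
  rw [abs_div, abs_of_pos hp, abs_mul (2 * Real.pi * Δ), abs_mul s, habs, one_mul, abs_of_pos hq,
    abs_of_pos (by positivity), div_le_iff₀ hp, ← div_eq_inv_mul, le_div_iff₀ hl]
  have h1 := Real.add_one_le_exp (2 * Real.pi * Δ * l)
  have hE : Real.exp (2 * Real.pi * Δ * l) * Real.exp (-2 * Real.pi * Δ * l) = 1 := by
    rw [← Real.exp_add]; ring_nf; simp
  have h2 := mul_le_mul_of_nonneg_right h1 hq.le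
  rw [hE] at h2
  nlinarith

theorem integrableOn_pow_mul_logDens {m : ℕ} {a s Δ : ℝ} (ha : 0 ≤ a) (hs : s = 1 ∨ s = -1)
    (hΔ : 0 < Δ) :
    IntegrableOn (fun l => (l - a) ^ (2 * m + 1) / (2 * m + 1) * logDens s Δ l) (Set.Ioc a 1) := by
  refine Integrable.mono' (g := fun _ => (1 : ℝ)) ?_ ?_ ?_
  · exact (integrableOn_const_iff).2 (Or.inr (by simp))
  · refine (Measurable.aestronglyMeasurable ?_)
    unfold logDens
    fun_prop
  · filter_upwards [ae_restrict_mem measurableSet_Ioc] with l hl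
    have hl0 : 0 < l := by linarith [hl.1]
    have h1 := abs_logDens_le hs hΔ hl0
    have h2 := wt_le_sq (m := m) ha hl
    have h3 := wt_nonneg (m := m) ha hl.1
    rw [pow_div_eq_wt_div hl0.ne', norm_mul, Real.norm_of_nonneg (by positivity), Real.norm_eq_abs]
    calc _ ≤ l ^ 2 / l * l⁻¹ := by gcongr
      _ = 1 := by field_simp

theorem logRatioIntegral_eq {m : ℕ} {α Δ s : ℝ} (h0 : 1 / 2 ≤ α) (h1 : α ≤ 1) (hΔ : 0 < Δ)
    (hs : s = 1 ∨ s = -1) :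
    logRatioIntegral m α Δ s = -∫ l in Set.Ioc (α - 1 / 2) 1,
      (l - (α - 1 / 2)) ^ (2 * m + 1) / (2 * m + 1) * logDens s Δ l := by
  have hs1 : s ≤ 1 := by rcases hs with rfl | rfl <;> norm_num
  set a := α - 1 / 2 with ha
  have ha0 : 0 ≤ a := by linarith
  have hi := integrableOn_pow_mul_logDens (m := m) ha0 hs hΔ
  have hm : Measurable (logDens s Δ) := by unfold logDens; fun_prop
  have htri := setIntegral_triangle (a := a) (2 * m) hm (by push_cast; exact hi)
  push_cast at htri
  rw [← htri, ← integral_neg]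
  have hshift := intervalIntegral.integral_comp_add_right (a := a) (b := 1) (fun σ : ℝ =>
    (σ - α) ^ (2 * m) * Real.log ((1 - s * Real.exp (-2 * Real.pi * (σ - 1 / 2) * Δ)) /
      (1 - s * Real.exp (-2 * Real.pi * Δ)))) (1 / 2)
  rw [show a + 1 / 2 = α by rw [ha]; ring, show (1 : ℝ) + 1 / 2 = 3 / 2 by norm_num] at hshift
  rw [logRatioIntegral, ← hshift, intervalIntegral.integral_of_le (by linarith)]
  refine setIntegral_congr_fun measurableSet_Ioc fun σ hσ => ?_
  have h2 := log_ratio_eq_setIntegral hs1 hΔ (by linarith [hσ.1] : 0 < σ) hσ.2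
  rw [show σ + 1 / 2 - 1 / 2 = σ by ring, h2, show σ + 1 / 2 - α = σ - a by rw [ha]; ring]
  ring

/-! ### The extremal functions -/

section Extremal

variable {m : ℕ} {a Δ s : ℝ} (ha : 0 ≤ a) (ha1 : a ≤ 1) (hs : s = 1 ∨ s = -1) (hΔ : 1 ≤ Δ)

theorem le_one_of_eq_or (hs : s = 1 ∨ s = -1) : s ≤ 1 := by
  rcases hs with rfl | rfl <;> norm_num

/-- The difference between the extremal function and `f_{2m+1,α}`. -/
noncomputable def remainder (m : ℕ) (a Δ s x : ℝ) : ℝ :=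
  ∫ l in Set.Ioc a 1, remKernel m a Δ s l x

theorem stronglyMeasurable_remKernel (m : ℕ) (a Δ s : ℝ) :
    StronglyMeasurable (Function.uncurry (remKernel m a Δ s)) := by
  apply Measurable.stronglyMeasurable
  unfold remKernel wt dens Function.uncurry
  fun_prop

include ha hs hΔ in
theorem norm_remKernel_le :
    ∀ l ∈ Set.Ioc a 1, ∀ x : ℝ, ‖remKernel m a Δ s l x‖ ≤ 2 * (1 + x ^ 2)⁻¹ :=
  fun _ hl x => abs_remKernel_le ha hl hs hΔ x

include ha hs hΔ in
theorem extremal_ofReal (x : ℝ) : extremal m a Δ s x =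
    (((∫ l in Set.Ioc a 1, wt m a l / (x ^ 2 + l ^ 2)) + remainder m a Δ s x : ℝ) : ℂ) := by
  rw [remainder, ← integral_add (integrableOn_section (stronglyMeasurable_wt_div m a)
    (norm_wt_div_le ha) x) (integrableOn_section (stronglyMeasurable_remKernel m a Δ s)
    (norm_remKernel_le ha hs hΔ) x), ← integral_complex_ofReal, extremal]
  exact setIntegral_congr_fun measurableSet_Ioc fun l hl =>
    bandKernel_mul_weight (le_one_of_eq_or hs) (by linarith) (by linarith [hl.1]) x

include ha hs hΔ in
theorem isRealEntire_extremal : IsRealEntire (extremal m a Δ s) := by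
  refine ⟨differentiable_setIntegral_mul ?_ (continuous_bandKernel Δ)
    (differentiable_bandKernel Δ), fun x => ?_⟩
  · refine Integrable.mono' (g := fun _ => (1 : ℝ)) ?_ ?_ ?_
    · exact (integrableOn_const_iff).2 (Or.inr (by simp))
    · refine Measurable.aestronglyMeasurable ?_
      unfold wt dens
      fun_prop
    · filter_upwards [ae_restrict_mem measurableSet_Ioc] with l hl
      have hl0 : 0 < l := by linarith [hl.1]
      have h1 := dens_pos (le_one_of_eq_or hs) (by linarith : 0 < Δ) hl0
      have h2 := wt_nonneg (m := m) ha hl.1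
      rw [Complex.norm_real, Real.norm_of_nonneg (by positivity), div_le_one h1]
      refine (wt_le_sq ha hl).trans (le_trans ?_
        (two_mul_sq_le_dens (le_one_of_eq_or hs) (by linarith : 0 < Δ) hl0.le))
      have h3 : 1 ≤ Real.pi * Δ := by nlinarith [Real.pi_gt_three]
      nlinarith [mul_le_mul_of_nonneg_right h3 hl0.le]
  · rw [extremal_ofReal ha hs hΔ]
    exact Complex.ofReal_im _

include ha ha1 hs hΔ in
theorem norm_extremal_le (z : ℂ) : ‖extremal m a Δ s z‖ ≤
    128 * (Δ ^ 2 * Real.exp (2 * Real.pi * Δ * |z.im|) / (1 + Δ * ‖z‖)) := by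
  have h := norm_setIntegral_le_of_norm_le_const (μ := volume) (s := Set.Ioc a 1)
    (f := fun l => ((wt m a l / dens s Δ l : ℝ) : ℂ) * bandKernel Δ l z) (by simp)
    fun l hl => norm_kernel_le (m := m) ha hl (le_one_of_eq_or hs) hΔ z
  refine h.trans (mul_le_of_le_one_right (by positivity) ?_)
  rw [Real.volume_real_Ioc_of_le ha1]
  linarith

include ha ha1 hs hΔ in
theorem hasExpType_extremal : HasExpType (extremal m a Δ s) (2 * Real.pi * Δ) := by
  refine hasExpType_of_bound fun ε hε => ⟨128 * Δ ^ 2, fun z => ?_⟩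
  refine (norm_extremal_le ha ha1 hs hΔ z).trans ?_
  rw [← mul_div_assoc, ← mul_assoc]
  have hpi := Real.pi_pos
  refine (div_le_self (by positivity) ?_).trans ?_
  · have : 0 ≤ Δ * ‖z‖ := by positivity
    linarith
  · gcongr
    · linarith
    · exact Complex.abs_im_le_norm z

include ha ha1 in
theorem abs_integral_wt_div_le (x : ℝ) :
    |∫ l in Set.Ioc a 1, wt m a l / (x ^ 2 + l ^ 2)| ≤ (1 + x ^ 2)⁻¹ := by
  have h := norm_setIntegral_le_of_norm_le_const (μ := volume) (s := Set.Ioc a 1)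
    (f := fun l => wt m a l / (x ^ 2 + l ^ 2)) (by simp) fun l hl => norm_wt_div_le ha l hl x
  rw [one_mul] at h
  refine h.trans (mul_le_of_le_one_right (by positivity) ?_)
  rw [Real.volume_real_Ioc_of_le ha1]
  linarith

include ha ha1 hs hΔ in
theorem abs_remainder_le (x : ℝ) : |remainder m a Δ s x| ≤ 2 * (1 + x ^ 2)⁻¹ := by
  have h := norm_setIntegral_le_of_norm_le_const (μ := volume) (s := Set.Ioc a 1)
    (f := fun l => remKernel m a Δ s l x) (by simp) fun l hl => norm_remKernel_le ha hs hΔ l hl x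
  refine h.trans (mul_le_of_le_one_right (by positivity) ?_)
  rw [Real.volume_real_Ioc_of_le ha1]
  linarith

include ha ha1 hs hΔ in
theorem norm_extremal_ofReal_le (x : ℝ) : ‖extremal m a Δ s x‖ ≤ 3 * (1 + x ^ 2)⁻¹ := by
  rw [extremal_ofReal ha hs hΔ, Complex.norm_real]
  refine (norm_add_le _ _).trans ?_
  have h1 := abs_integral_wt_div_le (m := m) ha ha1 x
  have h2 := abs_remainder_le (m := m) ha ha1 hs hΔ x
  rw [Real.norm_eq_abs, Real.norm_eq_abs]
  linarith

include ha ha1 hs hΔ in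
theorem abs_remainder_le_near {x x₀ : ℝ} (hx : x ≠ 0)
    (hcos : Real.cos (2 * Real.pi * Δ * x₀) = s) :
    |remainder m a Δ s x| ≤ (x - x₀) ^ 2 / x ^ 2 := by
  have h := norm_setIntegral_le_of_norm_le_const (μ := volume) (s := Set.Ioc a 1)
    (f := fun l => remKernel m a Δ s l x) (by simp)
    fun l hl => abs_remKernel_le_near ha hl hs (by linarith) hx hcos
  refine h.trans (mul_le_of_le_one_right (by positivity) ?_)
  rw [Real.volume_real_Ioc_of_le ha1]
  linarith

theorem remainder_eq_zero {x : ℝ} (hcos : Real.cos (2 * Real.pi * Δ * x) = s) :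
    remainder m a Δ s x = 0 := by
  simp [remainder, remKernel, hcos]

include ha hΔ in
theorem remainder_nonneg (x : ℝ) : 0 ≤ remainder m a Δ 1 x := by
  refine setIntegral_nonneg measurableSet_Ioc fun l hl => ?_
  have hl0 : 0 < l := by linarith [hl.1]
  have h1 := dens_pos le_rfl (by linarith : 0 < Δ) hl0
  have h2 := wt_nonneg (m := m) ha hl.1
  have h3 := Real.cos_le_one (2 * Real.pi * Δ * x)
  exact div_nonneg (mul_nonneg h2 (by linarith)) (by positivity)

include ha hΔ in
theorem remainder_nonpos (x : ℝ) : remainder m a Δ (-1) x ≤ 0 := by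
  refine setIntegral_nonpos measurableSet_Ioc fun l hl => ?_
  have hl0 : 0 < l := by linarith [hl.1]
  have h1 := dens_pos (by norm_num : (-1 : ℝ) ≤ 1) (by linarith : 0 < Δ) hl0
  have h2 := wt_nonneg (m := m) ha hl.1
  have h3 := Real.neg_one_le_cos (2 * Real.pi * Δ * x)
  exact div_nonpos_of_nonpos_of_nonneg (mul_nonpos_of_nonneg_of_nonpos h2 (by linarith))
    (by positivity)

include ha in
theorem integrable_integral_wt_div :
    Integrable fun x : ℝ => ∫ l in Set.Ioc a 1, wt m a l / (x ^ 2 + l ^ 2) :=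
  integrable_setIntegral_section (stronglyMeasurable_wt_div m a) (norm_wt_div_le ha)

include ha hs hΔ in
theorem integrable_remainder : Integrable (remainder m a Δ s) :=
  integrable_setIntegral_section (stronglyMeasurable_remKernel m a Δ s) (norm_remKernel_le ha hs hΔ)

include ha hs hΔ in
theorem integrable_extremal : Integrable fun x : ℝ => extremal m a Δ s x := by
  simp_rw [extremal_ofReal ha hs hΔ]
  exact ((integrable_integral_wt_div ha).add (integrable_remainder ha hs hΔ)).ofReal

end Extremal

/-! ### Fourier transforms of the kernels -/

theorem integrable_inv_mul_exp {l : ℝ} (hl : 0 < l) (ξ : ℝ) :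
    Integrable fun x : ℝ => (((x ^ 2 + l ^ 2)⁻¹ : ℝ) : ℂ) *
      Complex.exp (-2 * Real.pi * Complex.I * x * ξ) := by
  refine (integrable_inv_sq_add_sq hl).mono' (Measurable.aestronglyMeasurable (by fun_prop))
    (Eventually.of_forall fun x => ?_)
  rw [norm_mul, Complex.norm_real, Complex.norm_exp, Real.norm_of_nonneg (by positivity)]
  simp

/-- Multiplication by `cos 2πΔx` averages the two translates of the transform by `±Δ`. -/
theorem integral_band_mul_exp {Δ l : ℝ} (hl : 0 < l) (ξ : ℝ) :
    ∫ x : ℝ, (((Real.cosh (2 * Real.pi * Δ * l) - Real.cos (2 * Real.pi * Δ * x)) /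
      (x ^ 2 + l ^ 2) : ℝ) : ℂ) * Complex.exp (-2 * Real.pi * Complex.I * x * ξ) =
    ((Real.pi / l * (Real.cosh (2 * Real.pi * Δ * l) * Real.exp (-(2 * Real.pi * l * |ξ|)) -
      (Real.exp (-(2 * Real.pi * l * |ξ - Δ|)) + Real.exp (-(2 * Real.pi * l * |ξ + Δ|))) / 2)
      : ℝ) : ℂ) := by
  have hrw : ∀ x : ℝ, (((Real.cosh (2 * Real.pi * Δ * l) - Real.cos (2 * Real.pi * Δ * x)) /
      (x ^ 2 + l ^ 2) : ℝ) : ℂ) * Complex.exp (-2 * Real.pi * Complex.I * x * ξ) =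
      (Real.cosh (2 * Real.pi * Δ * l) : ℂ) * ((((x ^ 2 + l ^ 2)⁻¹ : ℝ) : ℂ) *
        Complex.exp (-2 * Real.pi * Complex.I * x * ξ)) -
      (1 / 2 : ℂ) * ((((x ^ 2 + l ^ 2)⁻¹ : ℝ) : ℂ) *
        Complex.exp (-2 * Real.pi * Complex.I * x * (ξ - Δ : ℝ)) + (((x ^ 2 + l ^ 2)⁻¹ : ℝ) : ℂ) *
        Complex.exp (-2 * Real.pi * Complex.I * x * (ξ + Δ : ℝ))) := by
    intro x
    have h1 : Complex.exp (-2 * Real.pi * Complex.I * x * (ξ - Δ : ℝ)) =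
        Complex.exp (2 * Real.pi * Δ * x * Complex.I) *
          Complex.exp (-2 * Real.pi * Complex.I * x * ξ) := by
      rw [← Complex.exp_add]
      congr 1
      push_cast
      ring
    have h2 : Complex.exp (-2 * Real.pi * Complex.I * x * (ξ + Δ : ℝ)) =
        Complex.exp (-(2 * Real.pi * Δ * x) * Complex.I) *
          Complex.exp (-2 * Real.pi * Complex.I * x * ξ) := by
      rw [← Complex.exp_add]
      congr 1
      push_cast
      ring
    rw [h1, h2]
    push_cast
    rw [Complex.cos]
    ring
  have i1 := integrable_inv_mul_exp hl ξ
  have i2 := integrable_inv_mul_exp hl (ξ - Δ)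
  have i3 := integrable_inv_mul_exp hl (ξ + Δ)
  have i23 : Integrable fun x : ℝ => (((x ^ 2 + l ^ 2)⁻¹ : ℝ) : ℂ) *
      Complex.exp (-2 * Real.pi * Complex.I * x * (ξ - Δ : ℝ)) + (((x ^ 2 + l ^ 2)⁻¹ : ℝ) : ℂ) *
      Complex.exp (-2 * Real.pi * Complex.I * x * (ξ + Δ : ℝ)) := i2.add i3
  simp_rw [hrw]
  rw [integral_sub (i1.const_mul _) (i23.const_mul _), integral_const_mul,
    integral_const_mul, integral_add i2 i3, integral_inv_sq_add_sq_mul_exp hl,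
    integral_inv_sq_add_sq_mul_exp hl, integral_inv_sq_add_sq_mul_exp hl]
  push_cast
  ring

theorem realFourier_extremal_eq {m : ℕ} {a Δ s : ℝ} (ha : 0 ≤ a) (hs : s = 1 ∨ s = -1)
    (hΔ : 1 ≤ Δ) (ξ : ℝ) :
    realFourier (extremal m a Δ s) ξ = ((∫ l in Set.Ioc a 1, wt m a l / dens s Δ l *
      (Real.pi / l * (Real.cosh (2 * Real.pi * Δ * l) * Real.exp (-(2 * Real.pi * l * |ξ|)) -
      (Real.exp (-(2 * Real.pi * l * |ξ - Δ|)) + Real.exp (-(2 * Real.pi * l * |ξ + Δ|))) / 2))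
      : ℝ) : ℂ) := by
  have hΔ0 : 0 < Δ := by linarith
  set k : ℝ → ℝ → ℂ := fun l x =>
    ((wt m a l / (x ^ 2 + l ^ 2) + remKernel m a Δ s l x : ℝ) : ℂ) *
      Complex.exp (-2 * Real.pi * Complex.I * x * ξ) with hk
  have hmeas : StronglyMeasurable (Function.uncurry k) := by
    apply Measurable.stronglyMeasurable
    simp only [hk]
    unfold remKernel wt dens Function.uncurry
    fun_prop
  have hb : ∀ l ∈ Set.Ioc a 1, ∀ x, ‖k l x‖ ≤ 3 * (1 + x ^ 2)⁻¹ := by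
    intro l hl x
    have h1 := norm_wt_div_le (m := m) ha l hl x
    have h2 := norm_remKernel_le (m := m) ha hs hΔ l hl x
    have h3 := norm_add_le (wt m a l / (x ^ 2 + l ^ 2)) (remKernel m a Δ s l x)
    have h4 : ‖Complex.exp (-2 * Real.pi * Complex.I * x * ξ)‖ = 1 := by
      rw [Complex.norm_exp]
      simp
    simp only [hk]
    rw [norm_mul, h4, mul_one, Complex.norm_real]
    linarith
  have hx : ∀ x : ℝ, extremal m a Δ s x * Complex.exp (-2 * Real.pi * Complex.I * x * ξ) =
      ∫ l in Set.Ioc a 1, k l x := by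
    intro x
    simp only [hk]
    rw [integral_mul_const, extremal]
    congr 1
    exact setIntegral_congr_fun measurableSet_Ioc fun l hl =>
      bandKernel_mul_weight (le_one_of_eq_or hs) hΔ0 (by linarith [hl.1]) x
  rw [realFourier_eq]
  simp_rw [hx]
  rw [integral_setIntegral_swap hmeas hb, ← integral_complex_ofReal]
  refine setIntegral_congr_fun measurableSet_Ioc fun l hl => ?_
  have hl0 : 0 < l := by linarith [hl.1]
  simp only [hk]
  rw [Complex.ofReal_mul, ← integral_band_mul_exp hl0, ← integral_const_mul]
  congr 1 with x
  rw [← bandKernel_mul_weight (le_one_of_eq_or hs) hΔ0 hl0, bandKernel_ofReal hΔ0 hl0]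
  ring

/-- For `|ξ| > Δ` the numbers `ξ` and `ξ ± Δ` have the same sign, and the exponentials cancel for
each `l`. -/
theorem realFourier_extremal_eq_zero {m : ℕ} {a Δ s : ℝ} (ha : 0 ≤ a) (hs : s = 1 ∨ s = -1)
    (hΔ : 1 ≤ Δ) {ξ : ℝ} (hξ : Δ < |ξ|) : realFourier (extremal m a Δ s) ξ = 0 := by
  rw [realFourier_extremal_eq ha hs hΔ, Complex.ofReal_eq_zero]
  refine setIntegral_eq_zero_of_forall_eq_zero fun l hl => ?_
  have hz : Real.cosh (2 * Real.pi * Δ * l) * Real.exp (-(2 * Real.pi * l * |ξ|)) =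
      (Real.exp (-(2 * Real.pi * l * |ξ - Δ|)) + Real.exp (-(2 * Real.pi * l * |ξ + Δ|))) / 2 := by
    rw [Real.cosh_eq, div_mul_eq_mul_div, add_mul, ← Real.exp_add, ← Real.exp_add]
    rcases lt_abs.1 hξ with h | h
    · rw [abs_of_pos (by linarith : 0 < ξ), abs_of_pos (by linarith : 0 < ξ - Δ),
        abs_of_pos (by linarith : 0 < ξ + Δ)]
      ring_nf
    · rw [abs_of_neg (by linarith : ξ < 0), abs_of_neg (by linarith : ξ - Δ < 0),
        abs_of_neg (by linarith : ξ + Δ < 0), add_comm (Real.exp _)]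
      ring_nf
  rw [hz]
  ring

/-- For `0 ≤ ξ ≤ Δ` the number `ξ - Δ` is nonpositive, and the cancellation leaves a `sinh`. -/
theorem realFourier_extremal_of_mem {m : ℕ} {a Δ s : ℝ} (ha : 0 ≤ a) (hs : s = 1 ∨ s = -1)
    (hΔ : 1 ≤ Δ) {ξ : ℝ} (h0 : 0 ≤ ξ) (h1 : ξ ≤ Δ) :
    realFourier (extremal m a Δ s) ξ = ((∫ l in Set.Ioc a 1, (l - a) ^ (2 * m + 1) / (2 * m + 1) *
      (Real.pi * Real.sinh (2 * Real.pi * (Δ - ξ) * l) / dens s Δ l) : ℝ) : ℂ) := by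
  rw [realFourier_extremal_eq ha hs hΔ]
  congr 1
  refine setIntegral_congr_fun measurableSet_Ioc fun l hl => ?_
  have hl0 : 0 < l := by linarith [hl.1]
  have hz : Real.cosh (2 * Real.pi * Δ * l) * Real.exp (-(2 * Real.pi * l * |ξ|)) -
      (Real.exp (-(2 * Real.pi * l * |ξ - Δ|)) + Real.exp (-(2 * Real.pi * l * |ξ + Δ|))) / 2 =
      Real.sinh (2 * Real.pi * (Δ - ξ) * l) := by
    rw [abs_of_nonneg h0, abs_of_nonpos (by linarith : ξ - Δ ≤ 0),
      abs_of_nonneg (by linarith : 0 ≤ ξ + Δ), Real.cosh_eq, Real.sinh_eq, div_mul_eq_mul_div,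
      add_mul, ← Real.exp_add, ← Real.exp_add]
    ring_nf
  rw [hz, pow_div_eq_wt_div hl0.ne']
  ring

theorem realFourier_neg {g : ℂ → ℂ} (hg : ∀ z, g (-z) = g z) (ξ : ℝ) :
    realFourier g (-ξ) = realFourier g ξ := by
  rw [realFourier_eq, realFourier_eq, ← integral_neg_eq_self]
  congr 1 with x
  push_cast
  rw [hg]
  ring_nf

theorem integral_pow_div {m : ℕ} {a : ℝ} (ha1 : a ≤ 1) :
    ∫ l in Set.Ioc a 1, (l - a) ^ (2 * m + 1) / (2 * m + 1) =
      (1 - a) ^ (2 * m + 2) / ((2 * (m : ℝ) + 1) * (2 * (m : ℝ) + 2)) := by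
  rw [integral_div, ← intervalIntegral.integral_of_le ha1,
    intervalIntegral.integral_comp_sub_right (fun x : ℝ => x ^ (2 * m + 1)), integral_pow, sub_self]
  push_cast
  rw [div_div]
  simp
  ring

theorem integral_integral_wt_div {m : ℕ} {a : ℝ} (ha : 0 ≤ a) (ha1 : a ≤ 1) :
    ∫ x : ℝ, ∫ l in Set.Ioc a 1, wt m a l / (x ^ 2 + l ^ 2) =
      Real.pi * (1 - a) ^ (2 * m + 2) / ((2 * (m : ℝ) + 1) * (2 * (m : ℝ) + 2)) := by
  rw [integral_setIntegral_swap (stronglyMeasurable_wt_div m a) (norm_wt_div_le ha), mul_div_assoc,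
    ← integral_pow_div ha1, ← integral_const_mul]
  refine setIntegral_congr_fun measurableSet_Ioc fun l hl => ?_
  have hl0 : 0 < l := by linarith [hl.1]
  have h := integral_inv_sq_add_sq_mul_exp hl0 0
  simp only [Complex.ofReal_zero, mul_zero, Complex.exp_zero, mul_one, abs_zero, neg_zero,
    Real.exp_zero] at h
  rw [integral_complex_ofReal] at h
  have h' : ∫ x : ℝ, (x ^ 2 + l ^ 2)⁻¹ = Real.pi / l := by exact_mod_cast h
  simp only [div_eq_mul_inv (wt m a l)]
  rw [integral_const_mul, h', pow_div_eq_wt_div hl0.ne']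
  ring

theorem realFourier_extremal_zero {m : ℕ} {a Δ s : ℝ} (ha : 0 ≤ a) (ha1 : a ≤ 1)
    (hs : s = 1 ∨ s = -1) (hΔ : 1 ≤ Δ) :
    realFourier (extremal m a Δ s) 0 =
      ((Real.pi * (1 - a) ^ (2 * m + 2) / ((2 * (m : ℝ) + 1) * (2 * (m : ℝ) + 2)) +
        Δ⁻¹ * ∫ l in Set.Ioc a 1, (l - a) ^ (2 * m + 1) / (2 * m + 1) * logDens s Δ l : ℝ) : ℂ) := by
  have hΔ0 : 0 < Δ := by linarith
  rw [realFourier_extremal_of_mem ha hs hΔ le_rfl hΔ0.le]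
  congr 1
  have hi := integrableOn_pow_mul_logDens (m := m) ha hs hΔ0
  have hi' : IntegrableOn (fun l : ℝ => (l - a) ^ (2 * m + 1) / (2 * m + 1)) (Set.Ioc a 1) :=
    (by fun_prop : Continuous fun l : ℝ => (l - a) ^ (2 * m + 1) / (2 * (m : ℝ) + 1)).integrableOn_Ioc
  rw [mul_div_assoc, ← integral_pow_div ha1, ← integral_const_mul, ← integral_const_mul,
    ← integral_add (hi'.const_mul _) (hi.const_mul _)]
  refine setIntegral_congr_fun measurableSet_Ioc fun l hl => ?_
  have hl0 : 0 < l := by linarith [hl.1]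
  simp only [sub_zero]
  rw [pi_mul_sinh_div_dens hs hΔ0 hl0]
  ring

theorem integral_remainder {m : ℕ} {a Δ s : ℝ} (ha : 0 ≤ a) (ha1 : a ≤ 1)
    (hs : s = 1 ∨ s = -1) (hΔ : 1 ≤ Δ) :
    ∫ x : ℝ, remainder m a Δ s x =
      Δ⁻¹ * ∫ l in Set.Ioc a 1, (l - a) ^ (2 * m + 1) / (2 * m + 1) * logDens s Δ l := by
  have h := realFourier_extremal_zero (m := m) ha ha1 hs hΔ
  rw [realFourier_eq] at h
  simp only [Complex.ofReal_zero, mul_zero, Complex.exp_zero, mul_one] at h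
  simp_rw [extremal_ofReal ha hs hΔ] at h
  rw [integral_complex_ofReal, integral_add (integrable_integral_wt_div ha)
    (integrable_remainder ha hs hΔ), integral_integral_wt_div ha ha1] at h
  have h' := Complex.ofReal_injective h
  linarith

/-! ### Optimality and uniqueness -/

/-- The shift is `t = 0` for `s = 1` and `t = 1/(2Δ)` for `s = -1`. Excluding `n = 0` from the
second claim treats both signs alike; the origin is a node only for `s = 1`. -/
theorem cos_node {Δ s : ℝ} (hs : s = 1 ∨ s = -1) (hΔ : 0 < Δ) :
    ∃ t : ℝ, (∀ n : ℤ, Real.cos (2 * Real.pi * Δ * (Δ⁻¹ * n + t)) = s) ∧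
      ∀ n : ℤ, n ≠ 0 → Δ⁻¹ * n + t ≠ 0 := by
  rcases hs with rfl | rfl
  · refine ⟨0, fun n => ?_, fun n hn => ?_⟩
    · rw [show 2 * Real.pi * Δ * (Δ⁻¹ * n + 0) = n * (2 * Real.pi) by field_simp; ring]
      exact Real.cos_int_mul_two_pi n
    · have : (n : ℝ) ≠ 0 := by exact_mod_cast hn
      rw [add_zero]
      exact mul_ne_zero (inv_ne_zero hΔ.ne') this
  · refine ⟨Δ⁻¹ * (1 / 2), fun n => ?_, fun n _ => ?_⟩
    · rw [show 2 * Real.pi * Δ * (Δ⁻¹ * n + Δ⁻¹ * (1 / 2)) = n * (2 * Real.pi) + Real.pi by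
        field_simp]
      exact Real.cos_int_mul_two_pi_add_pi n
    · rw [← mul_add]
      refine mul_ne_zero (inv_ne_zero hΔ.ne') fun h => ?_
      have h2 : (2 * n + 1 : ℝ) = 0 := by linarith
      have h3 : (2 * n + 1 : ℤ) = 0 := by exact_mod_cast h2
      omega

section Optimality

variable {m : ℕ} {α Δ : ℝ} (h0 : 1 / 2 ≤ α) (h1 : α ≤ 1) (hΔ : 1 ≤ Δ)

include h0 h1 hΔ

theorem extremal_ofReal_eq_fOdd {s : ℝ} (hs : s = 1 ∨ s = -1) (x : ℝ) :
    extremal m (α - 1 / 2) Δ s x = ((fOdd m α x + remainder m (α - 1 / 2) Δ s x : ℝ) : ℂ) := by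
  rw [extremal_ofReal (by linarith) hs hΔ, fOdd_eq h0 h1]

omit hΔ in
theorem integrable_fOdd : Integrable (fOdd m α) := by
  rw [show fOdd m α = _ from funext (fOdd_eq h0 h1)]
  exact integrable_integral_wt_div (by linarith)

theorem one_sided_approximation {s : ℝ} (hs : s = 1 ∨ s = -1) {h : ℂ → ℂ} (hh : IsRealEntire h)
    (htype : HasExpType h (2 * Real.pi * Δ)) (hint : Integrable fun x : ℝ => h x)
    (hle : ∀ x : ℝ, 0 ≤ s * ((h x).re - fOdd m α x)) :
    0 ≤ s * (∫ x : ℝ, (h x - extremal m (α - 1 / 2) Δ s x)).re ∧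
    (s * (∫ x : ℝ, (h x - extremal m (α - 1 / 2) Δ s x)).re ≤ 0 →
      h = extremal m (α - 1 / 2) Δ s) := by
  set a := α - 1 / 2 with ha
  have ha0 : 0 ≤ a := by linarith
  have ha1 : a ≤ 1 := by linarith
  have hΔ0 : 0 < Δ := by linarith
  have habs : |s| = 1 := by rcases hs with rfl | rfl <;> norm_num
  obtain ⟨t, hcos, hne⟩ := cos_node hs hΔ0
  set F : ℂ → ℂ := fun z => (s : ℂ) * (h z - extremal m a Δ s z) with hF
  have hg := isRealEntire_extremal (m := m) ha0 hs hΔ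
  have hFe : IsRealEntire F := by
    refine ⟨(hh.sub hg).entire.const_mul _, fun x => ?_⟩
    simp only [hF]
    rw [Complex.im_ofReal_mul, (hh.sub hg).real_on_real, mul_zero]
  have hFt : HasExpType F (2 * Real.pi * Δ) := by
    have := HasExpType.sub hh.entire hg.entire htype (hasExpType_extremal ha0 ha1 hs hΔ)
    rw [hasExpType_iff] at this ⊢
    simpa [hF, habs] using this
  have hFi : Integrable fun x : ℝ => F x :=
    (hint.sub (integrable_extremal ha0 hs hΔ)).const_mul _
  have hFx : ∀ x : ℝ, (F x).re = s * ((h x).re - fOdd m α x) - s * remainder m a Δ s x := by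
    intro x
    simp only [hF]
    rw [Complex.re_ofReal_mul, Complex.sub_re, extremal_ofReal_eq_fOdd h0 h1 hΔ hs,
      Complex.ofReal_re]
    ring
  have hpos : ∀ n : ℤ, 0 ≤ (F ((Δ⁻¹ * n + t : ℝ) : ℂ)).re := by
    intro n
    rw [hFx, remainder_eq_zero (hcos n), mul_zero, sub_zero]
    exact hle _
  have hI : (∫ x : ℝ, F x).re = s * (∫ x : ℝ, (h x - extremal m a Δ s x)).re := by
    simp only [hF]
    rw [integral_const_mul, Complex.re_ofReal_mul]
  refine ⟨hI ▸ integral_re_nonneg_of_nodes t hΔ0 hFe hFt hFi hpos, fun hle0 => ?_⟩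
  rw [← hI] at hle0
  have hz := eq_zero_of_nodes t hΔ0 hFe hFt hFi hpos ?_ hle0
  · funext z
    have hs0 : (s : ℂ) ≠ 0 := by
      rcases hs with rfl | rfl <;> simp
    exact sub_eq_zero.1 ((mul_eq_zero.1 (hz z)).resolve_left hs0)
  · intro n hn
    set x₀ := Δ⁻¹ * n + t with hx₀
    have hx₀' : x₀ ≠ 0 := hne n hn
    have hx2 : 0 < x₀ ^ 2 := by positivity
    -- Near `x₀` one has `x² > x₀²/4`, so the bound `(x - x₀)²/x²` on the remainder is at most `4 (x
    -- - x₀)²/x₀²`.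
    refine ⟨4 * (x₀ ^ 2)⁻¹, ?_⟩
    have hev : ∀ᶠ x : ℝ in 𝓝 x₀, x₀ ^ 2 / 4 < x ^ 2 :=
      (by fun_prop : Continuous fun x : ℝ => x ^ 2).continuousAt.eventually
        (lt_mem_nhds (by linarith))
    filter_upwards [hev] with x hx
    have hxne : x ≠ 0 := by rintro rfl; norm_num at hx; linarith
    have hr := abs_remainder_le_near (m := m) ha0 ha1 hs hΔ hxne (hcos n)
    have h3 : s * remainder m a Δ s x ≤ |remainder m a Δ s x| := by
      refine (le_abs_self _).trans ?_
      rw [abs_mul, habs, one_mul]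
    have h4 : (x - x₀) ^ 2 / x ^ 2 ≤ 4 * (x₀ ^ 2)⁻¹ * (x - x₀) ^ 2 := by
      rw [← div_eq_mul_inv, div_mul_eq_mul_div, div_le_div_iff₀ (by positivity) (by positivity)]
      nlinarith [sq_nonneg (x - x₀)]
    rw [hFx]
    have := hle x
    linarith

theorem isAdmissiblePair_extremal : IsAdmissiblePair (fOdd m α) (2 * Real.pi * Δ)
    (extremal m (α - 1 / 2) Δ (-1)) (extremal m (α - 1 / 2) Δ 1) where
  realEntire_minor := isRealEntire_extremal (by linarith) (Or.inr rfl) hΔ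
  realEntire_major := isRealEntire_extremal (by linarith) (Or.inl rfl) hΔ
  expType_minor := hasExpType_extremal (by linarith) (by linarith) (Or.inr rfl) hΔ
  expType_major := hasExpType_extremal (by linarith) (by linarith) (Or.inl rfl) hΔ
  minor_le x := by
    rw [extremal_ofReal_eq_fOdd h0 h1 hΔ (Or.inr rfl), Complex.ofReal_re]
    linarith [remainder_nonpos (m := m) (a := α - 1 / 2) (by linarith) hΔ x]
  le_major x := by
    rw [extremal_ofReal_eq_fOdd h0 h1 hΔ (Or.inl rfl), Complex.ofReal_re]
    linarith [remainder_nonneg (m := m) (a := α - 1 / 2) (by linarith) hΔ x]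

omit h0 h1 hΔ in
theorem IsRealEntire.ofReal_re {G : ℂ → ℂ} (hG : IsRealEntire G) (x : ℝ) :
    (((G x).re : ℝ) : ℂ) = G x :=
  Complex.ext (by simp) (by simpa using (hG.real_on_real x).symm)

omit h0 h1 hΔ in
theorem IsRealEntire.continuous_ofReal {G : ℂ → ℂ} (hG : IsRealEntire G) :
    Continuous fun x : ℝ => G x :=
  hG.entire.continuous.comp Complex.continuous_ofReal

omit h0 h1 hΔ in
theorem IsRealEntire.integrable_of_re {G : ℂ → ℂ} (hG : IsRealEntire G)
    (h : Integrable fun x : ℝ => (G x).re) : Integrable fun x : ℝ => G x := by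
  have := h.ofReal (𝕜 := ℂ)
  exact this.congr (Eventually.of_forall fun x => hG.ofReal_re x)

omit h0 h1 hΔ in
-- A finite gap dominates both `f - hm` and `hp - f`, so each competitor differs from the integrable
-- `f` by an integrable function.
theorem integrable_of_pairGap_ne_top {f : ℝ → ℝ} {τ : ℝ} {hm hp : ℂ → ℂ} (hf : Integrable f)
    (hadm : IsAdmissiblePair f τ hm hp) (hgap : pairGap hm hp ≠ ∞) :
    (Integrable fun x : ℝ => hm x) ∧ Integrable fun x : ℝ => hp x := by
  have cm := Complex.continuous_re.comp hadm.realEntire_minor.continuous_ofReal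
  have cp := Complex.continuous_re.comp hadm.realEntire_major.continuous_ofReal
  have hd : Integrable fun x : ℝ => (hp x).re - (hm x).re := by
    refine ⟨(cp.sub cm).aestronglyMeasurable, ?_⟩
    rw [hasFiniteIntegral_iff_ofReal (Eventually.of_forall fun x => ?_)]
    · exact lt_top_iff_ne_top.2 hgap
    · exact sub_nonneg.2 ((hadm.minor_le x).trans (hadm.le_major x))
  constructor
  · refine hadm.realEntire_minor.integrable_of_re ?_
    have : Integrable fun x : ℝ => f x - (hm x).re := by
      refine hd.mono' (hf.aestronglyMeasurable.sub cm.aestronglyMeasurable)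
        (Eventually.of_forall fun x => ?_)
      rw [Real.norm_of_nonneg (sub_nonneg.2 (hadm.minor_le x))]
      linarith [hadm.le_major x]
    refine (hf.sub this).congr (Eventually.of_forall fun x => ?_)
    simp
  · refine hadm.realEntire_major.integrable_of_re ?_
    have : Integrable fun x : ℝ => (hp x).re - f x := by
      refine hd.mono' (cp.aestronglyMeasurable.sub hf.aestronglyMeasurable)
        (Eventually.of_forall fun x => ?_)
      rw [Real.norm_of_nonneg (sub_nonneg.2 (hadm.le_major x))]
      linarith [hadm.minor_le x]
    refine (hf.add this).congr (Eventually.of_forall fun x => ?_)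
    simp

omit h0 h1 hΔ in
theorem pairGap_eq {f : ℝ → ℝ} {τ : ℝ} {hm hp : ℂ → ℂ}
    (hadm : IsAdmissiblePair f τ hm hp) (im : Integrable fun x : ℝ => hm x)
    (ip : Integrable fun x : ℝ => hp x) :
    0 ≤ (∫ x : ℝ, hp x).re - (∫ x : ℝ, hm x).re ∧
    pairGap hm hp = ENNReal.ofReal ((∫ x : ℝ, hp x).re - (∫ x : ℝ, hm x).re) := by
  have hnn : ∀ x : ℝ, 0 ≤ (hp x).re - (hm x).re := fun x =>
    sub_nonneg.2 ((hadm.minor_le x).trans (hadm.le_major x))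
  have ip' : Integrable fun x : ℝ => (hp x).re := ip.re
  have im' : Integrable fun x : ℝ => (hm x).re := im.re
  have hI : (∫ x : ℝ, hp x).re - (∫ x : ℝ, hm x).re = ∫ x : ℝ, ((hp x).re - (hm x).re) := by
    rw [integral_sub ip' im']
    congr 1
    · exact (integral_re ip).symm
    · exact (integral_re im).symm
  rw [hI]
  refine ⟨integral_nonneg hnn, ?_⟩
  exact (ofReal_integral_eq_lintegral_ofReal (ip'.sub im') (Eventually.of_forall hnn)).symm

/-- The gap is `∫ hp - ∫ hm`, and each integral is optimal separately. If the gaps agree, both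
one-sided inequalities are equalities. -/
theorem extremal_pair_optimal {hm hp : ℂ → ℂ}
    (hadm : IsAdmissiblePair (fOdd m α) (2 * Real.pi * Δ) hm hp) :
    pairGap (extremal m (α - 1 / 2) Δ (-1)) (extremal m (α - 1 / 2) Δ 1) ≤ pairGap hm hp ∧
    (pairGap hm hp ≤ pairGap (extremal m (α - 1 / 2) Δ (-1)) (extremal m (α - 1 / 2) Δ 1) →
      hm = extremal m (α - 1 / 2) Δ (-1) ∧ hp = extremal m (α - 1 / 2) Δ 1) := by
  have ha0 : 0 ≤ α - 1 / 2 := by linarith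
  have igm := integrable_extremal (m := m) ha0 (Or.inr rfl : (-1 : ℝ) = 1 ∨ (-1 : ℝ) = -1) hΔ
  have igp := integrable_extremal (m := m) ha0 (Or.inl rfl : (1 : ℝ) = 1 ∨ (1 : ℝ) = -1) hΔ
  obtain ⟨hg0, hg⟩ := pairGap_eq (isAdmissiblePair_extremal (m := m) h0 h1 hΔ) igm igp
  rcases eq_or_ne (pairGap hm hp) ∞ with htop | htop
  · rw [htop]
    refine ⟨le_top, fun h => ?_⟩
    rw [hg] at h
    exact absurd (top_le_iff.1 h) ENNReal.ofReal_ne_top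
  · obtain ⟨im, ip⟩ := integrable_of_pairGap_ne_top (integrable_fOdd h0 h1) hadm htop
    obtain ⟨hh0, hh⟩ := pairGap_eq hadm im ip
    obtain ⟨p1, p2⟩ := one_sided_approximation h0 h1 hΔ (Or.inl rfl) hadm.realEntire_major
      hadm.expType_major ip fun x => by linarith [hadm.le_major x]
    obtain ⟨m1, m2⟩ := one_sided_approximation h0 h1 hΔ (Or.inr rfl) hadm.realEntire_minor
      hadm.expType_minor im fun x => by linarith [hadm.minor_le x]
    rw [integral_sub ip igp, Complex.sub_re] at p1 p2
    rw [integral_sub im igm, Complex.sub_re] at m1 m2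
    rw [hg, hh]
    refine ⟨ENNReal.ofReal_le_ofReal (by linarith), fun h => ?_⟩
    rw [ENNReal.ofReal_le_ofReal_iff hg0] at h
    exact ⟨m2 (by linarith), p2 (by linarith)⟩

end Optimality

/-! ### The series for the Fourier transforms -/

theorem setIntegral_pow_mul_exp {a c : ℝ} (ha1 : a ≤ 1) (hc : c ≠ 0) (p : ℕ) :
    ∫ l in Set.Ioc a 1, (l - a) ^ p * Real.exp (-(c * l)) =
      (p.factorial : ℝ) * Real.exp (-(c * a)) / c ^ (p + 1) -
      ∑ j ∈ Finset.range (p + 1), (p.factorial : ℝ) / ((p - j).factorial : ℝ) * Real.exp (-c) /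
        c ^ (j + 1) * (1 - a) ^ (p - j) := by
  have hexp : ∀ l : ℝ, HasDerivAt (fun l : ℝ => -Real.exp (-(c * l)) / c) (Real.exp (-(c * l))) l := by
    intro l
    have h1 : HasDerivAt (fun l : ℝ => -(c * l)) (-c) l := by
      have h0 := ((hasDerivAt_id l).const_mul c).neg
      rw [mul_one] at h0
      exact h0
    have h2 := (h1.exp.neg).div_const c
    convert! h2 using 1
    field_simp
  rw [← intervalIntegral.integral_of_le ha1]
  induction p with
  | zero =>
    have h := intervalIntegral.integral_eq_sub_of_hasDerivAt (a := a) (b := 1)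
      (fun l _ => hexp l) (Continuous.intervalIntegrable (by fun_prop) _ _)
    simp only [pow_zero, one_mul, h]
    simp
    ring
  | succ p ih =>
    have hu : ∀ l : ℝ, HasDerivAt (fun l : ℝ => (l - a) ^ (p + 1)) (((p : ℝ) + 1) * (l - a) ^ p) l := by
      intro l
      have h0 := ((hasDerivAt_id l).sub_const a).pow (p + 1)
      convert! h0 using 1
      simp
    have h := intervalIntegral.integral_mul_deriv_eq_deriv_mul (a := a) (b := 1)
      (fun l _ => hu l) (fun l _ => hexp l) (Continuous.intervalIntegrable (by fun_prop) _ _)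
      (Continuous.intervalIntegrable (by fun_prop) _ _)
    have h2 : ∫ l in a..1, ((p : ℝ) + 1) * (l - a) ^ p * (-Real.exp (-(c * l)) / c) =
        -(((p : ℝ) + 1) / c) * ∫ l in a..1, (l - a) ^ p * Real.exp (-(c * l)) := by
      rw [← intervalIntegral.integral_const_mul]
      congr 1 with l
      ring
    -- The term `j = 0` is the boundary term at `l = 1` of the integration by parts; the others are
    -- those for `p`, shifted by one.
    rw [h, h2, ih, Finset.sum_range_succ' _ (p + 1), mul_sub, Finset.mul_sum]
    have hs : ∀ j ∈ Finset.range (p + 1), -(((p : ℝ) + 1) / c) * ((p.factorial : ℝ) /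
        ((p - j).factorial : ℝ) * Real.exp (-c) / c ^ (j + 1) * (1 - a) ^ (p - j)) =
        -(((p + 1).factorial : ℝ) / ((p + 1 - (j + 1)).factorial : ℝ) * Real.exp (-c) /
        c ^ (j + 1 + 1) * (1 - a) ^ (p + 1 - (j + 1))) := by
      intro j _
      rw [Nat.add_sub_add_right, Nat.factorial_succ]
      push_cast
      have : ((p - j).factorial : ℝ) ≠ 0 := by exact_mod_cast Nat.factorial_ne_zero _
      field_simp
      ring
    rw [Finset.sum_congr rfl hs, Finset.sum_neg_distrib, Nat.factorial_succ]
    have : ((p.factorial : ℝ)) ≠ 0 := by exact_mod_cast Nat.factorial_ne_zero _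
    push_cast
    simp only [sub_self, ne_eq, Nat.add_eq_zero_iff, one_ne_zero, and_false, not_false_eq_true,
      zero_pow, zero_mul, sub_zero, mul_one, pow_one, Nat.factorial_succ,
      Nat.cast_mul, Nat.cast_add, Nat.cast_one]
    field_simp
    ring

/-- The integrand for the `k`-th term of the series. -/
noncomputable def termKernel (m : ℕ) (a Δ s ξ : ℝ) (k : ℤ) (l : ℝ) : ℝ :=
  (l - a) ^ (2 * m + 1) / (2 * m + 1) *
    (Real.pi * (s ^ k * (((k : ℝ) + 1) * Real.exp (-(2 * Real.pi * |ξ + k * Δ| * l)))))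

/-- `setIntegral_pow_mul_exp` with `p = 2m + 1` and `c = 2π|ξ + kΔ|`; the `2m + 1` in `(2m+1)!`
cancels the denominator, and `π/c` yields the factor `1/2`. -/
theorem fourierTerm_eq {m : ℕ} {α Δ s ξ : ℝ} (h1 : α ≤ 1) {k : ℤ} (hk : ξ + k * Δ ≠ 0) :
    fourierTerm m α Δ s ξ k = ∫ l in Set.Ioc (α - 1 / 2) 1, termKernel m (α - 1 / 2) Δ s ξ k l := by
  have ht : 0 < |ξ + k * Δ| := abs_pos.2 hk
  have hpi := Real.pi_pos
  set t := |ξ + k * Δ| with htdef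
  have hc : 2 * Real.pi * t ≠ 0 := by positivity
  have hI := setIntegral_pow_mul_exp (a := α - 1 / 2) (c := 2 * Real.pi * t) (by linarith) hc
    (2 * m + 1)
  have hk : ∀ l, termKernel m (α - 1 / 2) Δ s ξ k l =
      (Real.pi * s ^ k * ((k : ℝ) + 1) / (2 * m + 1)) *
        ((l - (α - 1 / 2)) ^ (2 * m + 1) * Real.exp (-(2 * Real.pi * t * l))) := by
    intro l
    unfold termKernel
    ring
  simp_rw [hk]
  rw [integral_const_mul, hI]
  unfold fourierTerm gammaCoeff
  rw [← htdef]
  have hm : (2 * (m : ℝ) + 1) ≠ 0 := by positivity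
  have hsum : ∀ j ∈ Finset.range (2 * m + 1 + 1), ((2 * m + 1).factorial : ℝ) /
      ((2 * m + 1 - j).factorial : ℝ) * Real.exp (-(2 * Real.pi * t)) /
        (2 * Real.pi * t) ^ (j + 1) * (1 - (α - 1 / 2)) ^ (2 * m + 1 - j) =
      (2 * (m : ℝ) + 1) / (2 * Real.pi * t) * ((Nat.factorial (2 * m) : ℝ) /
        (Nat.factorial (2 * m + 1 - j) : ℝ) * Real.exp (-2 * Real.pi * t) /
            (2 * Real.pi * t) ^ j * (3 / 2 - α) ^ (2 * m + 1 - j)) := by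
    intro j _
    have : ((2 * m + 1 - j).factorial : ℝ) ≠ 0 := by exact_mod_cast Nat.factorial_ne_zero _
    rw [Nat.factorial_succ, show 1 - (α - 1 / 2) = 3 / 2 - α by ring,
      show -(2 * Real.pi * t) = -2 * Real.pi * t by ring]
    push_cast
    field_simp
    ring
  rw [Finset.sum_congr rfl hsum, ← Finset.mul_sum, Nat.factorial_succ,
    show -(2 * Real.pi * t * (α - 1 / 2)) = -2 * Real.pi * t * (α - 1 / 2) by ring]
  push_cast
  set X := ∑ j ∈ Finset.range (2 * m + 2), (Nat.factorial (2 * m) : ℝ) /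
        (Nat.factorial (2 * m + 1 - j) : ℝ) * Real.exp (-2 * Real.pi * t) /
            (2 * Real.pi * t) ^ j * (3 / 2 - α) ^ (2 * m + 1 - j)
  rw [show 2 * m + 1 + 1 = 2 * m + 2 by ring]
  rw [pow_succ (2 * Real.pi * t) (2 * m + 1)]
  field_simp

theorem sum_Icc_neg_eq {E : Type*} [AddCommMonoid E] (f : ℤ → E) (M N : ℕ) :
    ∑ k ∈ Finset.Icc (-(M : ℤ)) (N : ℤ), f k =
      ∑ k ∈ Finset.range (N + 1), f k + ∑ j ∈ Finset.range M, f (-((j : ℤ) + 1)) := by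
  induction M with
  | zero =>
    simp only [Nat.cast_zero, neg_zero, Finset.range_zero, Finset.sum_empty, add_zero]
    induction N with
    | zero => simp
    | succ N ih =>
      rw [Finset.sum_range_succ, ← ih]
      have : Finset.Icc (0 : ℤ) ((N + 1 : ℕ) : ℤ) =
          insert ((N + 1 : ℕ) : ℤ) (Finset.Icc (0 : ℤ) (N : ℤ)) := by
        ext x; simp only [Finset.mem_insert, Finset.mem_Icc]; push_cast; omega
      rw [this, Finset.sum_insert (by simp), add_comm]
  | succ M ih =>
    have : Finset.Icc (-((M + 1 : ℕ) : ℤ)) (N : ℤ) =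
        insert (-((M : ℤ) + 1)) (Finset.Icc (-(M : ℤ)) (N : ℤ)) := by
      ext x; simp only [Finset.mem_insert, Finset.mem_Icc]; push_cast; omega
    rw [this, Finset.sum_insert (by simp), ih, Finset.sum_range_succ _ M, add_comm, add_assoc]

/-- `u ∑_{k ≤ N} (k + 1) p^k - u⁻¹ ∑_{j < M} j p^{j+1}`. -/
noncomputable def partialKernel (p u : ℝ) (M N : ℕ) : ℝ :=
  u * ∑ k ∈ Finset.range (N + 1), ((k : ℝ) + 1) * p ^ k -
    u⁻¹ * ∑ j ∈ Finset.range M, (j : ℝ) * p ^ (j + 1)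

/-- For `k ≥ 0` the absolute value is `ξ + kΔ`; for `k = -(j+1)` it is `(j+1)Δ - ξ`, and the
coefficient `k + 1` becomes `-j`. -/
theorem sum_termKernel {m : ℕ} {a Δ s ξ : ℝ} (hs : s = 1 ∨ s = -1) (h0 : 0 < ξ) (h1 : ξ < Δ)
    (M N : ℕ) (l : ℝ) :
    ∑ k ∈ Finset.Icc (-(M : ℤ)) (N : ℤ), termKernel m a Δ s ξ k l =
      (l - a) ^ (2 * m + 1) / (2 * m + 1) * (Real.pi *
        partialKernel (s * Real.exp (-2 * Real.pi * Δ * l)) (Real.exp (-2 * Real.pi * ξ * l)) M N) := by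
  have hΔ : 0 < Δ := h0.trans h1
  unfold termKernel
  rw [← Finset.mul_sum, ← Finset.mul_sum, sum_Icc_neg_eq]
  congr 2
  unfold partialKernel
  rw [sub_eq_add_neg, Finset.mul_sum, Finset.mul_sum, ← Finset.sum_neg_distrib]
  congr 1
  · refine Finset.sum_congr rfl fun k _ => ?_
    have hk : 0 ≤ ξ + (k : ℝ) * Δ := by positivity
    rw [mul_pow, ← Real.exp_nat_mul, zpow_natCast, Int.cast_natCast, abs_of_nonneg hk,
      show -(2 * Real.pi * (ξ + (k : ℝ) * Δ) * l) =
        -2 * Real.pi * ξ * l + (k : ℝ) * (-2 * Real.pi * Δ * l) by ring, Real.exp_add]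
    ring
  · refine Finset.sum_congr rfl fun j _ => ?_
    have hj : ξ + ((-((j : ℤ) + 1) : ℤ) : ℝ) * Δ ≤ 0 := by
      push_cast
      have : 0 ≤ (j : ℝ) * Δ := by positivity
      linarith
    have hsz : s ^ (-((j : ℤ) + 1)) = s ^ (j + 1) := by
      rw [zpow_neg, ← inv_zpow]
      have : s⁻¹ = s := by rcases hs with rfl | rfl <;> norm_num
      rw [this]
      exact_mod_cast zpow_natCast s (j + 1)
    rw [mul_pow, ← Real.exp_nat_mul, hsz, abs_of_nonpos hj, ← Real.exp_neg]
    push_cast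
    rw [show -(2 * Real.pi * -(ξ + -((j : ℝ) + 1) * Δ) * l) =
        -(-2 * Real.pi * ξ * l) + ((j : ℝ) + 1) * (-2 * Real.pi * Δ * l) by ring, Real.exp_add]
    ring

/-- Both tails are derivatives of the geometric series: `∑ (k+1) p^k = (1-p)⁻²` and `∑ j p^{j+1} =
p² (1-p)⁻²`. -/
theorem tendsto_partialKernel {p u : ℝ} (hp : |p| < 1) {ι : Type*} {F : Filter ι} {M N : ι → ℕ}
    (hM : Tendsto M F atTop) (hN : Tendsto N F atTop) :
    Tendsto (fun i => partialKernel p u (M i) (N i)) F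
      (𝓝 ((u - p ^ 2 * u⁻¹) / (1 - p) ^ 2)) := by
  have hne : 1 - p ≠ 0 := by
    have := (abs_lt.1 hp).2
    intro h; linarith
  have h1 : HasSum (fun n : ℕ => (n : ℝ) * p ^ n) (p / (1 - p) ^ 2) :=
    hasSum_coe_mul_geometric_of_norm_lt_one (by simpa using hp)
  have h2 : HasSum (fun n : ℕ => p ^ n) (1 - p)⁻¹ :=
    hasSum_geometric_of_norm_lt_one (by simpa using hp)
  have h3 : HasSum (fun n : ℕ => ((n : ℝ) + 1) * p ^ n) (p / (1 - p) ^ 2 + (1 - p)⁻¹) := by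
    simpa only [add_mul, one_mul] using h1.add h2
  have h4 : HasSum (fun n : ℕ => (n : ℝ) * p ^ (n + 1)) (p / (1 - p) ^ 2 * p) := by
    simpa only [pow_succ, mul_assoc] using h1.mul_right p
  have h5 := (h3.tendsto_sum_nat.comp ((tendsto_add_atTop_nat 1).comp hN)).const_mul u
  have h6 := (h4.tendsto_sum_nat.comp hM).const_mul u⁻¹
  have h7 := h5.sub h6
  have : u * (p / (1 - p) ^ 2 + (1 - p)⁻¹) - u⁻¹ * (p / (1 - p) ^ 2 * p) =
      (u - p ^ 2 * u⁻¹) / (1 - p) ^ 2 := by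
    field_simp
    ring
  rw [this] at h7
  exact h7

theorem sum_add_one_mul_pow (p : ℝ) (K : ℕ) :
    (1 - p) ^ 2 * ∑ k ∈ Finset.range K, ((k : ℝ) + 1) * p ^ k =
      1 - ((K : ℝ) + 1) * p ^ K + K * p ^ (K + 1) := by
  induction K with
  | zero => simp
  | succ K ih =>
    rw [Finset.sum_range_succ, mul_add, ih]
    push_cast
    ring

theorem sum_mul_pow_succ (p : ℝ) (M : ℕ) :
    (1 - p) ^ 2 * ∑ j ∈ Finset.range M, (j : ℝ) * p ^ (j + 1) =
      p ^ 2 - M * p ^ (M + 1) + ((M : ℝ) - 1) * p ^ (M + 2) := by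
  induction M with
  | zero => simp
  | succ M ih =>
    rw [Finset.sum_range_succ, mul_add, ih]
    push_cast
    ring

/-! ### Bounds for the partial sums, uniform in the cut-offs -/

section Bounds

variable {q u l : ℝ} (hl0 : 0 < l) (hl1 : l ≤ 1) (hq0 : 0 < q) (hq : q ≤ Real.exp (-l))
  (hqu : q ≤ u) (hu : u ≤ 1)

include hl0 hq0 hq in
theorem mul_nat_mul_pow_le (K : ℕ) : l * (K * q ^ K) ≤ 1 := by
  have h1 : q ^ K ≤ Real.exp (-(K * l)) := by
    rw [← mul_neg, Real.exp_nat_mul]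
    exact pow_le_pow_left₀ hq0.le hq K
  have h2 := Real.add_one_le_exp ((K : ℝ) * l)
  have h3 : Real.exp ((K : ℝ) * l) * Real.exp (-(K * l)) = 1 := by rw [← Real.exp_add]; simp
  have h4 := Real.exp_pos (-((K : ℝ) * l))
  have hK : 0 ≤ (K : ℝ) * l := by positivity
  calc l * (K * q ^ K) = (K * l) * q ^ K := by ring
    _ ≤ (K * l) * Real.exp (-(K * l)) := by gcongr
    _ ≤ Real.exp ((K : ℝ) * l) * Real.exp (-(K * l)) := by gcongr; linarith
    _ = 1 := h3

include hl0 hl1 hq0 hq hqu hu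

/-- The closed forms have denominator `(1+q)² ≥ 1`, so each tail is bounded separately by `2 +
2Kq^K` with its own cut-off `K`, and `l K q^K ≤ 1`. The factor `u⁻¹` is paid for by `q ≤ u`. -/
theorem abs_partialKernel_neg_le (M N : ℕ) : l * |partialKernel (-1 * q) u M N| ≤ 8 := by
  have hq1 : q ≤ 1 := hqu.trans hu
  have hu0 : 0 < u := hq0.trans_le hqu
  have hsq : 1 ≤ (1 - -1 * q) ^ 2 := by nlinarith
  have habs : ∀ n : ℕ, |(-1 * q) ^ n| = q ^ n := by
    intro n
    rw [abs_pow, abs_mul, abs_neg, abs_one, one_mul, abs_of_pos hq0]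
  have hA : |∑ k ∈ Finset.range (N + 1), ((k : ℝ) + 1) * (-1 * q) ^ k| ≤
      2 + 2 * (((N + 1 : ℕ) : ℝ) * q ^ (N + 1)) := by
    have h1 := sum_add_one_mul_pow (-1 * q) (N + 1)
    have h2 : |∑ k ∈ Finset.range (N + 1), ((k : ℝ) + 1) * (-1 * q) ^ k| ≤
        |(1 - -1 * q) ^ 2 * ∑ k ∈ Finset.range (N + 1), ((k : ℝ) + 1) * (-1 * q) ^ k| := by
      rw [abs_mul, abs_of_nonneg (by positivity : 0 ≤ (1 - -1 * q) ^ 2)]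
      exact le_mul_of_one_le_left (abs_nonneg _) hsq
    rw [h1] at h2
    refine h2.trans ((abs_add_le _ _).trans ?_)
    have h3 := abs_sub (1 : ℝ) ((((N + 1 : ℕ) : ℝ) + 1) * (-1 * q) ^ (N + 1))
    rw [abs_mul, habs, abs_one, abs_of_nonneg (by positivity : 0 ≤ ((N + 1 : ℕ) : ℝ) + 1)] at h3
    rw [abs_mul (((N + 1 : ℕ) : ℝ)), habs, abs_of_nonneg (by positivity : 0 ≤ ((N + 1 : ℕ) : ℝ))]
    have h4 : q ^ (N + 1) ≤ 1 := pow_le_one₀ hq0.le hq1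
    have h5 : q ^ (N + 1 + 1) ≤ q ^ (N + 1) := pow_le_pow_of_le_one hq0.le hq1 (by omega)
    have h6 : ((N + 1 : ℕ) : ℝ) * q ^ (N + 1 + 1) ≤ ((N + 1 : ℕ) : ℝ) * q ^ (N + 1) := by gcongr
    linarith
  have hB : |∑ j ∈ Finset.range M, (j : ℝ) * (-1 * q) ^ (j + 1)| ≤
      q * (2 + 2 * ((M : ℝ) * q ^ M)) := by
    have h1 := sum_mul_pow_succ (-1 * q) M
    have h2 : |∑ j ∈ Finset.range M, (j : ℝ) * (-1 * q) ^ (j + 1)| ≤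
        |(1 - -1 * q) ^ 2 * ∑ j ∈ Finset.range M, (j : ℝ) * (-1 * q) ^ (j + 1)| := by
      rw [abs_mul, abs_of_nonneg (by positivity : 0 ≤ (1 - -1 * q) ^ 2)]
      exact le_mul_of_one_le_left (abs_nonneg _) hsq
    rw [h1] at h2
    refine h2.trans ((abs_add_le _ _).trans ?_)
    have h3 := abs_sub ((-1 * q) ^ 2) ((M : ℝ) * (-1 * q) ^ (M + 1))
    rw [abs_mul (M : ℝ), habs, habs, abs_of_nonneg (by positivity : 0 ≤ (M : ℝ))] at h3
    have h7 : |(M : ℝ) - 1| ≤ M + 1 := by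
      rw [abs_le]; constructor <;> linarith [Nat.cast_nonneg (α := ℝ) M]
    rw [abs_mul ((M : ℝ) - 1), habs]
    have h4 : q ^ (M + 2) ≤ q * q ^ M := by
      rw [pow_succ, pow_succ, mul_comm q]
      exact mul_le_of_le_one_right (by positivity) hq1
    have h5 : |(M : ℝ) - 1| * q ^ (M + 2) ≤ (M + 1) * (q * q ^ M) := by gcongr
    have h6 : q ^ M ≤ 1 := pow_le_one₀ hq0.le hq1
    have h8 : q ^ 2 ≤ q := by nlinarith
    have h9 : q * q ^ M ≤ q * 1 := by gcongr
    rw [pow_succ q M] at h3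
    linarith
  have hK := mul_nat_mul_pow_le hl0 hq0 hq (N + 1)
  have hM := mul_nat_mul_pow_le hl0 hq0 hq M
  have hqu' : u⁻¹ * q ≤ 1 := by rw [inv_mul_le_iff₀ hu0]; linarith
  unfold partialKernel
  have h1 := abs_sub (u * ∑ k ∈ Finset.range (N + 1), ((k : ℝ) + 1) * (-1 * q) ^ k)
    (u⁻¹ * ∑ j ∈ Finset.range M, (j : ℝ) * (-1 * q) ^ (j + 1))
  rw [abs_mul, abs_mul, abs_of_pos hu0, abs_of_pos (inv_pos.2 hu0)] at h1
  have h2 : u * |∑ k ∈ Finset.range (N + 1), ((k : ℝ) + 1) * (-1 * q) ^ k| ≤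
      2 + 2 * (((N + 1 : ℕ) : ℝ) * q ^ (N + 1)) :=
    (mul_le_of_le_one_left (abs_nonneg _) hu).trans hA
  have h3 : u⁻¹ * |∑ j ∈ Finset.range M, (j : ℝ) * (-1 * q) ^ (j + 1)| ≤
      2 + 2 * ((M : ℝ) * q ^ M) := by
    calc _ ≤ u⁻¹ * (q * (2 + 2 * ((M : ℝ) * q ^ M))) := by gcongr
      _ = (u⁻¹ * q) * (2 + 2 * ((M : ℝ) * q ^ M)) := by ring
      _ ≤ _ := mul_le_of_le_one_left (by positivity) hqu'
  calc _ ≤ l * ((2 + 2 * (((N + 1 : ℕ) : ℝ) * q ^ (N + 1))) + (2 + 2 * ((M : ℝ) * q ^ M))) := by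
        gcongr
        linarith
    _ ≤ 8 := by linarith

/-- Here `(1-q)⁻²` is too large to bound the tails separately. With equal cut-offs both contain the
same sum `T`, with total coefficient `u - q²/u ≤ 1 - q²`; this gains the missing factor `1 - q`, and
`l ≤ 2(1-q)` supplies the other. Two boundary terms remain. -/
theorem abs_partialKernel_self_le (N : ℕ) : l * |partialKernel (1 * q) u N N| ≤ 8 := by
  have hq1 : q ≤ 1 := hqu.trans hu
  have hu0 : 0 < u := hq0.trans_le hqu
  rw [one_mul]
  rcases N with _ | K
  · simp only [partialKernel, zero_add, Finset.range_one, Finset.sum_singleton, Nat.cast_zero,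
      pow_zero, mul_one, Finset.range_zero, Finset.sum_empty, mul_zero, sub_zero, abs_of_pos hu0]
    nlinarith
  · set T := ∑ i ∈ Finset.range K, ((i : ℝ) + 1) * q ^ i with hT
    have hT0 : 0 ≤ T := Finset.sum_nonneg fun i _ => by positivity
    have hT1 : (1 - q) ^ 2 * T ≤ 1 := by
      rw [hT, sum_add_one_mul_pow]
      have h5 : q ^ (K + 1) ≤ q ^ K := pow_le_pow_of_le_one hq0.le hq1 (by omega)
      have h6 : (K : ℝ) * q ^ (K + 1) ≤ K * q ^ K := by gcongr
      have h7 : 0 ≤ q ^ K := by positivity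
      linarith
    have hsplit : partialKernel q u (K + 1) (K + 1) = (u - q ^ 2 * u⁻¹) * T +
        u * (((K : ℝ) + 1) * q ^ K + ((K : ℝ) + 2) * q ^ (K + 1)) := by
      unfold partialKernel
      rw [Finset.sum_range_succ, Finset.sum_range_succ, Finset.sum_range_succ' _ K]
      have : ∑ k ∈ Finset.range K, ((k + 1 : ℕ) : ℝ) * q ^ (k + 1 + 1) = q ^ 2 * T := by
        rw [hT, Finset.mul_sum]
        refine Finset.sum_congr rfl fun i _ => ?_
        push_cast
        ring
      rw [this, ← hT]
      push_cast
      ring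
    have hpos : 0 ≤ u - q ^ 2 * u⁻¹ := by
      rw [sub_nonneg, ← div_eq_mul_inv, div_le_iff₀ hu0]
      nlinarith
    have hle : u - q ^ 2 * u⁻¹ ≤ 1 - q ^ 2 := by
      have : q ^ 2 ≤ q ^ 2 * u⁻¹ := le_mul_of_one_le_right (by positivity) ((one_le_inv₀ hu0).2 hu)
      linarith
    have hl : l ≤ 2 * (1 - q) := by
      have h1 := Real.add_one_le_exp l
      have h2 : Real.exp l * Real.exp (-l) = 1 := by rw [← Real.exp_add]; simp
      have h3 : (l + 1) * q ≤ 1 := by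
        calc _ ≤ Real.exp l * Real.exp (-l) := by gcongr
          _ = 1 := h2
      nlinarith
    have hmain : l * ((u - q ^ 2 * u⁻¹) * T) ≤ 4 := by
      calc _ ≤ 2 * (1 - q) * ((1 - q ^ 2) * T) := by gcongr
        _ = 2 * (1 + q) * ((1 - q) ^ 2 * T) := by ring
        _ ≤ 2 * (1 + 1) * 1 := by gcongr
        _ = 4 := by norm_num
    have hK := mul_nat_mul_pow_le hl0 hq0 hq K
    have hK1 := mul_nat_mul_pow_le hl0 hq0 hq (K + 1)
    push_cast at hK1
    have hp : q ^ K ≤ 1 := pow_le_one₀ hq0.le hq1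
    have hp1 : q ^ (K + 1) ≤ 1 := pow_le_one₀ hq0.le hq1
    rw [hsplit, abs_of_nonneg (by positivity), mul_add]
    have hend : l * (u * (((K : ℝ) + 1) * q ^ K + ((K : ℝ) + 2) * q ^ (K + 1))) ≤ 4 := by
      calc _ ≤ l * (1 * (((K : ℝ) + 1) * q ^ K + ((K : ℝ) + 2) * q ^ (K + 1))) := by gcongr
        _ = l * (K * q ^ K) + l * q ^ K + l * (((K : ℝ) + 1) * q ^ (K + 1)) + l * q ^ (K + 1) := by
            ring
        _ ≤ 1 + 1 * 1 + 1 + 1 * 1 := by gcongr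
        _ = 4 := by norm_num
    linarith

end Bounds

theorem add_int_mul_ne_zero {ξ Δ : ℝ} (h0 : 0 < ξ) (h1 : ξ < Δ) (k : ℤ) : ξ + k * Δ ≠ 0 := by
  rcases le_or_gt 0 k with hk | hk
  · have : (0 : ℝ) ≤ k := by exact_mod_cast hk
    have : 0 < Δ := h0.trans h1
    positivity
  · have h2 : (k : ℝ) ≤ -1 := by exact_mod_cast (by omega : k ≤ -1)
    have h3 : (k : ℝ) * Δ ≤ -1 * Δ := mul_le_mul_of_nonneg_right h2 (h0.trans h1).le
    intro h
    linarith

section Series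

variable {m : ℕ} {α Δ s ξ : ℝ} (hα0 : 1 / 2 ≤ α) (hα1 : α ≤ 1) (hs : s = 1 ∨ s = -1)
  (hΔ : 1 ≤ Δ) (h0 : 0 < ξ) (h1 : ξ < Δ)

include hα0 hα1 hs hΔ h0 h1

/-- Dominated convergence under the integral in `l`. The filter and cut-offs are arbitrary so that
symmetric and independent summation are covered at once. -/
theorem tendsto_sum_fourierTerm {ι : Type*} {F : Filter ι} [F.IsCountablyGenerated] {M N : ι → ℕ}
    (hM : Tendsto M F atTop) (hN : Tendsto N F atTop)
    (hb : ∀ i, ∀ l ∈ Set.Ioc (α - 1 / 2) 1, l * |partialKernel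
      (s * Real.exp (-2 * Real.pi * Δ * l)) (Real.exp (-2 * Real.pi * ξ * l)) (M i) (N i)| ≤ 8) :
    Tendsto (fun i => ∑ k ∈ Finset.Icc (-(M i : ℤ)) (N i : ℤ), (fourierTerm m α Δ s ξ k : ℂ)) F
      (𝓝 (realFourier (extremal m (α - 1 / 2) Δ s) ξ)) := by
  set a := α - 1 / 2 with ha
  have ha0 : 0 ≤ a := by linarith
  have hsum : ∀ i, ∑ k ∈ Finset.Icc (-(M i : ℤ)) (N i : ℤ), (fourierTerm m α Δ s ξ k : ℂ) =
      ((∫ l in Set.Ioc a 1, (l - a) ^ (2 * m + 1) / (2 * m + 1) * (Real.pi *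
        partialKernel (s * Real.exp (-2 * Real.pi * Δ * l)) (Real.exp (-2 * Real.pi * ξ * l))
          (M i) (N i)) : ℝ) : ℂ) := by
    intro i
    rw [← Complex.ofReal_sum]
    congr 1
    simp_rw [fourierTerm_eq hα1 (add_int_mul_ne_zero h0 h1 _)]
    rw [← integral_finsetSum]
    · congr 1 with l
      exact sum_termKernel hs h0 h1 _ _ l
    · intro k _
      refine Continuous.integrableOn_Ioc ?_
      unfold termKernel
      fun_prop
  simp_rw [hsum]
  rw [realFourier_extremal_of_mem ha0 hs hΔ h0.le h1.le]
  refine (Complex.continuous_ofReal.tendsto _).comp ?_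
  -- The weight `(l-a)^{2m+1}/(2m+1)` is at most `l`, which the hypothesis `hb` converts into the
  -- constant 8.
  refine tendsto_integral_filter_of_dominated_convergence (fun _ => Real.pi * 8) ?_ ?_
    ((integrableOn_const_iff).2 (Or.inr (by simp))) ?_
  · refine Eventually.of_forall fun i => Continuous.aestronglyMeasurable ?_
    unfold partialKernel
    have : ∀ l : ℝ, Real.exp (-2 * Real.pi * ξ * l) ≠ 0 := fun l => (Real.exp_pos _).ne'
    fun_prop (disch := assumption)
  · refine Eventually.of_forall fun i => ?_
    filter_upwards [ae_restrict_mem measurableSet_Ioc] with l hl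
    have hl0 : 0 < l := by linarith [hl.1]
    have h2 : (l - a) ^ (2 * m + 1) / (2 * m + 1) ≤ l := by
      rw [pow_div_eq_wt_div hl0.ne', div_le_iff₀ hl0]
      exact (wt_le_sq ha0 hl).trans (by rw [sq])
    have h3 : 0 ≤ (l - a) ^ (2 * m + 1) / (2 * (m : ℝ) + 1) :=
      div_nonneg (pow_nonneg (by linarith [hl.1]) _) (by positivity)
    rw [norm_mul, norm_mul, Real.norm_of_nonneg h3, Real.norm_of_nonneg Real.pi_pos.le,
      Real.norm_eq_abs]
    have hpi := Real.pi_pos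
    calc _ ≤ l * (Real.pi * |partialKernel (s * Real.exp (-2 * Real.pi * Δ * l))
          (Real.exp (-2 * Real.pi * ξ * l)) (M i) (N i)|) := by gcongr
      _ = Real.pi * (l * |partialKernel (s * Real.exp (-2 * Real.pi * Δ * l))
          (Real.exp (-2 * Real.pi * ξ * l)) (M i) (N i)|) := by ring
      _ ≤ _ := by gcongr; exact hb i l hl
  · filter_upwards [ae_restrict_mem measurableSet_Ioc] with l hl
    have hl0 : 0 < l := by linarith [hl.1]
    have hpi := Real.pi_pos
    have hq0 := Real.exp_pos (-2 * Real.pi * Δ * l)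
    have hq1 : Real.exp (-2 * Real.pi * Δ * l) < 1 := by
      rw [Real.exp_lt_one_iff]
      have : 0 < Real.pi * Δ * l := by positivity
      linarith
    have hp : |s * Real.exp (-2 * Real.pi * Δ * l)| < 1 := by
      have habs : |s| = 1 := by rcases hs with rfl | rfl <;> norm_num
      rw [abs_mul, habs, one_mul, abs_of_pos hq0]
      exact hq1
    have hlim := ((tendsto_partialKernel (u := Real.exp (-2 * Real.pi * ξ * l)) hp hM hN).const_mul
      Real.pi).const_mul ((l - a) ^ (2 * m + 1) / (2 * (m : ℝ) + 1))
    have hval : Real.pi * Real.sinh (2 * Real.pi * (Δ - ξ) * l) / dens s Δ l =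
        Real.pi * ((Real.exp (-2 * Real.pi * ξ * l) - (s * Real.exp (-2 * Real.pi * Δ * l)) ^ 2 *
          (Real.exp (-2 * Real.pi * ξ * l))⁻¹) / (1 - s * Real.exp (-2 * Real.pi * Δ * l)) ^ 2) := by
      have e1 : Real.exp (2 * Real.pi * (Δ - ξ) * l) =
          Real.exp (-2 * Real.pi * ξ * l) * (Real.exp (-2 * Real.pi * Δ * l))⁻¹ := by
        rw [← Real.exp_neg, ← Real.exp_add]; ring_nf
      have e2 : Real.exp (-(2 * Real.pi * (Δ - ξ) * l)) =
          Real.exp (-2 * Real.pi * Δ * l) * (Real.exp (-2 * Real.pi * ξ * l))⁻¹ := by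
        rw [← Real.exp_neg (-2 * Real.pi * ξ * l), ← Real.exp_add]; ring_nf
      have e3 : Real.exp (2 * Real.pi * Δ * l) = (Real.exp (-2 * Real.pi * Δ * l))⁻¹ := by
        rw [← Real.exp_neg]; ring_nf
      have e4 : Real.exp (-(2 * Real.pi * Δ * l)) = Real.exp (-2 * Real.pi * Δ * l) := by ring_nf
      have hu0 := Real.exp_pos (-2 * Real.pi * ξ * l)
      have hne : 1 - s * Real.exp (-2 * Real.pi * Δ * l) ≠ 0 := by
        have := (abs_lt.1 hp).2
        intro h; linarith
      have hs2 : s ^ 2 = 1 := by rcases hs with rfl | rfl <;> norm_num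
      unfold dens
      rw [Real.sinh_eq, Real.cosh_eq, e1, e2, e3, e4]
      set q := Real.exp (-2 * Real.pi * Δ * l)
      set u := Real.exp (-2 * Real.pi * ξ * l)
      have hd : (q⁻¹ + q) / 2 - s = (1 - s * q) ^ 2 / (2 * q) := by
        field_simp
        linear_combination -q ^ 2 * hs2
      rw [hd, mul_pow, hs2, one_mul]
      field_simp
    rw [hval]
    exact hlim

omit hα1 hs in
theorem exp_bounds {l : ℝ} (hl : l ∈ Set.Ioc (α - 1 / 2) 1) : 0 < l ∧
    Real.exp (-2 * Real.pi * Δ * l) ≤ Real.exp (-l) ∧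
    Real.exp (-2 * Real.pi * Δ * l) ≤ Real.exp (-2 * Real.pi * ξ * l) ∧
    Real.exp (-2 * Real.pi * ξ * l) ≤ 1 := by
  have hl0 : 0 < l := by linarith [hl.1]
  have hpi := Real.pi_gt_three
  have h2 : 1 ≤ Real.pi * Δ := by nlinarith
  have h3 : 0 ≤ Real.pi * ξ * l := by positivity
  have h4 : Real.pi * ξ * l ≤ Real.pi * Δ * l := by gcongr
  refine ⟨hl0, Real.exp_le_exp.2 ?_, Real.exp_le_exp.2 (by linarith), Real.exp_le_one_iff.2
    (by linarith)⟩
  nlinarith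

end Series

theorem hasSymmetricSum_major {m : ℕ} {α Δ ξ : ℝ} (hα0 : 1 / 2 ≤ α) (hα1 : α ≤ 1)
    (hΔ : 1 ≤ Δ) (h0 : 0 < ξ) (h1 : ξ < Δ) :
    HasSymmetricSum (fun k : ℤ => (fourierTerm m α Δ 1 ξ k : ℂ))
      (realFourier (extremal m (α - 1 / 2) Δ 1) ξ) := by
  refine tendsto_sum_fourierTerm hα0 hα1 (Or.inl rfl) hΔ h0 h1 tendsto_id tendsto_id
    fun N l hl => ?_
  obtain ⟨hl0, hq, hqu, hu⟩ := exp_bounds hα0 hΔ h0 h1 hl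
  exact abs_partialKernel_self_le hl0 hl.2 (Real.exp_pos _) hq hqu hu N

theorem hasBilateralSum_minor {m : ℕ} {α Δ ξ : ℝ} (hα0 : 1 / 2 ≤ α) (hα1 : α ≤ 1)
    (hΔ : 1 ≤ Δ) (h0 : 0 < ξ) (h1 : ξ < Δ) :
    HasBilateralSum (fun k : ℤ => (fourierTerm m α Δ (-1) ξ k : ℂ))
      (realFourier (extremal m (α - 1 / 2) Δ (-1)) ξ) := by
  refine tendsto_sum_fourierTerm hα0 hα1 (Or.inr rfl) hΔ h0 h1
    (M := fun p : ℕ × ℕ => p.1) (N := fun p : ℕ × ℕ => p.2) ?_ ?_ fun p l hl => ?_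
  · rw [← prod_atTop_atTop_eq]
    exact tendsto_fst
  · rw [← prod_atTop_atTop_eq]
    exact tendsto_snd
  · obtain ⟨hl0, hq, hqu, hu⟩ :=
      exp_bounds hα0 hΔ h0 h1 hl
    exact abs_partialKernel_neg_le hl0 hl.2 (Real.exp_pos _) hq hqu hu p.1 p.2

/-! ### Unconditional convergence of the series -/

theorem HasBilateralSum.hasSymmetricSum {f : ℤ → ℂ} {S : ℂ} (h : HasBilateralSum f S) :
    HasSymmetricSum f S := by
  have h1 : Tendsto (fun N : ℕ => (N, N)) atTop (atTop : Filter (ℕ × ℕ)) :=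
    tendsto_atTop_diagonal
  unfold HasBilateralSum at h
  unfold HasSymmetricSum
  have h2 := h.comp h1
  simpa only [Function.comp_def] using h2

theorem HasSymmetricSum.hasSum {f : ℤ → ℂ} {S : ℂ} (h : HasSymmetricSum f S) (hf : Summable f) :
    HasSum f S := by
  have h1 : Tendsto (fun N : ℕ => ∑ k ∈ Finset.Icc (-(N : ℤ)) (N : ℤ), f k) atTop
      (𝓝 (∑' k, f k)) := by
    have := hf.hasSum
    rw [HasSum] at this
    exact this.comp Finset.tendsto_Icc_neg
  rw [tendsto_nhds_unique h h1]
  exact hf.hasSum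

theorem exp_neg_le_div_pow {x : ℝ} (hx : 0 < x) : Real.exp (-x) ≤ 6 / x ^ 3 := by
  have h := Real.pow_div_factorial_le_exp x hx.le 3
  have h3 : ((Nat.factorial 3 : ℕ) : ℝ) = 6 := by norm_num [Nat.factorial]
  rw [h3, div_le_iff₀ (by norm_num)] at h
  rw [Real.exp_neg, inv_eq_one_div, div_le_div_iff₀ (Real.exp_pos x) (by positivity)]
  linarith

/-- Cubic decay in `c` offsets the coefficient `k + 1` and leaves `O(k⁻²)`. It comes from `e^{-ca}`
if `a > 0`, and from `(l-a)^{2m+1} ≤ l³` if `m ≥ 1`. -/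
theorem exists_pow_mul_exp_le {m : ℕ} {a : ℝ} (ha : 0 ≤ a) (h : 0 < a ∨ 1 ≤ m) :
    ∃ C, 0 ≤ C ∧ ∀ l ∈ Set.Ioc a 1, ∀ c : ℝ, 0 < c →
      (l - a) ^ (2 * m + 1) / (2 * m + 1) * Real.exp (-(c * l)) ≤ C / c ^ 3 := by
  rcases h with h | h
  · refine ⟨6 / a ^ 3, by positivity, fun l hl c hc => ?_⟩
    have hl0 : 0 < l := by linarith [hl.1]
    have h2 : (l - a) ^ (2 * m + 1) / (2 * m + 1) ≤ 1 := by
      rw [pow_div_eq_wt_div hl0.ne', div_le_one hl0]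
      refine (wt_le_sq ha hl).trans ?_
      nlinarith [hl.2]
    have h3 : Real.exp (-(c * l)) ≤ 6 / a ^ 3 / c ^ 3 := by
      calc _ ≤ Real.exp (-(c * a)) := by
            apply Real.exp_le_exp.2
            have := mul_le_mul_of_nonneg_left hl.1.le hc.le
            linarith
        _ ≤ 6 / (c * a) ^ 3 := exp_neg_le_div_pow (by positivity)
        _ = _ := by rw [mul_pow, mul_comm, div_div]
    exact (mul_le_of_le_one_left (Real.exp_pos _).le h2).trans h3
  · refine ⟨6, by norm_num, fun l hl c hc => ?_⟩
    have hl0 : 0 < l := by linarith [hl.1]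
    have hla : 0 ≤ l - a := by linarith [hl.1]
    have h2 : (l - a) ^ (2 * m + 1) / (2 * m + 1) ≤ l ^ 3 := by
      have hm : (0 : ℝ) ≤ m := Nat.cast_nonneg m
      calc _ ≤ (l - a) ^ (2 * m + 1) := div_le_self (by positivity) (by linarith)
        _ ≤ (l - a) ^ 3 := pow_le_pow_of_le_one hla (by linarith [hl.2]) (by omega)
        _ ≤ l ^ 3 := by gcongr; linarith
    calc _ ≤ l ^ 3 * (6 / (c * l) ^ 3) := by
          gcongr
          exact exp_neg_le_div_pow (by positivity)
      _ = _ := by field_simp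

theorem summable_fourierTerm {m : ℕ} {α Δ s ξ : ℝ} (hα0 : 1 / 2 ≤ α) (hα1 : α ≤ 1)
    (hs : s = 1 ∨ s = -1) (hΔ : 1 ≤ Δ) (h0 : 0 < ξ) (h1 : ξ < Δ) (h : 1 / 2 < α ∨ 1 ≤ m) :
    Summable fun k : ℤ => (fourierTerm m α Δ s ξ k : ℂ) := by
  set a := α - 1 / 2 with ha
  have ha0 : 0 ≤ a := by linarith
  have hpi := Real.pi_gt_three
  obtain ⟨C, hC0, hC⟩ := exists_pow_mul_exp_le (m := m) ha0
    (h.imp (fun h => by linarith) id)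
  have hsum : Summable fun k : ℤ => (16 * Real.pi * C) * (1 / (k : ℝ) ^ 2) :=
    (Real.summable_one_div_int_pow.2 one_lt_two).mul_left _
  refine Summable.of_norm_bounded_eventually hsum ?_
  filter_upwards [(Set.finite_Icc (-1 : ℤ) 1).compl_mem_cofinite] with k hk
  have hk2 : 2 ≤ |(k : ℝ)| := by
    have : (2 : ℤ) ≤ |k| := by
      by_contra hlt
      exact hk (abs_le.1 (by omega))
    exact_mod_cast this
  have hk0 : (k : ℝ) ≠ 0 := by rintro h; rw [h] at hk2; norm_num at hk2
  -- For `|k| ≥ 2`, `|ξ + kΔ| ≥ |k|Δ - ξ ≥ (|k| - 1)Δ ≥ |k|/2`.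
  have ht : |(k : ℝ)| / 2 ≤ |ξ + k * Δ| := by
    have h2 : |(k : ℝ) * Δ| ≤ |ξ + k * Δ| + |ξ| := by
      have := abs_sub (ξ + k * Δ) ξ
      rwa [show ξ + k * Δ - ξ = k * Δ by ring] at this
    rw [abs_mul, abs_of_pos (by linarith : 0 < Δ), abs_of_pos h0] at h2
    nlinarith
  have htpos : 0 < |ξ + k * Δ| := by linarith
  have hsk : |s ^ k| = 1 := by
    have habs : |s| = 1 := by rcases hs with rfl | rfl <;> norm_num
    rw [abs_zpow, habs, one_zpow]
  have hbound : ∀ l ∈ Set.Ioc a 1, ‖termKernel m a Δ s ξ k l‖ ≤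
      Real.pi * ((|(k : ℝ)| + 1) * (C / (2 * Real.pi * |ξ + k * Δ|) ^ 3)) := by
    intro l hl
    have hn : 0 ≤ (l - a) ^ (2 * m + 1) / (2 * (m : ℝ) + 1) :=
      div_nonneg (pow_nonneg (by linarith [hl.1]) _) (by positivity)
    have h3 := hC l hl (2 * Real.pi * |ξ + k * Δ|) (by positivity)
    have h4 : |(k : ℝ) + 1| ≤ |(k : ℝ)| + 1 := by simpa using abs_add_le (k : ℝ) 1
    unfold termKernel
    rw [Real.norm_eq_abs, abs_mul, abs_mul, abs_mul, abs_mul, hsk, one_mul, abs_of_nonneg hn,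
      abs_of_pos (by linarith : 0 < Real.pi), abs_of_pos (Real.exp_pos _)]
    calc _ = Real.pi * (|(k : ℝ) + 1| * ((l - a) ^ (2 * m + 1) / (2 * m + 1) *
          Real.exp (-(2 * Real.pi * |ξ + k * Δ| * l)))) := by ring
      _ ≤ _ := by gcongr
  rw [fourierTerm_eq hα1 (add_int_mul_ne_zero h0 h1 k), Complex.norm_real]
  have h5 := norm_setIntegral_le_of_norm_le_const (μ := volume) (s := Set.Ioc a 1)
    (by simp) hbound
  refine h5.trans ((mul_le_of_le_one_right (by positivity) ?_).trans ?_)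
  · rw [Real.volume_real_Ioc_of_le (by linarith)]
    linarith
  · have h6 : |(k : ℝ)| / 2 ≤ 2 * Real.pi * |ξ + k * Δ| := by nlinarith
    have hkpos : 0 < |(k : ℝ)| := by linarith
    calc _ ≤ Real.pi * ((|(k : ℝ)| + |(k : ℝ)|) * (C / (|(k : ℝ)| / 2) ^ 3)) := by
          gcongr
          linarith
      _ = 16 * Real.pi * C * (1 / |(k : ℝ)| ^ 2) := by field_simp; ring
      _ = _ := by rw [sq_abs]

theorem norm_realFourier_le {g : ℂ → ℂ} {C : ℝ} (hg : ∀ x : ℝ, ‖g x‖ ≤ C * (1 + x ^ 2)⁻¹) (ξ : ℝ) :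
    ‖realFourier g ξ‖ ≤ C * Real.pi := by
  have hpi : C * Real.pi = ∫ x : ℝ, C * (1 + x ^ 2)⁻¹ := by
    rw [integral_const_mul, integral_univ_inv_one_add_sq]
  rw [realFourier_eq, hpi]
  refine norm_integral_le_of_norm_le (integrable_inv_one_add_sq.const_mul C)
    (Eventually.of_forall fun x => ?_)
  have h4 : ‖Complex.exp (-2 * Real.pi * Complex.I * x * ξ)‖ = 1 := by
    rw [Complex.norm_exp]
    simp
  rw [norm_mul, h4, mul_one]
  exact hg x

theorem mainTheorem6 (m : ℕ) :
    ∃ C : ℝ, 0 < C ∧ ∀ α Δ : ℝ, 1 / 2 ≤ α → α ≤ 1 → 1 ≤ Δ →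
      ∃ gm gp : ℂ → ℂ,
        -- existence and uniqueness of the extremal pair
        IsExtremalPair (fOdd m α) (2 * Real.pi * Δ) gm gp ∧
        (∀ hm hp : ℂ → ℂ, IsExtremalPair (fOdd m α) (2 * Real.pi * Δ) hm hp →
          hm = gm ∧ hp = gp) ∧
        -- evenness
        (∀ z : ℂ, gm (-z) = gm z) ∧ (∀ z : ℂ, gp (-z) = gp z) ∧
        -- growth bounds
        (∀ x : ℝ, ‖gm (x : ℂ)‖ ≤ C / (1 + x ^ 2)) ∧
        (∀ x : ℝ, ‖gp (x : ℂ)‖ ≤ C / (1 + x ^ 2)) ∧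
        (∀ z : ℂ, ‖gm z‖ ≤
          C * (Δ ^ 2 * Real.exp (2 * Real.pi * Δ * |z.im|) / (1 + Δ * ‖z‖))) ∧
        (∀ z : ℂ, ‖gp z‖ ≤
          C * (Δ ^ 2 * Real.exp (2 * Real.pi * Δ * |z.im|) / (1 + Δ * ‖z‖))) ∧
        -- Fourier transforms
        Integrable (fun x : ℝ => gm (x : ℂ)) ∧ Integrable (fun x : ℝ => gp (x : ℂ)) ∧
        Continuous (realFourier gm) ∧ Continuous (realFourier gp) ∧
        (∀ ξ : ℝ, Δ < |ξ| → realFourier gm ξ = 0) ∧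
        (∀ ξ : ℝ, Δ < |ξ| → realFourier gp ξ = 0) ∧
        (∀ ξ : ℝ, ‖realFourier gm ξ‖ ≤ C) ∧ (∀ ξ : ℝ, ‖realFourier gp ξ‖ ≤ C) ∧
        -- distances to the function in the mean
        Integrable (fun x : ℝ => (gp (x : ℂ)).re - fOdd m α x) ∧
        (∫ x : ℝ, ((gp (x : ℂ)).re - fOdd m α x)) = -(1 / Δ) * logRatioIntegral m α Δ 1 ∧
        Integrable (fun x : ℝ => fOdd m α x - (gm (x : ℂ)).re) ∧
        (∫ x : ℝ, (fOdd m α x - (gm (x : ℂ)).re)) = 1 / Δ * logRatioIntegral m α Δ (-1) ∧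
        -- values of the Fourier transforms at the origin
        realFourier gp 0 =
          ((Real.pi * (3 / 2 - α) ^ (2 * m + 2) / ((2 * (m : ℝ) + 1) * (2 * (m : ℝ) + 2))
            - 1 / Δ * logRatioIntegral m α Δ 1 : ℝ) : ℂ) ∧
        realFourier gm 0 =
          ((Real.pi * (3 / 2 - α) ^ (2 * m + 2) / ((2 * (m : ℝ) + 1) * (2 * (m : ℝ) + 2))
            - 1 / Δ * logRatioIntegral m α Δ (-1) : ℝ) : ℂ) ∧
        -- evenness and series expansions of the Fourier transforms; the convergence is
        -- unconditional except when `m = 0` and `α = 1/2`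
        (∀ ξ : ℝ, realFourier gm (-ξ) = realFourier gm ξ) ∧
        (∀ ξ : ℝ, realFourier gp (-ξ) = realFourier gp ξ) ∧
        (∀ ξ : ℝ, 0 < ξ → ξ < Δ →
          HasSymmetricSum (fun k : ℤ => (fourierTerm m α Δ 1 ξ k : ℂ)) (realFourier gp ξ) ∧
          HasBilateralSum (fun k : ℤ => (fourierTerm m α Δ (-1) ξ k : ℂ)) (realFourier gm ξ) ∧
          (1 / 2 < α ∨ 1 ≤ m →
            HasSum (fun k : ℤ => (fourierTerm m α Δ 1 ξ k : ℂ)) (realFourier gp ξ) ∧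
            HasSum (fun k : ℤ => (fourierTerm m α Δ (-1) ξ k : ℂ)) (realFourier gm ξ))) := by
  -- The complex growth bound dictates 128; the real bound needs only 3 and the Fourier bound `3π`.
  -- The constant is even independent of `m`.
  refine ⟨128, by norm_num, fun α Δ h0 h1 hΔ => ?_⟩
  have ha0 : 0 ≤ α - 1 / 2 := by linarith
  have ha1 : α - 1 / 2 ≤ 1 := by linarith
  have hΔ0 : 0 < Δ := by linarith
  have hp : (1 : ℝ) = 1 ∨ (1 : ℝ) = -1 := Or.inl rfl
  have hm : (-1 : ℝ) = 1 ∨ (-1 : ℝ) = -1 := Or.inr rfl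
  have hdiff : ∀ s : ℝ, (s = 1 ∨ s = -1) → (fun x : ℝ => (extremal m (α - 1 / 2) Δ s x).re -
      fOdd m α x) = remainder m (α - 1 / 2) Δ s := by
    intro s hs
    funext x
    rw [extremal_ofReal_eq_fOdd h0 h1 hΔ hs, Complex.ofReal_re]
    ring
  have hdiff' : (fun x : ℝ => fOdd m α x - (extremal m (α - 1 / 2) Δ (-1) x).re) =
      fun x => -remainder m (α - 1 / 2) Δ (-1) x := by
    rw [← hdiff (-1) hm]
    funext x
    ring
  have hlog : ∀ s : ℝ, (s = 1 ∨ s = -1) → ∫ l in Set.Ioc (α - 1 / 2) 1,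
      (l - (α - 1 / 2)) ^ (2 * m + 1) / (2 * m + 1) * logDens s Δ l = -logRatioIntegral m α Δ s := by
    intro s hs
    rw [logRatioIntegral_eq h0 h1 hΔ0 hs, neg_neg]
  have hreal : ∀ s : ℝ, (s = 1 ∨ s = -1) → ∀ x : ℝ, ‖extremal m (α - 1 / 2) Δ s x‖ ≤
      128 / (1 + x ^ 2) := by
    intro s hs x
    rw [div_eq_mul_inv]
    refine (norm_extremal_ofReal_le ha0 ha1 hs hΔ x).trans ?_
    exact mul_le_mul_of_nonneg_right (by norm_num) (by positivity)
  have hfour : ∀ s : ℝ, (s = 1 ∨ s = -1) → ∀ ξ : ℝ,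
      ‖realFourier (extremal m (α - 1 / 2) Δ s) ξ‖ ≤ 128 := by
    intro s hs ξ
    refine (norm_realFourier_le (norm_extremal_ofReal_le ha0 ha1 hs hΔ) ξ).trans ?_
    linarith [Real.pi_lt_four]
  have hzero : ∀ s : ℝ, (s = 1 ∨ s = -1) → realFourier (extremal m (α - 1 / 2) Δ s) 0 =
      ((Real.pi * (3 / 2 - α) ^ (2 * m + 2) / ((2 * (m : ℝ) + 1) * (2 * (m : ℝ) + 2))
            - 1 / Δ * logRatioIntegral m α Δ s : ℝ) : ℂ) := by
    intro s hs
    rw [realFourier_extremal_zero ha0 ha1 hs hΔ, hlog s hs]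
    congr 1
    ring
  refine ⟨extremal m (α - 1 / 2) Δ (-1), extremal m (α - 1 / 2) Δ 1,
    ⟨isAdmissiblePair_extremal h0 h1 hΔ, fun _ _ h => (extremal_pair_optimal h0 h1 hΔ h).1⟩,
    fun _ _ h => (extremal_pair_optimal h0 h1 hΔ h.1).2
      (h.2 _ _ (isAdmissiblePair_extremal h0 h1 hΔ)),
    extremal_neg _ _ _ _, extremal_neg _ _ _ _, hreal _ hm, hreal _ hp,
    norm_extremal_le ha0 ha1 hm hΔ, norm_extremal_le ha0 ha1 hp hΔ,
    integrable_extremal ha0 hm hΔ, integrable_extremal ha0 hp hΔ,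
    continuous_realFourier (integrable_extremal ha0 hm hΔ),
    continuous_realFourier (integrable_extremal ha0 hp hΔ),
    fun _ => realFourier_extremal_eq_zero ha0 hm hΔ, fun _ => realFourier_extremal_eq_zero ha0 hp hΔ,
    hfour _ hm, hfour _ hp, ?_, ?_, ?_, ?_, hzero _ hp, hzero _ hm,
    realFourier_neg (extremal_neg _ _ _ _), realFourier_neg (extremal_neg _ _ _ _),
    fun ξ hξ0 hξ1 => ⟨hasSymmetricSum_major h0 h1 hΔ hξ0 hξ1,
      hasBilateralSum_minor h0 h1 hΔ hξ0 hξ1, fun h =>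
      ⟨(hasSymmetricSum_major h0 h1 hΔ hξ0 hξ1).hasSum
        (summable_fourierTerm h0 h1 hp hΔ hξ0 hξ1 h),
      (hasBilateralSum_minor h0 h1 hΔ hξ0 hξ1).hasSymmetricSum.hasSum
        (summable_fourierTerm h0 h1 hm hΔ hξ0 hξ1 h)⟩⟩⟩
  · rw [hdiff 1 hp]
    exact integrable_remainder ha0 hp hΔ
  · rw [hdiff 1 hp, integral_remainder ha0 ha1 hp hΔ, hlog 1 hp]
    ring
  · rw [hdiff']
    exact (integrable_remainder ha0 hm hΔ).neg
  · rw [hdiff', integral_neg, integral_remainder ha0 ha1 hm hΔ, hlog (-1) hm]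
    ring
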